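/- Let $x\circ y=x_1y_1+\dots+x_4y_4-x_5y_5$ on $\mathbb{R}^5$ and $\mathbb{H}^4=\{x : x\circ x=-1,\ x_5>0\}$. Let $e_1,\dots,e_5\in\mathbb{R}^5$ have Gram matrix $G=(e_i\circ e_j)=(-\cos(\pi/m_{ij}))$, where $m_{ii}=1$, $m_{12}=m_{34}=5$, $m_{14}=m_{23}=m_{25}=m_{45}=3$, $m_{ij}=2$ for the other pairs $i<j$, and $m_{ji}=m_{ij}$; the sign of $(e_i)$ is chosen so that $\{x\in\mathbb{H}^4 : x\circ e_i\le 0\ \forall i\}\neq\emptyset$. Put $w_i=\sum_k \mathrm{cof}_{ik}(G)\,e_k$ and $v_i=w_i/\sqrt{w_i\circ w_i}$, and let $$T=\{x\in\mathbb{H}^4 : x\circ e_i\le 0 \text{ and } x\circ v_i\le 0 \text{ for } i=1,\dots,5\},$$ a compact Coxeter polytope, determined up to isometry. Its orthogonal facets are $F_i=T\cap v_i^{\perp}$ ($1\le i\le 5$), where $v^\perp=\{x : x\circ v=0\}$. The facets $F_1,F_3$ are of type $A$ (their Coxeter graph is a 4-cycle with labels $5,3,3,3$), $F_2,F_4$ are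 of type $B$ (a node joined to three others, with labels $5,3,3$), and $F_5$ is of type $C$ (a 4-cycle with labels $5,3,5,3$). Let $D\subset\mathbb{H}^4$ be a polytope obtained from $n+1\geq 1$ copies of $T$ by $n$ successive gluings along orthogonal facets of the same type: $\ell$ times along type $A$, $m$ times along type $B$, and $n-\ell-m$ times along type $C$. Here gluing two polytopes along an orthogonal facet means placing them on opposite sides of a hyperplane so that they have in it a common orthogonal facet, and taking the union. Let $S$ be the set of reflections in the hyperplanes that carry the facets of $D$, let $W$ be the group generated by $S$, and let $W_{\ell,m,n}(t)=\sum_{k\ge0}a_kt^k$ be its growth series, where $a_k$ is the number of $w\in W$ of word length $k$ with respect to $S$. Then $D$ has finitely many facets, and $W_{\ell,m,n}(t)$ is the expansion at $0$ of the rational function $P_{\ell,m,n}(t)/Q_{\ell,m,n}(t)$, where, with $[k]=1+t+\dots+t^{k-1}$ and $\Phi_k$ the $k$-th cyclotomic polynomial, $$P_{\ell,m,n}(t)=[2][4][6][10]=\Phi_2(t)^4\Phi_3(t)\Phi_4(t)\Phi_5(t)\Phi_6(t)\Phi_{10}(t)$$ and $$\begin{aligned}Q_{\ell,m,n}(t)={}&t^{18}-(4n+6)t^{17}+(2n-m+3)t^{16}-(3n-m+\ell+5)t^{15}+(5n-3m+5)t^{14}\\&-(n-4m+1)t^{13}+(8n-4m+\ell+9)t^{12}+(5m-\ell)t^{11}+(10n-5m+\ell+11)t^{10}\\&-(2n-6m+2)t^{9}+(10n-5m+\ell+11)t^{8}+(5m-\ell)t^{7}+(8n-4m+\ell+9)t^{6}\\&-(n-4m+1)t^{5}+(5n-3m+5)t^{4}-(3n-m+\ell+5)t^{3}+(2n-m+3)t^{2}-(4n+6)t+1.\end{aligned}$$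 The polynomial $Q_{\ell,m,n}$ is palindromic of degree $18$, and $P_{\ell,m,n}$ and $Q_{\ell,m,n}$ are relatively prime in $\mathbb{Z}[t]$ (every common divisor is a unit). -/

import Mathlib

noncomputable section

namespace CoxeterDomino

/-! ## Hyperbolic space and convex polytopes in it -/

/-- The underlying vector space of the Lorentzian space of signature `(4,1)`. -/
abbrev LSpace : Type := Fin 5 → ℝ

/-- The Lorentzian inner product `x₁y₁ + ⋯ + x₄y₄ - x₅y₅`. -/
def lor (x y : LSpace) : ℝ :=
  (∑ i : Fin 4, x i.castSucc * y i.castSucc) - x (Fin.last 4) * y (Fin.last 4)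

/-- Hyperbolic 4-space: the upper sheet of the hyperboloid. -/
def hyp4 : Set LSpace := {x | lor x x = -1 ∧ 0 < x (Fin.last 4)}

/-- The hyperplane (Lorentzian orthogonal complement of `e`). -/
def perp (e : LSpace) : Set LSpace := {x | lor x e = 0}

/-- The part of hyperbolic 4-space cut out by the half spaces `x ∘ (e i) ≤ 0`. -/
def polyhedron {ι : Type} (e : ι → LSpace) : Set LSpace :=
  {x | x ∈ hyp4 ∧ ∀ i, lor x (e i) ≤ 0}

/-- The outward unit normal vectors of the facets of a 4-dimensional polytope `P`: unit
space-like vectors `e` such that `P` lies in the half space `x ∘ e ≤ 0` and the face `P ∩ e^L`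
is 3-dimensional, that is, it spans the 4-dimensional linear hyperplane `e^L`. -/
def facetNormals (P : Set LSpace) : Set LSpace :=
  {e | lor e e = 1 ∧ (∀ x ∈ P, lor x e ≤ 0) ∧
    ∀ y ∈ perp e, y ∈ Submodule.span ℝ (P ∩ perp e)}

/-- The reflections in the hyperplanes bounding `P`. They act on the Lorentzian space and, by
restriction, faithfully on hyperbolic space. -/
def facetReflections (P : Set LSpace) : Set (LSpace ≃ₗ[ℝ] LSpace) :=
  {s | ∃ e ∈ facetNormals P, ∀ x, s x = x - (2 * lor x e) • e}

/-! ## Growth series -/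

/-- `k` is the word length of `g` with respect to `S`: the smallest length of a word in `S` that
represents `g`. (If the elements of `S` are involutions, the elements with such a word are exactly
those of the group generated by `S`.) -/
def HasWordLength {G : Type*} [Group G] (S : Set G) (g : G) (k : ℕ) : Prop :=
  IsLeast {n : ℕ | ∃ w : List G, w.length = n ∧ (∀ s ∈ w, s ∈ S) ∧ w.prod = g} k

/-- The growth series `∑ₖ aₖ tᵏ`, with `aₖ` the number of elements of word length `k`. -/
def growthSeries {G : Type*} [Group G] (S : Set G) : PowerSeries ℤ :=
  PowerSeries.mk fun k => (({g : G | HasWordLength S g k}.ncard : ℕ) : ℤ)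

/-! ## The totally truncated simplex `T` -/

/-- The labels of the Coxeter graph of the extended simplex: a 4-cycle on the nodes `0, 1, 2, 3`
with consecutive labels `5, 3, 5, 3`, and a node `4` joined to the nodes `1` and `3` by edges with
label `3`. -/
def label : Matrix (Fin 5) (Fin 5) ℕ :=
  !![1, 5, 2, 3, 2;
     5, 1, 3, 2, 3;
     2, 3, 1, 5, 2;
     3, 2, 5, 1, 3;
     2, 3, 2, 3, 1]

/-- The Gram matrix of the extended simplex. -/
def gram : Matrix (Fin 5) (Fin 5) ℝ := fun i j => -Real.cos (Real.pi / (label i j : ℝ))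

/-- `e` is the system of outward unit normals of an extended simplex in hyperbolic 4-space with
Gram matrix `gram`. Two such systems differ by an isometry of hyperbolic 4-space. (A system with
this Gram matrix is unique up to a Lorentz transformation; exactly one of `e` and `-e` cuts out a
nonempty subset of the upper sheet.) -/
def IsSimplexFrame (e : Fin 5 → LSpace) : Prop :=
  (∀ i j, lor (e i) (e j) = gram i j) ∧ (polyhedron e).Nonempty

/-- The vector `wᵢ = ∑ₖ cofᵢₖ eₖ`, which is orthogonal to `eⱼ` for all `j ≠ i`. -/
def dualVec (e : Fin 5 → LSpace) (i : Fin 5) : LSpace :=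
  ∑ k, gram.adjugate i k • e k

/-- The `i`-th ultraideal vertex: the vector `wᵢ`, which is space-like, scaled to length `1`. -/
def vertex (e : Fin 5 → LSpace) (i : Fin 5) : LSpace :=
  (Real.sqrt (lor (dualVec e i) (dualVec e i)))⁻¹ • dualVec e i

/-- The copy of the polytope `T` with simplex normals `e`: the extended simplex, truncated by the
polar hyperplanes of all its five ultraideal vertices. -/
def truncatedSimplex (e : Fin 5 → LSpace) : Set LSpace :=
  {x | x ∈ polyhedron e ∧ ∀ i, lor x (vertex e i) ≤ 0}

/-- The three types of orthogonal facets. -/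
inductive FacetType where
  | A
  | B
  | C
  deriving DecidableEq

/-- The type of the `i`-th orthogonal facet of `T`, a compact Coxeter tetrahedron whose Coxeter
graph arises from that of the simplex by deleting the node `i`. Type `A`: a 4-cycle with labels
`5, 3, 3, 3`. Type `B`: three nodes joined to a fourth one by edges with labels `5, 3, 3`.
Type `C`: a 4-cycle with labels `5, 3, 5, 3`. -/
def facetType : Fin 5 → FacetType := ![.A, .B, .A, .B, .C]

/-! ## Gluing -/

/-- `IsDomino ℓ m n P O`: the set `P` in hyperbolic 4-space is obtained from `n + 1` copies of `T`
by gluing `n` times along orthogonal facets of the same type, `ℓ` times along type `A`, `m` times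
along type `B` and the other times along type `C`; and `O X` is the set of the outward unit normals
of those orthogonal facets of type `X` of the copies along which no gluing has taken place.

Gluing `P₁` and `P₂` means to place them on the two sides of a hyperplane `f^L` such that the same
subset of `f^L` is an orthogonal facet of both, and to form the union. -/
inductive IsDomino : ℕ → ℕ → ℕ → Set LSpace → (FacetType → Set LSpace) → Prop
  | copy (e : Fin 5 → LSpace) (he : IsSimplexFrame e) :
      IsDomino 0 0 0 (truncatedSimplex e) (fun X => {v | ∃ i, facetType i = X ∧ v = vertex e i})
  | glue {ℓ₁ m₁ n₁ ℓ₂ m₂ n₂ : ℕ} {P₁ P₂ : Set LSpace} {O₁ O₂ : FacetType → Set LSpace}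
      (h₁ : IsDomino ℓ₁ m₁ n₁ P₁ O₁) (h₂ : IsDomino ℓ₂ m₂ n₂ P₂ O₂)
      (X : FacetType) (f : LSpace) (hf₁ : f ∈ O₁ X) (hf₂ : -f ∈ O₂ X)
      (hF : P₁ ∩ perp f = P₂ ∩ perp f) :
      IsDomino (ℓ₁ + ℓ₂ + if X = .A then 1 else 0) (m₁ + m₂ + if X = .B then 1 else 0)
        (n₁ + n₂ + 1) (P₁ ∪ P₂) (fun Y => (O₁ Y \ {f}) ∪ (O₂ Y \ {-f}))

/-! ## The numerator and the denominator -/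

open Polynomial in
/-- The polynomial `[k] = 1 + t + ⋯ + t^(k-1)`. -/
def bracket (k : ℕ) : ℤ[X] := ∑ i ∈ Finset.range k, X ^ i

open Polynomial in
/-- `[2,4,6,10] = [2][4][6][10]`. -/
def numP : ℤ[X] := bracket 2 * bracket 4 * bracket 6 * bracket 10

open Polynomial in
/-- The denominator polynomial, for integers `l`, `m`, `n`. -/
def denQ (l m n : ℤ) : ℤ[X] :=
  X ^ 18 - C (4 * n + 6) * X ^ 17 + C (2 * n - m + 3) * X ^ 16 - C (3 * n - m + l + 5) * X ^ 15
    + C (5 * n - 3 * m + 5) * X ^ 14 - C (n - 4 * m + 1) * X ^ 13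
    + C (8 * n - 4 * m + l + 9) * X ^ 12 + C (5 * m - l) * X ^ 11
    + C (10 * n - 5 * m + l + 11) * X ^ 10 - C (2 * n - 6 * m + 2) * X ^ 9
    + C (10 * n - 5 * m + l + 11) * X ^ 8 + C (5 * m - l) * X ^ 7
    + C (8 * n - 4 * m + l + 9) * X ^ 6 - C (n - 4 * m + 1) * X ^ 5
    + C (5 * n - 3 * m + 5) * X ^ 4 - C (3 * n - m + l + 5) * X ^ 3
    + C (2 * n - m + 3) * X ^ 2 - C (4 * n + 6) * X + 1

end CoxeterDomino

end

noncomputable section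

namespace CoxeterDomino

/-! ## Word length -/

/-! The group W is studied as a linear reflection group, without an abstract Coxeter presentation. A
root basis is a set R of unit vectors whose mutual products are -cos(π/m) or at most -1 and on which
some linear functional is positive; linear independence is not required, since a domino has more
than five facets. For w in the group and a in R, the vector w a is a nonnegative or a nonpositive
combination of R, and its sign decides whether w s_a is longer or shorter than w
(`mem_hull_of_rlen_le`). This yields unique factorization with additive lengths along every
parabolic subgroup W_T and, by an alternating count over descent sets, Steinberg's formula: 1/W_R(t)
is the sum of (-1)^|T| t^N / W_T(t) over the subsets T for which W_T has a longest element, N being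
its length (`sum_growthTerm`).

Two rules follow. If all products between R₁ \ R₂ and R₂ \ R₁ are at most -1, then 1/W_{R₁ ∪ R₂} +
1/W_{R₁ ∩ R₂} = 1/W_{R₁} + 1/W_{R₂}; and an additional root orthogonal to all others multiplies W by
1 + t. Moreover, Möbius inversion of Steinberg's formula computes 1/W_R from proper parabolic
subgroups: for dihedral groups, A₃ and H₃ by means of a longest element, for the tetrahedral facet
groups and the simplex group from the absence of one.

The geometry has to supply a root basis of facet normals with the right incidences. Four facet
normals, the set E, are orthogonal to the normal f of an orthogonal facet, and every other one has
product at most -1 with f. Adding the five truncating facets to the simplex one by one gives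
Q_{0,0,0}. Gluing along f deletes f and -f and identifies the two copies of E; normals outside E on
different sides have product at most -1. The two rules then give 1/W = 1/W₁ + 1/W₂ + ((t - 1)/(t +
1))/W_E, and induction over the gluings gives Q (`IsDominoSystem.glue`).

P is a product of cyclotomic polynomials. Each of them leaves a nonzero remainder in Q, by explicit
division and the inequality ℓ + m ≤ n. -/

section WordLength

variable {G : Type*} [Group G] {S T : Set G} {g h s : G}

/-- The smallest length of a word in `S` that represents `g` (and `0` if there is none). -/
def wordLength (S : Set G) (g : G) : ℕ :=
  sInf {n | ∃ w : List G, w.length = n ∧ (∀ s ∈ w, s ∈ S) ∧ w.prod = g}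

theorem wordLength_prod_le {w : List G} (hw : ∀ s ∈ w, s ∈ S) :
    wordLength S w.prod ≤ w.length :=
  Nat.sInf_le ⟨w, rfl, hw, rfl⟩

theorem list_prod_mem_closure {w : List G} (hw : ∀ s ∈ w, s ∈ S) :
    w.prod ∈ Subgroup.closure S :=
  Subgroup.list_prod_mem _ fun s hs => Subgroup.subset_closure (hw s hs)

theorem exists_word (hS : ∀ s ∈ S, s * s = 1) (hg : g ∈ Subgroup.closure S) :
    ∃ w : List G, w.length = wordLength S g ∧ (∀ s ∈ w, s ∈ S) ∧ w.prod = g := by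
  have hne : {n | ∃ w : List G, w.length = n ∧ (∀ s ∈ w, s ∈ S) ∧ w.prod = g}.Nonempty := by
    rw [← Subgroup.mem_toSubmonoid, Subgroup.closure_toSubmonoid] at hg
    obtain ⟨l, hl, hp⟩ := Submonoid.exists_list_of_mem_closure hg
    refine ⟨l.length, l, rfl, fun s hs => ?_, hp⟩
    rcases hl s hs with h | h
    · exact h
    · have := hS _ h
      rw [mul_eq_one_iff_eq_inv, inv_inv] at this
      rwa [← this]
  exact Nat.sInf_mem hne

theorem hasWordLength_iff (hS : ∀ s ∈ S, s * s = 1) {k : ℕ} :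
    HasWordLength S g k ↔ g ∈ Subgroup.closure S ∧ wordLength S g = k := by
  constructor
  · intro h
    obtain ⟨w, -, hw, rfl⟩ := h.1
    exact ⟨list_prod_mem_closure hw, h.csInf_eq⟩
  · rintro ⟨hg, rfl⟩
    exact ⟨exists_word hS hg, fun n hn => Nat.sInf_le hn⟩

@[simp]
theorem wordLength_one : wordLength S (1 : G) = 0 :=
  Nat.le_zero.1 (wordLength_prod_le (S := S) (w := []) (by simp))

theorem wordLength_eq_zero_iff (hS : ∀ s ∈ S, s * s = 1) (hg : g ∈ Subgroup.closure S) :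
    wordLength S g = 0 ↔ g = 1 := by
  refine ⟨fun h => ?_, fun h => h ▸ wordLength_one⟩
  obtain ⟨w, hl, -, rfl⟩ := exists_word hS hg
  rw [h, List.length_eq_zero_iff] at hl
  simp [hl]

theorem wordLength_mul_le (hS : ∀ s ∈ S, s * s = 1) (hg : g ∈ Subgroup.closure S)
    (hh : h ∈ Subgroup.closure S) :
    wordLength S (g * h) ≤ wordLength S g + wordLength S h := by
  obtain ⟨w, hl, hw, rfl⟩ := exists_word hS hg
  obtain ⟨w', hl', hw', rfl⟩ := exists_word hS hh
  rw [← hl, ← hl', ← List.prod_append, ← List.length_append]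
  exact wordLength_prod_le fun s hs => (List.mem_append.1 hs).elim (hw s) (hw' s)

theorem wordLength_le_one (hs : s ∈ S) : wordLength S s ≤ 1 := by
  simpa using wordLength_prod_le (S := S) (w := [s]) (by simpa using hs)

theorem wordLength_mul_gen_le (hS : ∀ s ∈ S, s * s = 1) (hg : g ∈ Subgroup.closure S)
    (hs : s ∈ S) : wordLength S (g * s) ≤ wordLength S g + 1 :=
  (wordLength_mul_le hS hg (Subgroup.subset_closure hs)).trans
    (Nat.add_le_add_left (wordLength_le_one hs) _)

theorem wordLength_gen_mul_le (hS : ∀ s ∈ S, s * s = 1) (hg : g ∈ Subgroup.closure S)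
    (hs : s ∈ S) : wordLength S (s * g) ≤ wordLength S g + 1 :=
  (wordLength_mul_le hS (Subgroup.subset_closure hs) hg).trans
    ((Nat.add_le_add_right (wordLength_le_one hs) _).trans_eq (add_comm _ _))

theorem wordLength_le_mul_gen (hS : ∀ s ∈ S, s * s = 1) (hg : g ∈ Subgroup.closure S)
    (hs : s ∈ S) : wordLength S g ≤ wordLength S (g * s) + 1 := by
  have := wordLength_mul_gen_le hS (mul_mem hg (Subgroup.subset_closure hs)) hs
  rwa [mul_assoc, hS s hs, mul_one] at this

theorem exists_wordLength_mul_add_one (hS : ∀ s ∈ S, s * s = 1) (hg : g ∈ Subgroup.closure S)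
    (h1 : g ≠ 1) : ∃ s ∈ S, wordLength S (g * s) + 1 = wordLength S g := by
  obtain ⟨w, hl, hw, rfl⟩ := exists_word hS hg
  rcases List.eq_nil_or_concat w with rfl | ⟨w', s, rfl⟩
  · simp at h1
  have hs : s ∈ S := hw s (by simp)
  have hw' : ∀ t ∈ w', t ∈ S := fun t ht => hw t (by simp [ht])
  refine ⟨s, hs, le_antisymm ?_ (wordLength_le_mul_gen hS hg hs)⟩
  rw [← hl]
  simpa [mul_assoc, hS s hs] using wordLength_prod_le hw'

theorem wordLength_mono (hT : ∀ s ∈ T, s * s = 1) (hTS : T ⊆ S)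
    (hg : g ∈ Subgroup.closure T) : wordLength S g ≤ wordLength T g := by
  obtain ⟨w, hl, hw, rfl⟩ := exists_word hT hg
  exact hl ▸ wordLength_prod_le fun s hs => hTS (hw s hs)

theorem finite_setOf_wordLength_eq (hS : ∀ s ∈ S, s * s = 1) (hf : S.Finite) (k : ℕ) :
    {g | g ∈ Subgroup.closure S ∧ wordLength S g = k}.Finite := by
  have := hf.to_subtype
  refine ((List.finite_length_eq S k).image fun w => (w.map Subtype.val).prod).subset ?_
  rintro g ⟨hg, rfl⟩
  obtain ⟨w, hl, hw, rfl⟩ := exists_word hS hg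
  refine ⟨w.attach.map fun x => ⟨x.1, hw _ x.2⟩, by simpa using hl, ?_⟩
  simp [Function.comp_def]

end WordLength

end CoxeterDomino

end

noncomputable section

namespace CoxeterDomino

/-! ## Reflections and root bases -/

section Reflection

variable {V : Type*} [AddCommGroup V] [Module ℝ V] {B : LinearMap.BilinForm ℝ V}

/-- The reflection in the hyperplane orthogonal to the unit vector `a` (and the identity if `a` is
not a unit vector). -/
def refl (B : LinearMap.BilinForm ℝ V) (a : V) : V ≃ₗ[ℝ] V :=
  if h : B a a = 1 then Module.reflection (x := a) (f := (2 : ℝ) • B a) (by simp [h]) else 1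

theorem refl_apply {a : V} (h : B a a = 1) (x : V) : refl B a x = x - (2 * B a x) • a := by
  simp [refl, h, Module.reflection_apply]

theorem refl_self {a : V} (h : B a a = 1) : refl B a a = -a := by
  rw [refl_apply h, h]
  module

theorem refl_mul_self (a : V) : refl B a * refl B a = 1 := by
  by_cases h : B a a = 1
  · ext x
    simp only [LinearEquiv.mul_apply, refl_apply h, map_sub, map_smul, smul_eq_mul, h,
      LinearEquiv.coe_one, id]
    module
  · simp [refl, h]

/-- The set of reflections in the vectors of `R`. -/
def refls (B : LinearMap.BilinForm ℝ V) (R : Set V) : Set (V ≃ₗ[ℝ] V) := refl B '' R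

theorem mul_self_of_mem_refls {R : Set V} {s : V ≃ₗ[ℝ] V} (hs : s ∈ refls B R) : s * s = 1 := by
  obtain ⟨a, -, rfl⟩ := hs
  exact refl_mul_self a

theorem refl_mem_refls {R : Set V} {a : V} (ha : a ∈ R) : refl B a ∈ refls B R := ⟨a, ha, rfl⟩

theorem refls_mono {R R' : Set V} (h : R ⊆ R') : refls B R ⊆ refls B R' := Set.image_mono h

/-- The group generated by the reflections in the vectors of `R`. -/
def reflGroup (B : LinearMap.BilinForm ℝ V) (R : Set V) : Subgroup (V ≃ₗ[ℝ] V) :=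
  Subgroup.closure (refls B R)

/-- The word length with respect to the reflections in the vectors of `R`. -/
def rlen (B : LinearMap.BilinForm ℝ V) (R : Set V) (g : V ≃ₗ[ℝ] V) : ℕ := wordLength (refls B R) g

theorem refl_mem_reflGroup {R : Set V} {a : V} (ha : a ∈ R) : refl B a ∈ reflGroup B R :=
  Subgroup.subset_closure (refl_mem_refls ha)

theorem reflGroup_mono {R R' : Set V} (h : R ⊆ R') : reflGroup B R ≤ reflGroup B R' :=
  Subgroup.closure_mono (refls_mono h)

theorem map_refl (hB : ∀ x y, B x y = B y x) (a x y : V) : B (refl B a x) (refl B a y) = B x y := by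
  by_cases h : B a a = 1
  · simp only [refl_apply h, map_sub, map_smul, LinearMap.sub_apply, LinearMap.smul_apply,
      smul_eq_mul, h, hB x a]
    ring
  · simp [refl, h]

theorem map_of_mem_reflGroup (hB : ∀ x y, B x y = B y x) {R : Set V} {g : V ≃ₗ[ℝ] V}
    (hg : g ∈ reflGroup B R) : ∀ x y, B (g x) (g y) = B x y := by
  induction hg using Subgroup.closure_induction with
  | mem s hs => obtain ⟨a, -, rfl⟩ := hs; exact map_refl hB a
  | one => simp
  | mul g h _ _ ihg ihh => intro x y; rw [LinearEquiv.mul_apply, LinearEquiv.mul_apply, ihg, ihh]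
  | inv g _ ih =>
    intro x y
    rw [← ih, ← LinearEquiv.mul_apply, ← LinearEquiv.mul_apply, mul_inv_cancel]
    simp

theorem mul_refl_of_isometry {g : V ≃ₗ[ℝ] V} (hg : ∀ x y, B (g x) (g y) = B x y) {a : V}
    (ha : B a a = 1) : refl B (g a) * g = g * refl B a := by
  have hga : B (g a) (g a) = 1 := by rw [hg, ha]
  ext x
  simp only [LinearEquiv.mul_apply, refl_apply ha, refl_apply hga, hg, map_sub, map_smul]

end Reflection

/-! ## Dihedral groups -/

section Dihedral

/-- The Chebyshev numbers `sin (k θ) / sin θ` for `c = cos θ`. -/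
def chebU (c : ℝ) : ℕ → ℝ
  | 0 => 0
  | 1 => 1
  | k + 2 => 2 * c * chebU c (k + 1) - chebU c k

theorem chebU_mul_sin (θ : ℝ) (k : ℕ) : chebU (Real.cos θ) k * Real.sin θ = Real.sin (k * θ) := by
  induction k using Nat.twoStepInduction with
  | zero => simp [chebU]
  | one => simp [chebU]
  | more k ih₀ ih₁ =>
    rw [chebU, sub_mul, mul_assoc, ih₀, ih₁]
    push_cast
    rw [show ((k : ℝ) + 2) * θ = (k + 1) * θ + θ by ring, Real.sin_add,
      show (k : ℝ) * θ = (k + 1) * θ - θ by ring, Real.sin_sub]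
    ring

theorem chebU_nonneg_of_one_le {c : ℝ} (hc : 1 ≤ c) (k : ℕ) : 0 ≤ chebU c k := by
  -- Nonnegativity alone does not pass through the recursion; together with monotonicity it does.
  have h : ∀ k, 0 ≤ chebU c k ∧ chebU c k ≤ chebU c (k + 1) := by
    intro k
    induction k with
    | zero => simp [chebU]
    | succ k ih =>
      refine ⟨ih.1.trans ih.2, ?_⟩
      rw [chebU]
      nlinarith [mul_nonneg (sub_nonneg.2 hc) (ih.1.trans ih.2)]
  exact (h k).1

theorem chebU_cos_pi_div {m : ℕ} (hm : 2 ≤ m) :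
    (∀ k ≤ m, 0 ≤ chebU (Real.cos (Real.pi / m)) k) ∧ chebU (Real.cos (Real.pi / m)) m = 0 ∧
      chebU (Real.cos (Real.pi / m)) (m - 1) = 1 := by
  have hm' : (2 : ℝ) ≤ m := by exact_mod_cast hm
  have hm0 : (m : ℝ) ≠ 0 := by positivity
  have hpos : 0 < Real.sin (Real.pi / m) := by
    apply Real.sin_pos_of_pos_of_lt_pi (by positivity)
    rw [div_lt_iff₀ (by positivity)]
    nlinarith [Real.pi_pos]
  refine ⟨fun k hk => ?_, ?_, ?_⟩
  · refine nonneg_of_mul_nonneg_left ?_ hpos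
    rw [chebU_mul_sin]
    apply Real.sin_nonneg_of_nonneg_of_le_pi (by positivity)
    rw [mul_div_assoc', div_le_iff₀ (by positivity), mul_comm]
    exact mul_le_mul_of_nonneg_left (by exact_mod_cast hk) Real.pi_pos.le
  · refine mul_right_cancel₀ hpos.ne' ?_
    rw [chebU_mul_sin, mul_div_cancel₀ _ hm0, Real.sin_pi, zero_mul]
  · refine mul_right_cancel₀ hpos.ne' ?_
    rw [chebU_mul_sin, Nat.cast_sub (by omega), sub_mul, mul_div_cancel₀ _ hm0]
    simp [Real.sin_pi_sub]

/-- The alternating product `⋯ y x y x` of `k` factors. -/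
def altProd {G : Type*} [Group G] (x y : G) : ℕ → G
  | 0 => 1
  | k + 1 => (if Even k then x else y) * altProd x y k

variable {G : Type*} [Group G] {x y : G}

theorem altProd_succ_right (k : ℕ) : altProd x y (k + 1) = altProd y x k * x := by
  induction k with
  | zero => simp [altProd]
  | succ k ih =>
    rw [altProd, ih, ← mul_assoc, altProd]
    congr 2
    by_cases h : Even k <;> simp [h, Nat.even_add_one]

theorem altProd_mem (k : ℕ) : altProd x y k ∈ Subgroup.closure {x, y} := by
  induction k with
  | zero => exact one_mem _
  | succ k ih =>
    refine mul_mem (Subgroup.subset_closure ?_) ih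
    split_ifs <;> simp

theorem wordLength_altProd_le (hS : ∀ s ∈ ({x, y} : Set G), s * s = 1) (k : ℕ) :
    wordLength {x, y} (altProd x y k) ≤ k := by
  induction k with
  | zero => simp [altProd]
  | succ k ih =>
    refine (wordLength_gen_mul_le hS (altProd_mem k) ?_).trans (Nat.add_le_add_right ih 1)
    split_ifs <;> simp

/-- Two equal neighbouring letters cancel, so a reduced word in two involutions alternates. -/
theorem eq_altProd_of_reduced (hS : ∀ s ∈ ({x, y} : Set G), s * s = 1) (w : List G)
    (hw : ∀ s ∈ w, s ∈ ({x, y} : Set G)) (hl : wordLength {x, y} w.prod = w.length) :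
    w.prod = altProd x y w.length ∨ w.prod = altProd y x w.length := by
  induction w with
  | nil => simp [altProd]
  | cons s w ih =>
    have hw' : ∀ t ∈ w, t ∈ ({x, y} : Set G) := fun t ht => hw t (by simp [ht])
    have hs : s ∈ ({x, y} : Set G) := hw s (by simp)
    have hl' : wordLength {x, y} w.prod = w.length := by
      refine le_antisymm (wordLength_prod_le hw') ?_
      have := wordLength_gen_mul_le hS (list_prod_mem_closure hw') hs
      simp only [List.prod_cons, List.length_cons] at hl
      omega
    -- The new letter must differ from the first letter of the alternating word: otherwise the two
    -- cancel and the length is too small. Stated for both orders of the generators.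
    have key : ∀ p q : G, ({x, y} : Set G) = {p, q} → w.prod = altProd p q w.length →
        s = (if Even w.length then p else q) ∨ w.length = 0 := by
      intro p q hpq h
      by_contra! hcon
      obtain ⟨k, hk⟩ := Nat.exists_eq_succ_of_ne_zero hcon.2
      rw [hk, Nat.succ_eq_add_one] at h hcon
      have hs' : s = if Even k then p else q := by
        rw [hpq] at hs
        by_cases hev : Even k
        · simp only [hev, Nat.even_add_one, not_true, if_false, if_true] at hcon ⊢
          exact hs.resolve_right hcon.1
        · simp only [hev, Nat.even_add_one, not_false_iff, if_false, if_true] at hcon ⊢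
          exact hs.resolve_left hcon.1
      rw [List.prod_cons, h, altProd, ← hs', ← mul_assoc, hS s hs, one_mul, List.length_cons,
        hk] at hl
      have := wordLength_altProd_le (x := p) (y := q) (hpq ▸ hS) k
      rw [hpq] at hl
      omega
    rcases ih hw' hl' with h | h
    · rcases key x y rfl h with h' | h'
      · exact Or.inl (by rw [List.prod_cons, List.length_cons, altProd, ← h', h])
      · rw [List.length_eq_zero_iff] at h'
        subst h'
        simpa [altProd] using hs
    · rcases key y x (Set.pair_comm x y) h with h' | h'
      · exact Or.inr (by rw [List.prod_cons, List.length_cons, altProd, ← h', h])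
      · rw [List.length_eq_zero_iff] at h'
        subst h'
        simpa [altProd] using hs

/-- A reduced word ending in y would be shortened by y, so the alternating word for u ends in x (or
is empty). -/
theorem eq_altProd_of_le (hS : ∀ s ∈ ({x, y} : Set G), s * s = 1) {u : G}
    (hu : u ∈ Subgroup.closure {x, y}) (hl : wordLength {x, y} u ≤ wordLength {x, y} (u * y)) :
    u = altProd x y (wordLength {x, y} u) := by
  obtain ⟨w, hlw, hw, rfl⟩ := exists_word hS hu
  rcases eq_altProd_of_reduced hS w hw hlw.symm with h | h
  · rwa [← hlw]
  · cases hk : w.length with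
    | zero => rw [← hlw, hk, h, hk]; rfl
    | succ k =>
      rw [← hlw, hk, h, hk, altProd_succ_right, mul_assoc, hS y (by simp), mul_one] at hl
      have := wordLength_altProd_le hS k
      omega

end Dihedral

/-! ### Roots of rank two systems. -/

section DihedralRoots

variable {V : Type*} [AddCommGroup V] [Module ℝ V] {B : LinearMap.BilinForm ℝ V}

theorem altProd_refl_apply (hB : ∀ x y, B x y = B y x) {a b : V} (ha : B a a = 1) (hb : B b b = 1)
    (k : ℕ) : altProd (refl B b) (refl B a) k a =
      if Even k then chebU (-B a b) (k + 1) • a + chebU (-B a b) k • b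
      else chebU (-B a b) k • a + chebU (-B a b) (k + 1) • b := by
  induction k with
  | zero => simp [altProd, chebU]
  | succ k ih =>
    rw [altProd, LinearEquiv.mul_apply, ih]
    by_cases h : Even k
    · simp only [h, if_true, Nat.even_add_one, not_true, if_false, refl_apply hb, map_add,
        map_smul, hb, hB b a, smul_eq_mul, chebU]
      module
    · simp only [h, if_true, Nat.even_add_one, not_false_iff, if_false, refl_apply ha, map_add,
        map_smul, ha, smul_eq_mul, chebU]
      module

/-- The condition on the product of two unit vectors under which the reflections in them can be
simple reflections of a Coxeter group. -/
def CoxeterProduct (p : ℝ) : Prop := p ≤ -1 ∨ ∃ m : ℕ, 2 ≤ m ∧ p = -Real.cos (Real.pi / m)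

/-- The rank two case of the sign theorem. By hypothesis u is an alternating word ending in the
reflection in b, so the coefficients of u a are consecutive Chebyshev numbers. They are nonnegative
in the infinite case always, and in the finite case as long as the word is shorter than m. -/
theorem dihedral_apply_mem_hull (hB : ∀ x y, B x y = B y x) {a b : V} (ha : B a a = 1)
    (hb : B b b = 1) (hab : CoxeterProduct (B a b)) {u : V ≃ₗ[ℝ] V} (hu : u ∈ reflGroup B {b, a})
    (hl : rlen B {b, a} u ≤ rlen B {b, a} (u * refl B a)) : u a ∈ PointedCone.hull ℝ {b, a} := by
  have hS : ∀ s ∈ ({refl B b, refl B a} : Set _), s * s = 1 := by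
    rintro s (rfl | rfl) <;> exact refl_mul_self _
  have hpair : refls B {b, a} = {refl B b, refl B a} := Set.image_pair ..
  rw [reflGroup, hpair] at hu
  rw [rlen, rlen, hpair] at hl
  have hu' := eq_altProd_of_le hS hu hl
  set k := wordLength {refl B b, refl B a} u
  have haC : a ∈ PointedCone.hull ℝ {b, a} := Submodule.subset_span (by simp)
  have hbC : b ∈ PointedCone.hull ℝ {b, a} := Submodule.subset_span (by simp)
  have fin : 0 ≤ chebU (-B a b) k → 0 ≤ chebU (-B a b) (k + 1) →
      u a ∈ PointedCone.hull ℝ {b, a} := by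
    intro h₀ h₁
    rw [hu', altProd_refl_apply hB ha hb]
    split_ifs
    · exact add_mem (PointedCone.smul_mem _ h₁ haC) (PointedCone.smul_mem _ h₀ hbC)
    · exact add_mem (PointedCone.smul_mem _ h₀ haC) (PointedCone.smul_mem _ h₁ hbC)
  rcases hab with h | ⟨m, hm, h⟩
  · exact fin (chebU_nonneg_of_one_le (by linarith) _) (chebU_nonneg_of_one_le (by linarith) _)
  · obtain ⟨h₁, h₂, h₃⟩ := chebU_cos_pi_div hm
    rw [show Real.cos (Real.pi / m) = -B a b by rw [h, neg_neg]] at h₁ h₂ h₃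
    obtain ⟨m, rfl⟩ : ∃ n, m = n + 1 := ⟨m - 1, by omega⟩
    rw [Nat.add_sub_cancel] at h₃
    by_cases hk : k ≤ m
    · exact fin (h₁ _ (by omega)) (h₁ _ (by omega))
    exfalso
    set W := altProd (refl B b) (refl B a)
    have hWiso : ∀ x y, B (W m x) (W m y) = B x y :=
      map_of_mem_reflGroup hB (R := {b, a}) (by rw [reflGroup, hpair]; exact altProd_mem m)
    -- From here on the label of the pair is m + 1. The word of length m maps a to b or to a,
    -- because the Chebyshev numbers at m and m + 1 are 1 and 0. Hence it conjugates the reflection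
    -- in a into the next letter of the word: this is the braid relation.
    have hbraid : W (m + 1) * refl B a = W m := by
      have h₄ : (if Even m then refl B b else refl B a) = refl B (W m a) := by
        simp only [W]
        rw [altProd_refl_apply hB ha hb, h₂, h₃]
        split_ifs <;> simp
      simp only [W] at h₄ ⊢
      rw [altProd, h₄, mul_refl_of_isometry hWiso ha, mul_assoc, refl_mul_self, mul_one]
    -- By the braid relation, the reflection in a shortens every alternating word of length at least
    -- m + 1, against `hl`.
    have hd : ∀ d, W (m + 1 + d) * refl B a ∈ Subgroup.closure {refl B b, refl B a} ∧
        wordLength {refl B b, refl B a} (W (m + 1 + d) * refl B a) ≤ m + d := by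
      intro d
      induction d with
      | zero =>
        rw [add_zero, hbraid]
        exact ⟨altProd_mem m, wordLength_altProd_le hS m⟩
      | succ d ih =>
        have hmem : (if Even (m + 1 + d) then refl B b else refl B a) ∈
            ({refl B b, refl B a} : Set _) := by split_ifs <;> simp
        rw [← add_assoc]
        simp only [W] at ih ⊢
        rw [altProd, mul_assoc]
        exact ⟨mul_mem (Subgroup.subset_closure hmem) ih.1,
          (wordLength_gen_mul_le hS ih.1 hmem).trans (Nat.add_le_add_right ih.2 1)⟩
    have := (hd (k - (m + 1))).2
    rw [show m + 1 + (k - (m + 1)) = k by omega] at this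
    rw [hu'] at hl
    omega

end DihedralRoots

end CoxeterDomino

end

noncomputable section

namespace CoxeterDomino

/-! ### Positive and negative roots, parabolic subgroups, longest elements. -/

section RootBasis

variable {V : Type*} [AddCommGroup V] [Module ℝ V] {B : LinearMap.BilinForm ℝ V}

/-- A system of unit vectors, all on one side of a hyperplane, whose mutual products are those
of the simple roots of a Coxeter group. -/
structure IsRootBasis (B : LinearMap.BilinForm ℝ V) (R : Set V) : Prop where
  symm : ∀ x y, B x y = B y x
  unit : ∀ a ∈ R, B a a = 1
  pair : ∀ a ∈ R, ∀ b ∈ R, a ≠ b → CoxeterProduct (B a b)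
  pos : ∃ φ : V →ₗ[ℝ] ℝ, ∀ a ∈ R, 0 < φ a

theorem map_mem_hull {R T : Set V} {g : V →ₗ[ℝ] V} (hg : ∀ a ∈ T, g a ∈ PointedCone.hull ℝ R)
    {x : V} (hx : x ∈ PointedCone.hull ℝ T) : g x ∈ PointedCone.hull ℝ R := by
  induction hx using Submodule.span_induction with
  | mem x hx => exact hg x hx
  | zero => simp
  | add x y _ _ hx hy => rw [map_add]; exact add_mem hx hy
  | smul c x _ hx =>
    have : g (c • x) = c • g x := LinearMap.map_smul_of_tower g c x
    rw [this]
    exact Submodule.smul_mem _ c hx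

theorem rlen_le_of_subset {R T : Set V} (hTR : T ⊆ R) {g : V ≃ₗ[ℝ] V} (hg : g ∈ reflGroup B T) :
    rlen B R g ≤ rlen B T g :=
  wordLength_mono (fun _ => mul_self_of_mem_refls) (refls_mono hTR) hg

theorem rlen_mul_le {R : Set V} {g h : V ≃ₗ[ℝ] V} (hg : g ∈ reflGroup B R)
    (hh : h ∈ reflGroup B R) : rlen B R (g * h) ≤ rlen B R g + rlen B R h :=
  wordLength_mul_le (fun _ => mul_self_of_mem_refls) hg hh

theorem rlen_mul_le_of_subset {R T : Set V} (hTR : T ⊆ R) {g h : V ≃ₗ[ℝ] V}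
    (hg : g ∈ reflGroup B R) (hh : h ∈ reflGroup B T) :
    rlen B R (g * h) ≤ rlen B R g + rlen B T h :=
  (rlen_mul_le hg (reflGroup_mono hTR hh)).trans (Nat.add_le_add_left (rlen_le_of_subset hTR hh) _)

theorem rlen_refl_le {R : Set V} {a : V} (ha : a ∈ R) : rlen B R (refl B a) ≤ 1 :=
  wordLength_le_one (refl_mem_refls ha)

theorem rlen_refl_mul_le {R : Set V} {a : V} (ha : a ∈ R) {g : V ≃ₗ[ℝ] V}
    (hg : g ∈ reflGroup B R) : rlen B R (refl B a * g) ≤ rlen B R g + 1 :=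
  wordLength_gen_mul_le (fun _ => mul_self_of_mem_refls) hg (refl_mem_refls ha)

theorem exists_rlen_mul_refl_add_one {R : Set V} {g : V ≃ₗ[ℝ] V} (hg : g ∈ reflGroup B R)
    (h1 : g ≠ 1) : ∃ a ∈ R, rlen B R (g * refl B a) + 1 = rlen B R g := by
  obtain ⟨_, ⟨a, ha, rfl⟩, h⟩ :=
    exists_wordLength_mul_add_one (fun _ => mul_self_of_mem_refls) hg h1
  exact ⟨a, ha, h⟩

/-- As long as some letter from T shortens v on the right, move it from the end of v to the front of
u. The product does not change, the lengths stay additive, and v gets shorter, so this stops at a v'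
that no letter from T shortens. -/
theorem exists_factor_of_le {R T : Set V} (hTR : T ⊆ R) {v u : V ≃ₗ[ℝ] V}
    (hv : v ∈ reflGroup B R) (hu : u ∈ reflGroup B T)
    (hl : rlen B R v + rlen B T u ≤ rlen B R (v * u)) :
    ∃ v' ∈ reflGroup B R, ∃ u' ∈ reflGroup B T, v' * u' = v * u ∧
      rlen B R v' + rlen B T u' = rlen B R (v * u) ∧ rlen B R v' ≤ rlen B R v ∧
      ∀ a ∈ T, rlen B R v' ≤ rlen B R (v' * refl B a) := by
  induction hn : rlen B R v using Nat.strong_induction_on generalizing v u with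
  | _ n ih =>
    by_cases h : ∀ a ∈ T, rlen B R v ≤ rlen B R (v * refl B a)
    · exact ⟨v, hv, u, hu, rfl, le_antisymm hl (rlen_mul_le_of_subset hTR hv hu), hn.le, h⟩
    · push Not at h
      obtain ⟨a, ha, hlt⟩ := h
      have heq : (v * refl B a) * (refl B a * u) = v * u := by
        rw [mul_assoc, ← mul_assoc (refl B a), refl_mul_self, one_mul]
      have := rlen_refl_mul_le ha hu
      obtain ⟨v', hv', u', hu', h₁, h₂, h₃, h₄⟩ :=
        ih _ (hn ▸ hlt) (mul_mem hv (refl_mem_reflGroup (hTR ha)))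
          (mul_mem (refl_mem_reflGroup ha) hu) (by rw [heq]; omega) rfl
      exact ⟨v', hv', u', hu', h₁.trans heq, by rw [h₂, heq], by omega, h₄⟩

namespace IsRootBasis

variable {R T : Set V} {w : V ≃ₗ[ℝ] V} {a : V}

theorem mono (h : IsRootBasis B R) (hTR : T ⊆ R) : IsRootBasis B T where
  symm := h.symm
  unit a ha := h.unit a (hTR ha)
  pair a ha b hb := h.pair a (hTR ha) b (hTR hb)
  pos := h.pos.imp fun _ hφ a ha => hφ a (hTR ha)

theorem ne_zero (h : IsRootBasis B R) (ha : a ∈ R) : a ≠ 0 := by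
  rintro rfl
  simpa using h.unit 0 ha

/-- The functional φ is positive on the hull except at 0, so the cone contains no line. This takes
the place of linear independence of the roots. -/
theorem eq_zero_of_mem_hull_of_neg_mem_hull (h : IsRootBasis B R) {x : V}
    (hx : x ∈ PointedCone.hull ℝ R) (hx' : -x ∈ PointedCone.hull ℝ R) : x = 0 := by
  obtain ⟨φ, hφ⟩ := h.pos
  have key : ∀ y ∈ PointedCone.hull ℝ R, 0 ≤ φ y ∧ (φ y = 0 → y = 0) := by
    intro y hy
    induction hy using Submodule.span_induction with
    | mem y hy => exact ⟨(hφ y hy).le, fun h0 => absurd h0 (hφ y hy).ne'⟩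
    | zero => simp
    | add y z _ _ hy hz =>
      rw [map_add]
      refine ⟨add_nonneg hy.1 hz.1, fun h0 => ?_⟩
      rw [hy.2 (by linarith [hy.1, hz.1]), hz.2 (by linarith [hy.1, hz.1]), add_zero]
    | smul c y _ hy =>
      have : φ (c • y) = (c : ℝ) * φ y := LinearMap.map_smul φ (c : ℝ) y
      rw [this]
      refine ⟨mul_nonneg c.2 hy.1, fun h0 => ?_⟩
      rcases mul_eq_zero.1 h0 with h0 | h0
      · have : c = 0 := Subtype.ext h0
        rw [this, zero_smul]
      · rw [hy.2 h0, smul_zero]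
  refine (key x hx).2 (le_antisymm ?_ (key x hx).1)
  have := (key _ hx').1
  rw [map_neg] at this
  linarith

/-- Induction on the length of w. Choose a letter b that shortens w and write w = v u with u in the
dihedral group of a and b, additive lengths, and v shortened neither by a nor by b. By rank two, u a
is a nonnegative combination of a and b; by induction v maps both into the hull. -/
theorem mem_hull_of_rlen_le (h : IsRootBasis B R) (hw : w ∈ reflGroup B R) (ha : a ∈ R)
    (hl : rlen B R w ≤ rlen B R (w * refl B a)) : w a ∈ PointedCone.hull ℝ R := by
  induction hn : rlen B R w using Nat.strong_induction_on generalizing w a with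
  | _ n ih =>
    by_cases h1 : w = 1
    · subst h1
      exact Submodule.subset_span ha
    obtain ⟨b, hb, hlb⟩ := exists_rlen_mul_refl_add_one hw h1
    have hab : a ≠ b := by
      rintro rfl
      omega
    have hT : ({b, a} : Set V) ⊆ R := by
      rintro x (rfl | rfl) <;> assumption
    have hwb : (w * refl B b) * refl B b = w := by rw [mul_assoc, refl_mul_self, mul_one]
    have hbT : b ∈ ({b, a} : Set V) := by simp
    have haT : a ∈ ({b, a} : Set V) := by simp
    -- The factorization starts from w = (w s_b) s_b, so v is at most as long as w s_b, hence
    -- strictly shorter than w.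
    obtain ⟨v, hv, u, hu, h₁, h₂, h₃, h₄⟩ := exists_factor_of_le (B := B) hT
      (mul_mem hw (refl_mem_reflGroup hb)) (refl_mem_reflGroup (B := B) hbT)
      (by rw [hwb]; have := rlen_refl_le (B := B) hbT; omega)
    rw [hwb] at h₁ h₂
    have hu_le : rlen B {b, a} u ≤ rlen B {b, a} (u * refl B a) := by
      have := rlen_mul_le_of_subset hT hv (mul_mem hu (refl_mem_reflGroup haT))
      rw [← mul_assoc, h₁] at this
      omega
    have hua := dihedral_apply_mem_hull h.symm (h.unit a ha) (h.unit b hb) (h.pair a ha b hb hab)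
      hu hu_le
    rw [← h₁, LinearEquiv.mul_apply]
    refine map_mem_hull (g := v.toLinearMap) ?_ hua
    rintro x (rfl | rfl)
    · exact ih _ (by omega) hv (hT hbT) (h₄ _ hbT) rfl
    · exact ih _ (by omega) hv (hT haT) (h₄ _ haT) rfl

theorem neg_mem_hull_of_rlen_lt (h : IsRootBasis B R) (hw : w ∈ reflGroup B R) (ha : a ∈ R)
    (hl : rlen B R (w * refl B a) < rlen B R w) : -w a ∈ PointedCone.hull ℝ R := by
  have := h.mem_hull_of_rlen_le (mul_mem hw (refl_mem_reflGroup ha)) ha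
    (by rw [mul_assoc, refl_mul_self, mul_one]; exact hl.le)
  rwa [LinearEquiv.mul_apply, refl_self (h.unit a ha), map_neg] at this

theorem mem_hull_or_neg_mem_hull (h : IsRootBasis B R) (hw : w ∈ reflGroup B R) (ha : a ∈ R) :
    w a ∈ PointedCone.hull ℝ R ∨ -w a ∈ PointedCone.hull ℝ R :=
  (le_or_gt (rlen B R w) (rlen B R (w * refl B a))).imp (h.mem_hull_of_rlen_le hw ha)
    (h.neg_mem_hull_of_rlen_lt hw ha)

theorem not_mem_hull_and_neg_mem_hull (h : IsRootBasis B R) (ha : a ≠ 0) :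
    ¬(w a ∈ PointedCone.hull ℝ R ∧ -w a ∈ PointedCone.hull ℝ R) := fun h' =>
  ha (by simpa using h.eq_zero_of_mem_hull_of_neg_mem_hull h'.1 h'.2)

theorem rlen_le_of_mem_hull (h : IsRootBasis B R) (hw : w ∈ reflGroup B R) (ha : a ∈ R)
    (hwa : w a ∈ PointedCone.hull ℝ R) : rlen B R w ≤ rlen B R (w * refl B a) := by
  by_contra! hl
  exact h.not_mem_hull_and_neg_mem_hull (h.ne_zero ha) ⟨hwa, h.neg_mem_hull_of_rlen_lt hw ha hl⟩

/-- The length cannot stay equal: then the sign theorem would apply to w s_a as well and make w a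
both positive and negative. -/
theorem rlen_mul_refl_of_mem_hull (h : IsRootBasis B R) (hw : w ∈ reflGroup B R) (ha : a ∈ R)
    (hwa : w a ∈ PointedCone.hull ℝ R) : rlen B R (w * refl B a) = rlen B R w + 1 := by
  have h₁ := h.rlen_le_of_mem_hull hw ha hwa
  have h₂ : rlen B R (w * refl B a) ≤ rlen B R w + 1 :=
    wordLength_mul_gen_le (fun _ => mul_self_of_mem_refls) hw (refl_mem_refls ha)
  rcases h₂.lt_or_eq with h₃ | h₃
  · exfalso
    refine h.not_mem_hull_and_neg_mem_hull (w := w) (h.ne_zero ha) ⟨hwa, ?_⟩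
    have := h.mem_hull_of_rlen_le (mul_mem hw (refl_mem_reflGroup ha)) ha
      (by rw [mul_assoc, refl_mul_self, mul_one]; omega)
    rwa [LinearEquiv.mul_apply, refl_self (h.unit a ha), map_neg] at this
  · exact h₃

theorem eq_one_of_forall_mem_hull (h : IsRootBasis B R) (hw : w ∈ reflGroup B R)
    (hpos : ∀ a ∈ R, w a ∈ PointedCone.hull ℝ R) : w = 1 := by
  by_contra h1
  obtain ⟨a, ha, hl⟩ := exists_rlen_mul_refl_add_one hw h1
  have := h.rlen_le_of_mem_hull hw ha (hpos a ha)
  omega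

theorem exists_neg_mem_hull (h : IsRootBasis B R) (hw : w ∈ reflGroup B R) (h1 : w ≠ 1) :
    ∃ a ∈ R, -w a ∈ PointedCone.hull ℝ R := by
  by_contra! hcon
  exact h1 (h.eq_one_of_forall_mem_hull hw fun a ha =>
    (h.mem_hull_or_neg_mem_hull hw ha).resolve_right (hcon a ha))

/-! ### Parabolic subgroups -/

/-- The minimal representatives of the left cosets of the parabolic subgroup generated by `T`. -/
def _root_.CoxeterDomino.minReps (B : LinearMap.BilinForm ℝ V) (R T : Set V) :
    Set (V ≃ₗ[ℝ] V) :=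
  {u | u ∈ reflGroup B R ∧ ∀ a ∈ T, u a ∈ PointedCone.hull ℝ R}

theorem exists_factor (h : IsRootBasis B R) (hTR : T ⊆ R) (hw : w ∈ reflGroup B R) :
    ∃ u ∈ minReps B R T, ∃ v ∈ reflGroup B T, u * v = w ∧
      rlen B R w = rlen B R u + rlen B T v := by
  obtain ⟨u, hu, v, hv, h₁, h₂, -, h₄⟩ := exists_factor_of_le hTR hw (one_mem (reflGroup B T))
    (by rw [mul_one, rlen, rlen, wordLength_one, add_zero])
  rw [mul_one] at h₁ h₂
  exact ⟨u, ⟨hu, fun a ha => h.mem_hull_of_rlen_le hu (hTR ha) (h₄ a ha)⟩, v, hv, h₁, h₂.symm⟩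

/-- Write u' = u x with x in the subgroup of T. If x ≠ 1, it makes some a in T a negative
combination of T, which u maps to a negative combination of R; but u' a is positive. -/
theorem factor_unique (h : IsRootBasis B R) (hTR : T ⊆ R) {u u' v v' : V ≃ₗ[ℝ] V}
    (hu : u ∈ minReps B R T) (hu' : u' ∈ minReps B R T) (hv : v ∈ reflGroup B T)
    (hv' : v' ∈ reflGroup B T) (heq : u * v = u' * v') : u = u' ∧ v = v' := by
  have hx : u' = u * (v * v'⁻¹) := by rw [← mul_assoc, heq, mul_inv_cancel_right]
  have hx1 : v * v'⁻¹ = 1 := by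
    by_contra h1
    obtain ⟨a, ha, hna⟩ := (h.mono hTR).exists_neg_mem_hull (mul_mem hv (inv_mem hv')) h1
    refine h.not_mem_hull_and_neg_mem_hull (w := u') (h.ne_zero (hTR ha)) ⟨hu'.2 a ha, ?_⟩
    have := map_mem_hull (g := u.toLinearMap) hu.2 hna
    rwa [map_neg, LinearEquiv.coe_coe, ← LinearEquiv.mul_apply, ← hx] at this
  rw [hx1, mul_one] at hx
  exact ⟨hx.symm, mul_inv_eq_one.1 hx1⟩

theorem rlen_mul_of_mem_minReps (h : IsRootBasis B R) (hTR : T ⊆ R) {u v : V ≃ₗ[ℝ] V}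
    (hu : u ∈ minReps B R T) (hv : v ∈ reflGroup B T) :
    rlen B R (u * v) = rlen B R u + rlen B T v := by
  obtain ⟨u', hu', v', hv', heq, hl⟩ :=
    h.exists_factor hTR (mul_mem hu.1 (reflGroup_mono hTR hv))
  obtain ⟨rfl, rfl⟩ := h.factor_unique hTR hu' hu hv' hv heq
  exact hl

/-- The elements of the reflection group that have all simple reflections as right descents
(at most one element, the longest one). -/
def _root_.CoxeterDomino.longest (B : LinearMap.BilinForm ℝ V) (R : Set V) : Set (V ≃ₗ[ℝ] V) :=
  {w | w ∈ reflGroup B R ∧ ∀ a ∈ R, -w a ∈ PointedCone.hull ℝ R}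

/-- u preserves positivity of combinations of T, so the descents of u v in T are those of v. -/
theorem mul_mem_descents_iff (h : IsRootBasis B R) (hTR : T ⊆ R) {u v : V ≃ₗ[ℝ] V}
    (hu : u ∈ minReps B R T) (hv : v ∈ reflGroup B T) :
    (∀ a ∈ T, -(u * v) a ∈ PointedCone.hull ℝ R) ↔ v ∈ longest B T := by
  constructor
  · refine fun hd => ⟨hv, fun a ha => ?_⟩
    refine ((h.mono hTR).mem_hull_or_neg_mem_hull hv ha).resolve_left fun hva => ?_
    exact h.not_mem_hull_and_neg_mem_hull (w := u * v) (h.ne_zero (hTR ha))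
      ⟨map_mem_hull (g := u.toLinearMap) hu.2 hva, hd a ha⟩
  · intro hv' a ha
    have := map_mem_hull (g := u.toLinearMap) hu.2 (hv'.2 a ha)
    rwa [map_neg] at this

/-- The inverse of w' makes every simple root negative, and w turns it positive again; so w w'⁻¹
keeps all simple roots positive and is 1. -/
theorem longest_subsingleton (h : IsRootBasis B R) {w' : V ≃ₗ[ℝ] V} (hw : w ∈ longest B R)
    (hw' : w' ∈ longest B R) : w = w' := by
  have hneg : ∀ {g : V ≃ₗ[ℝ] V}, g ∈ longest B R → ∀ x, -x ∈ PointedCone.hull ℝ R →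
      g x ∈ PointedCone.hull ℝ R := by
    intro g hg x hx
    have := map_mem_hull (g := -g.toLinearMap) (fun a ha => hg.2 a ha) hx
    simpa using this
  refine mul_inv_eq_one.1 (h.eq_one_of_forall_mem_hull (mul_mem hw.1 (inv_mem hw'.1)) ?_)
  intro a ha
  rw [LinearEquiv.mul_apply]
  refine hneg hw _ ((h.mem_hull_or_neg_mem_hull (inv_mem hw'.1) ha).resolve_left fun hcon => ?_)
  refine h.not_mem_hull_and_neg_mem_hull (w := 1) (h.ne_zero ha)
    ⟨Submodule.subset_span ha, ?_⟩
  have := map_mem_hull (g := -w'.toLinearMap) (fun a ha => hw'.2 a ha) hcon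
  rw [LinearMap.neg_apply, LinearEquiv.coe_coe, ← LinearEquiv.mul_apply, mul_inv_cancel] at this
  exact this

theorem longest_eq_empty_of_subset (h : IsRootBasis B R) (hTR : T ⊆ R)
    (hT : longest B T = ∅) : longest B R = ∅ := by
  rw [Set.eq_empty_iff_forall_notMem] at hT ⊢
  intro w hw
  obtain ⟨u, hu, v, hv, rfl, -⟩ := h.exists_factor hTR hw.1
  exact hT v ((h.mul_mem_descents_iff hTR hu hv).1 fun a ha => hw.2 a (hTR ha))

/-- If the cone spanned by the roots contains a nonzero vector in the closed fundamental chamber,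
then the group has no longest element. -/
theorem longest_eq_empty (h : IsRootBasis B R) {c : V} (hc : c ∈ PointedCone.hull ℝ R)
    (hc0 : c ≠ 0) (hch : ∀ a ∈ R, B c a ≤ 0) : longest B R = ∅ := by
  -- For a vector of the closed chamber in this sign convention, w c - c is a nonnegative
  -- combination of roots: every letter of a reduced word adds a nonnegative multiple of a positive
  -- root. A longest w would also put -w c into the hull, and the sum -c then forces c = 0.
  have key : ∀ w ∈ reflGroup B R, w c - c ∈ PointedCone.hull ℝ R := by
    intro w hw
    induction hn : rlen B R w using Nat.strong_induction_on generalizing w with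
    | _ n ih =>
      by_cases h1 : w = 1
      · simp [h1]
      obtain ⟨a, ha, hl⟩ := exists_rlen_mul_refl_add_one hw h1
      have hwa := h.neg_mem_hull_of_rlen_lt hw ha (by omega)
      have := ih _ (by omega) _ (mul_mem hw (refl_mem_reflGroup ha)) rfl
      rw [LinearEquiv.mul_apply, refl_apply (h.unit a ha), map_sub, map_smul] at this
      have h2 : 0 ≤ -(2 * B a c) := by linarith [hch a ha, h.symm a c]
      have := add_mem this (PointedCone.smul_mem _ h2 hwa)
      convert! this using 1
      module
  rw [Set.eq_empty_iff_forall_notMem]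
  intro w hw
  have h₁ := map_mem_hull (g := -w.toLinearMap) (fun a ha => hw.2 a ha) hc
  have h₂ := add_mem h₁ (key w hw.1)
  have h₃ : -c ∈ PointedCone.hull ℝ R := by
    convert! h₂ using 1
    rw [LinearMap.neg_apply, LinearEquiv.coe_coe]
    module
  exact hc0 (h.eq_zero_of_mem_hull_of_neg_mem_hull hc h₃)

end IsRootBasis

end RootBasis

end CoxeterDomino

end

noncomputable section

namespace CoxeterDomino

/-! ## Growth series of reflection groups -/

open PowerSeries

section GenFun

/-- The generating function of a set of group elements with respect to a length function. -/
def genFun {G : Type*} (l : G → ℕ) (X : Set G) : PowerSeries ℤ :=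
  PowerSeries.mk fun k => (({g | g ∈ X ∧ l g = k}.ncard : ℕ) : ℤ)

@[simp]
theorem genFun_empty {G : Type*} (l : G → ℕ) : genFun l ∅ = 0 := by
  ext k
  simp [genFun]

theorem genFun_singleton {G : Type*} (l : G → ℕ) (g : G) : genFun l {g} = X ^ l g := by
  ext k
  rw [genFun, coeff_mk, coeff_X_pow]
  by_cases hk : k = l g
  · subst hk
    rw [if_pos rfl, show {g' | g' ∈ ({g} : Set G) ∧ l g' = l g} = {g} by ext; aesop]
    simp
  · rw [if_neg hk, show {g' | g' ∈ ({g} : Set G) ∧ l g' = k} = ∅ by ext; aesop]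
    simp

variable {V : Type*} [AddCommGroup V] [Module ℝ V] {B : LinearMap.BilinForm ℝ V}

/-- The growth series of the reflection group of `R`. -/
def growth (B : LinearMap.BilinForm ℝ V) (R : Set V) : PowerSeries ℤ :=
  genFun (rlen B R) (reflGroup B R)

/-- Without finiteness `ncard` would be 0 and the coefficients would not count anything. -/
theorem finite_rlen_eq {R : Set V} (hR : R.Finite) {X : Set (V ≃ₗ[ℝ] V)}
    (hX : X ⊆ reflGroup B R) (k : ℕ) : {g | g ∈ X ∧ rlen B R g = k}.Finite :=
  (finite_setOf_wordLength_eq (fun _ => mul_self_of_mem_refls) (hR.image _) k).subset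
    fun _ hg => ⟨hX hg.1, hg.2⟩

theorem minReps_subset {R T : Set V} : minReps B R T ⊆ reflGroup B R := fun _ h => h.1

theorem longest_subset {R : Set V} : longest B R ⊆ reflGroup B R := fun _ h => h.1

theorem growth_eq_growthSeries (R : Set V) : growth B R = growthSeries (refls B R) := by
  ext k
  simp only [growth, genFun, growthSeries, coeff_mk]
  congr 3
  ext g
  exact (hasWordLength_iff fun _ => mul_self_of_mem_refls).symm

theorem constantCoeff_growth (R : Set V) : constantCoeff (growth B R) = 1 := by
  rw [← coeff_zero_eq_constantCoeff_apply, growth, genFun, coeff_mk]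
  rw [show {g | g ∈ (reflGroup B R : Set _) ∧ rlen B R g = 0} = {1} from ?_]
  · simp
  · ext g
    constructor
    · rintro ⟨hg, h0⟩
      exact (wordLength_eq_zero_iff (fun _ => mul_self_of_mem_refls) hg).1 h0
    · rintro rfl
      exact ⟨one_mem _, wordLength_one⟩

/-- The inverse of the growth series. -/
def growthInv (B : LinearMap.BilinForm ℝ V) (R : Set V) : PowerSeries ℤ :=
  invOfUnit (growth B R) 1

theorem growth_mul_growthInv (R : Set V) : growth B R * growthInv B R = 1 :=
  mul_invOfUnit _ _ (by simpa using constantCoeff_growth R)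

theorem growthInv_empty : growthInv B (∅ : Set V) = 1 := by
  have h : growth B (∅ : Set V) = 1 := by
    have : (reflGroup B (∅ : Set V) : Set (V ≃ₗ[ℝ] V)) = {1} := by simp [reflGroup, refls]
    rw [growth, this, genFun_singleton, rlen, wordLength_one, pow_zero]
  simpa [h] using growth_mul_growthInv (B := B) (∅ : Set V)

namespace IsRootBasis

variable {R T : Set V}

/-- Factorization through minimal representatives is unique and adds lengths, so the Cauchy product
of the two series counts the products u v. -/
theorem genFun_minReps_mul (h : IsRootBasis B R) (hR : R.Finite) (hTR : T ⊆ R)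
    {X : Set (V ≃ₗ[ℝ] V)} (hX : X ⊆ reflGroup B T) :
    genFun (rlen B R) (minReps B R T) * genFun (rlen B T) X =
      genFun (rlen B R) {w | ∃ u ∈ minReps B R T, ∃ v ∈ X, u * v = w} := by
  classical
  ext k
  rw [coeff_mul]
  simp only [genFun, coeff_mk]
  have fU := fun i => finite_rlen_eq hR (minReps_subset (B := B) (R := R) (T := T)) i
  have fX := fun i => finite_rlen_eq (B := B) (hR.subset hTR) hX i
  have fW := finite_rlen_eq (B := B) (X := {w | ∃ u ∈ minReps B R T, ∃ v ∈ X, u * v = w}) hR (by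
    rintro _ ⟨u, hu, v, hv, rfl⟩
    exact mul_mem hu.1 (reflGroup_mono hTR (hX hv))) k
  rw [Set.ncard_eq_toFinset_card _ fW]
  simp_rw [fun i => Set.ncard_eq_toFinset_card _ (fU i),
    fun i => Set.ncard_eq_toFinset_card _ (fX i)]
  norm_cast
  simp_rw [← Finset.card_product]
  rw [← Finset.card_sigma]
  refine Finset.card_bij (fun p _ => p.2.1 * p.2.2) ?_ ?_ ?_
  · rintro ⟨⟨i, j⟩, u, v⟩ hp
    simp only [Finset.mem_sigma, Finset.mem_product,
      Set.Finite.mem_toFinset, Set.mem_ofPred_eq] at hp ⊢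
    obtain ⟨hij, ⟨hu, hui⟩, hv, hvj⟩ := hp
    exact ⟨⟨u, hu, v, hv, rfl⟩, by rw [h.rlen_mul_of_mem_minReps hTR hu (hX hv), hui, hvj,
      Finset.HasAntidiagonal.mem_antidiagonal.1 hij]⟩
  · rintro ⟨⟨i, j⟩, u, v⟩ hp ⟨⟨i', j'⟩, u', v'⟩ hp' heq
    simp only [Finset.mem_sigma, Finset.mem_product,
      Set.Finite.mem_toFinset, Set.mem_ofPred_eq] at hp hp' heq
    obtain ⟨rfl, rfl⟩ := h.factor_unique hTR hp.2.1.1 hp'.2.1.1 (hX hp.2.2.1) (hX hp'.2.2.1) heq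
    obtain ⟨-, ⟨-, rfl⟩, -, rfl⟩ := hp
    obtain ⟨-, ⟨-, rfl⟩, -, rfl⟩ := hp'
    rfl
  · intro w hw
    simp only [Set.Finite.mem_toFinset, Set.mem_ofPred_eq] at hw
    obtain ⟨⟨u, hu, v, hv, rfl⟩, hk⟩ := hw
    rw [h.rlen_mul_of_mem_minReps hTR hu (hX hv)] at hk
    refine ⟨⟨(rlen B R u, rlen B T v), u, v⟩, ?_, rfl⟩
    simp only [Finset.mem_sigma, Finset.mem_product,
      Set.Finite.mem_toFinset, Set.mem_ofPred_eq]
    exact ⟨Finset.HasAntidiagonal.mem_antidiagonal.2 hk, ⟨hu, trivial⟩, hv, trivial⟩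

theorem genFun_minReps_mul_growth (h : IsRootBasis B R) (hR : R.Finite) (hTR : T ⊆ R) :
    genFun (rlen B R) (minReps B R T) * growth B T = growth B R := by
  rw [growth, h.genFun_minReps_mul hR hTR subset_rfl, growth]
  congr 1
  ext w
  constructor
  · rintro ⟨u, hu, v, hv, rfl⟩
    exact mul_mem hu.1 (reflGroup_mono hTR hv)
  · intro hw
    obtain ⟨u, hu, v, hv, h, -⟩ := h.exists_factor hTR hw
    exact ⟨u, hu, v, hv, h⟩

theorem genFun_minReps_mul_longest (h : IsRootBasis B R) (hR : R.Finite) (hTR : T ⊆ R) :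
    genFun (rlen B R) (minReps B R T) * genFun (rlen B T) (longest B T) =
      genFun (rlen B R) {w | w ∈ reflGroup B R ∧ ∀ a ∈ T, -w a ∈ PointedCone.hull ℝ R} := by
  rw [h.genFun_minReps_mul hR hTR longest_subset]
  congr 1
  ext w
  constructor
  · rintro ⟨u, hu, v, hv, rfl⟩
    exact ⟨mul_mem hu.1 (reflGroup_mono hTR hv.1), (h.mul_mem_descents_iff hTR hu hv.1).2 hv⟩
  · rintro ⟨hw, hd⟩
    obtain ⟨u, hu, v, hv, rfl, -⟩ := h.exists_factor hTR hw
    exact ⟨u, hu, v, (h.mul_mem_descents_iff hTR hu hv).1 hd, rfl⟩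

/-- The product for T counts the elements whose descent set contains T. Hence w contributes the
alternating sum over all subsets of its descent set, which vanishes unless that set is empty, that
is, unless w = 1. -/
theorem sum_genFun_minReps_mul_longest {R : Finset V} (h : IsRootBasis B (R : Set V)) :
    ∑ T ∈ R.powerset, (-1 : PowerSeries ℤ) ^ T.card *
      (genFun (rlen B R) (minReps B (R : Set V) T) * genFun (rlen B T) (longest B (T : Set V)))
      = 1 := by
  classical
  have hR := R.finite_toSet
  have e : ∀ T ∈ R.powerset, (-1 : PowerSeries ℤ) ^ T.card *
      (genFun (rlen B R) (minReps B (R : Set V) T) * genFun (rlen B T) (longest B (T : Set V))) =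
      C ((-1) ^ T.card) * genFun (rlen B R)
        {w | w ∈ reflGroup B (R : Set V) ∧ ∀ a ∈ T, -w a ∈ PointedCone.hull ℝ (R : Set V)} := by
    intro T hT
    rw [h.genFun_minReps_mul_longest hR (Finset.coe_subset.2 (Finset.mem_powerset.1 hT))]
    simp
  rw [Finset.sum_congr rfl e]
  ext k
  rw [map_sum]
  simp only [coeff_C_mul, genFun, coeff_mk]
  let F := (finite_rlen_eq (B := B) hR (X := reflGroup B (R : Set V)) subset_rfl k).toFinset
  have hF : ∀ w, w ∈ F ↔ w ∈ reflGroup B (R : Set V) ∧ rlen B R w = k := by simp [F]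
  let D : (V ≃ₗ[ℝ] V) → Finset V :=
    fun w => R.filter fun a => -w a ∈ PointedCone.hull ℝ (R : Set V)
  have e₂ : ∀ T ∈ R.powerset, (((-1) ^ T.card : ℤ) * (({g | g ∈ {w | w ∈ reflGroup B (R : Set V) ∧
      ∀ a ∈ T, -w a ∈ PointedCone.hull ℝ (R : Set V)} ∧ rlen B R g = k}.ncard : ℕ) : ℤ)) =
      ∑ w ∈ F, if T ⊆ D w then (-1) ^ T.card else 0 := by
    intro T hT
    rw [← Finset.sum_filter, Finset.sum_const, nsmul_eq_mul, mul_comm]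
    congr 2
    rw [← Set.ncard_coe_finset]
    congr 1
    ext w
    simp only [Set.mem_ofPred_eq, Finset.coe_filter, hF, D]
    constructor
    · rintro ⟨⟨h₁, h₂⟩, h₃⟩
      exact ⟨⟨h₁, h₃⟩, fun a ha => Finset.mem_filter.2 ⟨Finset.mem_powerset.1 hT ha, h₂ a ha⟩⟩
    · rintro ⟨⟨h₁, h₃⟩, h₂⟩
      exact ⟨⟨h₁, fun a ha => (Finset.mem_filter.1 (h₂ ha)).2⟩, h₃⟩
  rw [Finset.sum_congr rfl e₂, Finset.sum_comm]
  have e₃ : ∀ w ∈ F, (∑ T ∈ R.powerset, if T ⊆ D w then ((-1) ^ T.card : ℤ) else 0) =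
      if w = 1 then 1 else 0 := by
    intro w hw
    rw [← Finset.sum_filter, show R.powerset.filter (· ⊆ D w) = (D w).powerset from ?_,
      Finset.sum_powerset_neg_one_pow_card]
    · congr 1
      refine propext ⟨fun hD => ?_, fun h1 => ?_⟩
      · by_contra h1
        obtain ⟨a, ha, hna⟩ := h.exists_neg_mem_hull ((hF w).1 hw).1 h1
        have : a ∈ D w := Finset.mem_filter.2 ⟨ha, hna⟩
        rw [hD] at this
        exact absurd this (Finset.notMem_empty a)
      · subst h1
        refine Finset.filter_eq_empty_iff.2 fun a ha hna => ?_
        exact h.not_mem_hull_and_neg_mem_hull (w := 1) (h.ne_zero ha)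
          ⟨Submodule.subset_span ha, hna⟩
    · ext T
      simp only [Finset.mem_filter, Finset.mem_powerset]
      exact ⟨fun h => h.2, fun h => ⟨h.trans (Finset.filter_subset _ _), h⟩⟩
  rw [Finset.sum_congr rfl e₃, Finset.sum_ite_eq', coeff_one]
  congr 1
  rw [hF, rlen, wordLength_one]
  simp [one_mem, eq_comm]

end IsRootBasis

/-- The contribution of the parabolic subgroup generated by `T` to the inverse growth series of a
larger group. -/
def growthTerm (B : LinearMap.BilinForm ℝ V) (T : Finset V) : PowerSeries ℤ :=
  (-1) ^ T.card * genFun (rlen B T) (longest B (T : Set V)) * growthInv B (T : Set V)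

/-- A form of Steinberg's formula. -/
theorem IsRootBasis.sum_growthTerm {R : Finset V} (h : IsRootBasis B (R : Set V)) :
    ∑ T ∈ R.powerset, growthTerm B T = growthInv B (R : Set V) := by
  have h₁ := congrArg (growthInv B (R : Set V) * ·) h.sum_genFun_minReps_mul_longest
  rw [mul_one, Finset.mul_sum] at h₁
  rw [← h₁]
  refine Finset.sum_congr rfl fun T hT => ?_
  rw [growthTerm]
  have h₂ := h.genFun_minReps_mul_growth R.finite_toSet
    (Finset.coe_subset.2 (Finset.mem_powerset.1 hT))
  have h₃ := growth_mul_growthInv (B := B) (R : Set V)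
  have h₄ := growth_mul_growthInv (B := B) (T : Set V)
  set u := genFun (rlen B R) (minReps B (R : Set V) T)
  set n := genFun (rlen B T) (longest B (T : Set V))
  -- Dividing W_R = W^T W_T, where W^T is the series of minimal representatives, by W_R W_T.
  have h₅ : growthInv B (R : Set V) * u = growthInv B (T : Set V) := by
    linear_combination (growthInv B (T : Set V)) * h₃ - (growthInv B (R : Set V)) * u * h₄
      + (growthInv B (R : Set V)) * (growthInv B (T : Set V)) * h₂
  rw [← h₅]
  ring

end GenFun

end CoxeterDomino

end

noncomputable section

namespace CoxeterDomino

open PowerSeries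

/-! ## Computation of growth series -/

section Moebius

/-- Möbius inversion on the Boolean lattice. Inserting a replaces g by its difference T ↦ g (T ∪
{a}) - g T, which sums k over the sets containing a. -/
theorem sum_powerset_neg_one_pow_mul {α A : Type*} [DecidableEq α] [CommRing A] (R : Finset α)
    (k g : Finset α → A) (hg : ∀ T ⊆ R, g T = ∑ U ∈ T.powerset, k U) :
    ∑ T ∈ R.powerset, (-1) ^ T.card * g T = (-1) ^ R.card * k R := by
  induction R using Finset.induction generalizing k g with
  | empty => simp [hg ∅ (by simp)]
  | insert a R ha ih =>
    have h' : ∀ T ∈ R.powerset, a ∉ T := fun T hT haT => ha (Finset.mem_powerset.1 hT haT)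
    rw [Finset.sum_powerset_insert ha, ← Finset.sum_add_distrib]
    have := ih (fun U => k (insert a U)) (fun T => g (insert a T) - g T) (by
      intro T hT
      have haT : a ∉ T := fun haT => ha (hT haT)
      rw [hg _ (Finset.insert_subset_insert a hT), hg _ (hT.trans (Finset.subset_insert a R)),
        Finset.sum_powerset_insert haT, add_sub_cancel_left])
    rw [Finset.card_insert_of_notMem ha, pow_succ, mul_neg_one, neg_mul, ← this,
      ← Finset.sum_neg_distrib]
    refine Finset.sum_congr rfl fun T hT => ?_
    rw [Finset.card_insert_of_notMem (h' T hT)]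
    ring

end Moebius

/-! ### Amalgams, direct products with a group of order two, dihedral groups. -/

section Growth

variable {V : Type*} [AddCommGroup V] [Module ℝ V] {B : LinearMap.BilinForm ℝ V}

theorem growthTerm_eq_zero {T : Finset V} (h : longest B (T : Set V) = ∅) :
    growthTerm B T = 0 := by
  simp [growthTerm, h]

theorem genFun_pair {G : Type*} (l : G → ℕ) {g g' : G} (h : l g ≠ l g') :
    genFun l {g, g'} = X ^ l g + X ^ l g' := by
  rw [← genFun_singleton l g, ← genFun_singleton l g']
  ext k
  simp only [genFun, coeff_mk, map_add]
  norm_cast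
  rw [← Set.ncard_union_eq]
  · congr 1
    ext x
    simp only [Set.mem_ofPred_eq, Set.mem_union, Set.mem_insert_iff, Set.mem_singleton_iff]
    tauto
  · rw [Set.disjoint_left]
    rintro x ⟨rfl, rfl⟩ ⟨h', -⟩
    exact h (congrArg l h')

theorem commute_refl {a b : V} (hB : ∀ x y, B x y = B y x) (hab : B a b = 0) :
    refl B a * refl B b = refl B b * refl B a := by
  by_cases ha : B a a = 1
  · by_cases hb : B b b = 1
    · ext x
      simp only [LinearEquiv.mul_apply, refl_apply ha, refl_apply hb, map_sub, map_smul, hab,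
        hB b a, smul_eq_mul]
      module
    · simp [refl, hb]
  · simp [refl, ha]

namespace IsRootBasis

theorem longest_eq_singleton {R : Set V} (h : IsRootBasis B R) {w : V ≃ₗ[ℝ] V}
    (hw : w ∈ longest B R) : longest B R = {w} :=
  Set.eq_singleton_iff_unique_mem.2 ⟨hw, fun _ hw' => h.longest_subsingleton hw' hw⟩

theorem growthTerm_eq {R : Finset V} (h : IsRootBasis B (R : Set V)) {w : V ≃ₗ[ℝ] V}
    (hw : w ∈ longest B (R : Set V)) :
    growthTerm B R = (-1) ^ R.card * X ^ rlen B R w * growthInv B (R : Set V) := by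
  rw [growthTerm, h.longest_eq_singleton hw, genFun_singleton]

/-- The vector a + b is nonzero and has product 1 + B a b ≤ 0 with both roots. -/
theorem longest_pair_eq_empty {a b : V} (h : IsRootBasis B {a, b}) (hab : B a b ≤ -1) :
    longest B {a, b} = ∅ := by
  have ha : a ∈ PointedCone.hull ℝ ({a, b} : Set V) := Submodule.subset_span (by simp)
  have hb : b ∈ PointedCone.hull ℝ ({a, b} : Set V) := Submodule.subset_span (by simp)
  refine h.longest_eq_empty (c := a + b) (add_mem ha hb) (fun h0 => ?_) ?_
  · exact h.ne_zero (a := a) (by simp) (h.eq_zero_of_mem_hull_of_neg_mem_hull ha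
      (by rwa [neg_eq_of_add_eq_zero_right h0]))
  · have h₁ := h.unit a (by simp)
    have h₂ := h.unit b (by simp)
    rintro x (rfl | rfl)
    · rw [map_add, LinearMap.add_apply, h.symm b]
      linarith
    · rw [map_add, LinearMap.add_apply]
      linarith

theorem growthTerm_eq_zero_of_le {R : Finset V} (h : IsRootBasis B (R : Set V)) {a b : V}
    (ha : a ∈ R) (hb : b ∈ R) (hab : B a b ≤ -1) : growthTerm B R = 0 := by
  have hs : ({a, b} : Set V) ⊆ R := by
    rintro x (rfl | rfl) <;> assumption
  exact growthTerm_eq_zero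
    (h.longest_eq_empty_of_subset hs ((h.mono hs).longest_pair_eq_empty hab))

/-- The growth series of an amalgamated product of two Coxeter groups along a common parabolic
subgroup. -/
theorem growthInv_union_add_inter [DecidableEq V] {R₁ R₂ : Finset V}
    (h : IsRootBasis B ((R₁ ∪ R₂ : Finset V) : Set V))
    (hR : ∀ a ∈ R₁, a ∉ R₂ → ∀ b ∈ R₂, b ∉ R₁ → B a b ≤ -1) :
    growthInv B ((R₁ ∪ R₂ : Finset V) : Set V) + growthInv B ((R₁ ∩ R₂ : Finset V) : Set V) =
      growthInv B (R₁ : Set V) + growthInv B (R₂ : Set V) := by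
  have hsub : ∀ {T : Finset V}, T ⊆ R₁ ∪ R₂ → IsRootBasis B (T : Set V) :=
    fun hT => h.mono (Finset.coe_subset.2 hT)
  rw [← h.sum_growthTerm, ← (hsub Finset.subset_union_left).sum_growthTerm,
    ← (hsub Finset.subset_union_right).sum_growthTerm,
    ← (hsub (Finset.inter_subset_left.trans Finset.subset_union_left)).sum_growthTerm,
    show (R₁ ∩ R₂).powerset = R₁.powerset ∩ R₂.powerset by
      ext; simp only [Finset.mem_powerset, Finset.mem_inter, Finset.subset_inter_iff],
    ← Finset.sum_union_inter (s₁ := R₁.powerset)]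
  congr 1
  symm
  -- In Steinberg's formula for the union, a subset contained in neither part contains a pair with
  -- product at most -1, so it generates a group without longest element and contributes 0.
  refine Finset.sum_subset ?_ fun T hT hT' => ?_
  · exact Finset.union_subset (Finset.powerset_mono.2 Finset.subset_union_left)
      (Finset.powerset_mono.2 Finset.subset_union_right)
  · rw [Finset.mem_powerset] at hT
    simp only [Finset.mem_union, Finset.mem_powerset, not_or, Finset.not_subset] at hT'
    obtain ⟨⟨b, hbT, hb⟩, a, haT, ha⟩ := hT'
    refine (hsub hT).growthTerm_eq_zero_of_le haT hbT (hR a ?_ ha b ?_ hb)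
    · exact (Finset.mem_union.1 (hT haT)).resolve_right ha
    · exact (Finset.mem_union.1 (hT hbT)).resolve_left hb

/-- The group is the direct product of the subgroup of R with the reflection in f. An element v or
s_f v with v ≠ 1 sends some root of R to a negative combination of R, which s_f fixes. -/
theorem minReps_insert {R : Set V} {f : V} (h : IsRootBasis B (insert f R))
    (hf : ∀ a ∈ R, B f a = 0) : minReps B (insert f R) R = {1, refl B f} := by
  have hR : R ⊆ insert f R := Set.subset_insert f R
  have hff : B f f = 1 := h.unit f (by simp)
  have hfix : ∀ x ∈ PointedCone.hull ℝ R, B f x = 0 := by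
    intro x hx
    induction hx using Submodule.span_induction with
    | mem x hx => exact hf x hx
    | zero => simp
    | add x y _ _ hx hy => rw [map_add, hx, hy, add_zero]
    | smul c x _ hx =>
      have : B f (c • x) = (c : ℝ) * B f x := LinearMap.map_smul (B f) (c : ℝ) x
      rw [this, hx, mul_zero]
  have hdec : ∀ u ∈ reflGroup B (insert f R), u ∈ reflGroup B R ∨
      ∃ v ∈ reflGroup B R, u = refl B f * v := by
    have hcomm : ∀ v ∈ reflGroup B R, v * refl B f = refl B f * v := by
      intro v hv
      induction hv using Subgroup.closure_induction with
      | mem s hs =>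
        obtain ⟨a, ha, rfl⟩ := hs
        exact (commute_refl h.symm (hf a ha)).symm
      | one => simp
      | mul g g' _ _ hg hg' => rw [mul_assoc, hg', ← mul_assoc, hg, mul_assoc]
      | inv g _ hg => rw [inv_mul_eq_iff_eq_mul, ← mul_assoc, hg, mul_inv_cancel_right]
    intro u hu
    induction hu using Subgroup.closure_induction with
    | mem s hs =>
      obtain ⟨a, rfl | ha, rfl⟩ := hs
      · exact Or.inr ⟨1, one_mem _, (mul_one _).symm⟩
      · exact Or.inl (refl_mem_reflGroup ha)
    | one => exact Or.inl (one_mem _)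
    | mul g g' _ _ hg hg' =>
      rcases hg with hg | ⟨v, hv, rfl⟩ <;> rcases hg' with hg' | ⟨v', hv', rfl⟩
      · exact Or.inl (mul_mem hg hg')
      · exact Or.inr ⟨g * v', mul_mem hg hv', by rw [← mul_assoc, hcomm g hg, mul_assoc]⟩
      · exact Or.inr ⟨v * g', mul_mem hv hg', mul_assoc _ _ _⟩
      · refine Or.inl ?_
        rw [← hcomm v hv, mul_assoc, ← mul_assoc (refl B f), refl_mul_self, one_mul]
        exact mul_mem hv hv'
    | inv g _ hg =>
      rcases hg with hg | ⟨v, hv, rfl⟩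
      · exact Or.inl (inv_mem hg)
      · refine Or.inr ⟨v⁻¹, inv_mem hv, ?_⟩
        rw [← hcomm v hv, mul_inv_rev]
        congr 1
        rw [_root_.inv_eq_iff_mul_eq_one, refl_mul_self]
  ext u
  constructor
  · rintro ⟨hu, hpos⟩
    have key : ∀ v ∈ reflGroup B R, (∀ a ∈ R, -v a ∈ PointedCone.hull ℝ R → v a = u a) →
        v = 1 := by
      intro v hv hvu
      by_contra h1
      obtain ⟨a, ha, hna⟩ := (h.mono hR).exists_neg_mem_hull hv h1
      refine h.not_mem_hull_and_neg_mem_hull (w := u) (h.ne_zero (hR ha)) ⟨hpos a ha, ?_⟩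
      rw [← hvu a ha hna]
      exact Submodule.span_mono hR hna
    rcases hdec u hu with hu' | ⟨v, hv, rfl⟩
    · exact Or.inl (key u hu' fun _ _ _ => rfl)
    · refine Or.inr ?_
      rw [key v hv, mul_one, Set.mem_singleton_iff]
      intro a ha hna
      have := hfix _ hna
      rw [map_neg, neg_eq_zero] at this
      rw [LinearEquiv.mul_apply, refl_apply hff, this]
      simp
  · rintro (rfl | rfl)
    · exact ⟨one_mem _, fun a ha => Submodule.subset_span (hR ha)⟩
    · refine ⟨refl_mem_reflGroup (by simp), fun a ha => ?_⟩
      rw [refl_apply hff, hf a ha]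
      simpa using Submodule.subset_span (hR ha)

theorem rlen_refl {R : Set V} (h : IsRootBasis B R) {a : V} (ha : a ∈ R) :
    rlen B R (refl B a) = 1 := by
  have := h.rlen_mul_refl_of_mem_hull (one_mem _) ha (Submodule.subset_span ha)
  rwa [one_mul, rlen, rlen, wordLength_one, zero_add] at this

/-- The growth series of the product of a Coxeter group with a group of order two. -/
theorem growthInv_insert {R : Set V} {f : V} (h : IsRootBasis B (insert f R)) (hR : R.Finite)
    (hf : ∀ a ∈ R, B f a = 0) : growthInv B (insert f R) * (1 + X) = growthInv B R := by
  have h₁ := h.genFun_minReps_mul_growth (hR.insert f) (Set.subset_insert f R)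
  have h0 : rlen B (insert f R) 1 = 0 := wordLength_one
  have hr := h.rlen_refl (a := f) (by simp)
  rw [h.minReps_insert hf, genFun_pair _ (by omega), h0, hr] at h₁
  have h₂ := growth_mul_growthInv (B := B) R
  have h₃ := growth_mul_growthInv (B := B) (insert f R)
  linear_combination (-growthInv B (insert f R) * (1 + X)) * h₂ + growthInv B R * h₃
    + growthInv B R * growthInv B (insert f R) * h₁

theorem growthInv_singleton {a : V} (h : IsRootBasis B {a}) :
    growthInv B {a} * (1 + X) = 1 := by
  have := (show IsRootBasis B (insert a ∅) by simpa using h).growthInv_insert Set.finite_empty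
    (by simp)
  rwa [growthInv_empty, insert_empty_eq] at this

/-- Inverted Steinberg formula: the alternating sum of all 1/W_T is t^N / W_R if there is a longest
element of length N, and 0 if there is none. In rank two and three it is solved for 1/W_R. -/
theorem sum_growthInv [DecidableEq V] {R : Finset V} (h : IsRootBasis B (R : Set V)) :
    ∑ T ∈ R.powerset, (-1) ^ T.card * growthInv B (T : Set V) = (-1) ^ R.card * growthTerm B R :=
  sum_powerset_neg_one_pow_mul R (growthTerm B) _ fun _ hT =>
    (h.mono (Finset.coe_subset.2 hT)).sum_growthTerm.symm

/-! ### Dihedral groups -/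

/-- Every prefix of length k < m maps the root of the next letter to a combination with coefficients
sin(jπ/m)/sin(π/m), j ≤ m, so each letter adds one to the length. -/
theorem rlen_altProd {a b : V} (h : IsRootBasis B {b, a}) {m : ℕ} (hm : 2 ≤ m)
    (hab : B a b = -Real.cos (Real.pi / m)) : ∀ k ≤ m,
      rlen B {b, a} (altProd (refl B b) (refl B a) k) = k ∧
      rlen B {b, a} (altProd (refl B a) (refl B b) k) = k := by
  have ha := h.unit a (by simp)
  have hb := h.unit b (by simp)
  have haR : a ∈ ({b, a} : Set V) := by simp
  have hbR : b ∈ ({b, a} : Set V) := by simp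
  have haC : a ∈ PointedCone.hull ℝ ({b, a} : Set V) := Submodule.subset_span haR
  have hbC : b ∈ PointedCone.hull ℝ ({b, a} : Set V) := Submodule.subset_span hbR
  obtain ⟨hU, -, -⟩ := chebU_cos_pi_div hm
  have hcos : -B a b = Real.cos (Real.pi / m) := by rw [hab, neg_neg]
  have hmem : ∀ k, altProd (refl B b) (refl B a) k ∈ reflGroup B {b, a} ∧
      altProd (refl B a) (refl B b) k ∈ reflGroup B {b, a} := by
    intro k
    rw [reflGroup, refls, Set.image_pair]
    exact ⟨altProd_mem k, by rw [Set.pair_comm]; exact altProd_mem k⟩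
  intro k
  induction k with
  | zero => intro _; simp [altProd, rlen]
  | succ k ih =>
    intro hk
    obtain ⟨ih₁, ih₂⟩ := ih (by omega)
    have h₀ := hU k (by omega)
    have h₁ := hU (k + 1) hk
    constructor
    · rw [altProd_succ_right, h.rlen_mul_refl_of_mem_hull (hmem k).2 hbR, ih₂]
      rw [altProd_refl_apply h.symm hb ha, h.symm b a, hcos]
      split_ifs
      · exact add_mem (PointedCone.smul_mem _ h₁ hbC) (PointedCone.smul_mem _ h₀ haC)
      · exact add_mem (PointedCone.smul_mem _ h₀ hbC) (PointedCone.smul_mem _ h₁ haC)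
    · rw [altProd_succ_right, h.rlen_mul_refl_of_mem_hull (hmem k).1 haR, ih₁]
      rw [altProd_refl_apply h.symm ha hb, hcos]
      split_ifs
      · exact add_mem (PointedCone.smul_mem _ h₁ haC) (PointedCone.smul_mem _ h₀ hbC)
      · exact add_mem (PointedCone.smul_mem _ h₀ haC) (PointedCone.smul_mem _ h₁ hbC)

theorem altProd_mem_longest {a b : V} (h : IsRootBasis B {b, a}) {m : ℕ} (hm : 2 ≤ m)
    (hab : B a b = -Real.cos (Real.pi / m)) :
    altProd (refl B b) (refl B a) m ∈ longest B {b, a} := by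
  have hl := h.rlen_altProd hm hab
  have hS : ∀ s ∈ ({refl B b, refl B a} : Set _), s * s = 1 := by
    rintro s (rfl | rfl) <;> exact refl_mul_self _
  have hmem : altProd (refl B b) (refl B a) m ∈ reflGroup B {b, a} := by
    rw [reflGroup, refls, Set.image_pair]
    exact altProd_mem m
  obtain ⟨n, rfl⟩ : ∃ n, m = n + 1 := ⟨m - 1, by omega⟩
  obtain ⟨-, h₂, h₃⟩ := chebU_cos_pi_div hm
  have hcos : -B a b = Real.cos (Real.pi / (n + 1 : ℕ)) := by rw [hab, neg_neg]
  refine ⟨hmem, ?_⟩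
  rintro x (rfl | rfl)
  · refine h.neg_mem_hull_of_rlen_lt hmem (by simp) ?_
    rw [altProd_succ_right, mul_assoc, refl_mul_self, mul_one, (hl n (by omega)).2,
      ← altProd_succ_right, (hl _ le_rfl).1]
    omega
  · have ha := h.unit x (by simp)
    have hb := h.unit b (by simp)
    -- The label is n + 1, so this is sin((m + 1)π/m)/sin(π/m) with m = n + 1: the longest element
    -- maps x to -x or -b.
    have h₄ : chebU (-B x b) (n + 2) = -1 := by
      rw [chebU, hcos, h₂, show chebU _ n = 1 from h₃]
      ring
    rw [altProd_refl_apply h.symm ha hb, h₄, hcos, h₂]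
    split_ifs
    · rw [zero_smul, add_zero, neg_one_smul, neg_neg]
      exact Submodule.subset_span (by simp)
    · rw [zero_smul, zero_add, neg_one_smul, neg_neg]
      exact Submodule.subset_span (by simp)

theorem growthInv_pair {a b : V} (h : IsRootBasis B {a, b}) (hne : a ≠ b) {m : ℕ} (hm : 2 ≤ m)
    (hab : B a b = -Real.cos (Real.pi / m)) :
    growthInv B {a, b} * (1 + X) * (∑ i ∈ Finset.range m, X ^ i) = 1 := by
  classical
  have hR : ((({a, b} : Finset V)) : Set V) = {a, b} := by simp
  have h' : IsRootBasis B (({a, b} : Finset V) : Set V) := by rwa [hR]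
  have hsum := h'.sum_growthInv
  rw [h'.growthTerm_eq (w := altProd (refl B a) (refl B b) m) (by
      rw [hR]
      exact h.altProd_mem_longest hm (by rw [h.symm, hab])), hR,
    (h.rlen_altProd hm (by rw [h.symm, hab]) m le_rfl).1,
    Finset.sum_powerset_insert (by simpa using hne), ← insert_empty_eq b,
    Finset.sum_powerset_insert (by simp), Finset.sum_powerset_insert (by simp)] at hsum
  simp only [Finset.powerset_empty, Finset.sum_singleton, Finset.card_empty, insert_empty_eq,
    Finset.card_singleton, Finset.card_pair hne, Finset.coe_empty, Finset.coe_singleton, hR,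
    growthInv_empty] at hsum
  have ha := (h.mono (T := {a}) (by simp)).growthInv_singleton
  have hb := (h.mono (T := {b}) (by simp)).growthInv_singleton
  have hg : (∑ i ∈ Finset.range m, (X : PowerSeries ℤ) ^ i) * (1 - X) = 1 - X ^ m :=
    geom_sum_mul_neg X m
  have hX : (1 - X : PowerSeries ℤ) ≠ 0 := fun h0 => by
    simpa using congrArg constantCoeff h0
  -- The inverted formula reads (1 - t^m)/W = 2/(1 + t) - 1 = (1 - t)/(1 + t); the factor 1 - t is
  -- cancelled.
  refine mul_right_cancel₀ hX ?_
  linear_combination (1 + X) * hsum + ha + hb + growthInv B {a, b} * (1 + X) * hg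

end IsRootBasis

end Growth

end CoxeterDomino

end

noncomputable section

namespace CoxeterDomino

open PowerSeries

/-! ### Groups of rank three -/

section RankThree

/-- Coordinate vectors of length three over `ℤ[φ]`, with `(p, q)` standing for `p + q φ`. -/
abbrev GoldVec : Type := (ℤ × ℤ) × (ℤ × ℤ) × (ℤ × ℤ)

namespace GoldVec

/-- The product in `ℤ[φ]`. -/
def mul (k x : ℤ × ℤ) : ℤ × ℤ := (k.1 * x.1 + k.2 * x.2, k.1 * x.2 + k.2 * x.1 + k.2 * x.2)

/-- The action of the simple reflections of a linear Coxeter graph of rank three on coordinate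
vectors; the off-diagonal entries of the Gram matrix are `-k / 2` and `-1 / 2`. -/
def step (k : ℤ × ℤ) (i : Fin 3) (t : GoldVec) : GoldVec :=
  match i with
  | 0 => (-t.1 + mul k t.2.1, t.2.1, t.2.2)
  | 1 => (t.1, -t.2.1 + mul k t.1 + t.2.2, t.2.2)
  | 2 => (t.1, t.2.1, -t.2.2 + t.2.1)

/-- The action of a word in the simple reflections. -/
def run (k : ℤ × ℤ) (w : List (Fin 3)) (t : GoldVec) : GoldVec := w.foldr (step k) t

/-- The simple roots. -/
def unit (i : Fin 3) : GoldVec :=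
  match i with
  | 0 => ((1, 0), (0, 0), (0, 0))
  | 1 => ((0, 0), (1, 0), (0, 0))
  | 2 => ((0, 0), (0, 0), (1, 0))

/-- Nonnegativity of both coordinates. -/
def Nonneg (x : ℤ × ℤ) : Prop := 0 ≤ x.1 ∧ 0 ≤ x.2

instance (x : ℤ × ℤ) : Decidable (Nonneg x) := inferInstanceAs (Decidable (_ ∧ _))

/-- Nonnegativity of all coordinates. -/
def IsPos (t : GoldVec) : Prop := Nonneg t.1 ∧ Nonneg t.2.1 ∧ Nonneg t.2.2

instance (t : GoldVec) : Decidable (IsPos t) := inferInstanceAs (Decidable (_ ∧ _ ∧ _))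

/-- The word is reduced and represents an element that makes all simple roots negative. -/
def IsLongestWord (k : ℤ × ℤ) (w : List (Fin 3)) : Prop :=
  (∀ i : Fin w.length, IsPos (run k (w.take i) (unit (w.get i)))) ∧
    ∀ i : Fin 3, IsPos (-run k w (unit i))

instance (k : ℤ × ℤ) (w : List (Fin 3)) : Decidable (IsLongestWord k w) :=
  inferInstanceAs (Decidable (_ ∧ _))

theorem isLongestWord_A3 : IsLongestWord (1, 0) [0, 1, 0, 2, 1, 0] := by decide

/-- The word is the fifth power of a Coxeter element of order 10, which is the longest element, of
length 15. -/
theorem isLongestWord_H3 :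
    IsLongestWord (0, 1) [0, 1, 2, 0, 1, 2, 0, 1, 2, 0, 1, 2, 0, 1, 2] := by decide

end GoldVec

open GoldVec Real

variable {V : Type*} [AddCommGroup V] [Module ℝ V] {B : LinearMap.BilinForm ℝ V}

/-- The value of an element of `ℤ[φ]`. -/
def goldVal (x : ℤ × ℤ) : ℝ := x.1 + x.2 * goldenRatio

theorem goldVal_add (x y : ℤ × ℤ) : goldVal (x + y) = goldVal x + goldVal y := by
  simp only [goldVal, Prod.fst_add, Prod.snd_add]
  push_cast
  ring

theorem goldVal_neg (x : ℤ × ℤ) : goldVal (-x) = -goldVal x := by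
  simp only [goldVal, Prod.fst_neg, Prod.snd_neg]
  push_cast
  ring

theorem goldVal_mul (k x : ℤ × ℤ) : goldVal (GoldVec.mul k x) = goldVal k * goldVal x := by
  simp only [goldVal, GoldVec.mul]
  push_cast
  linear_combination (-(k.2 : ℝ) * x.2) * goldenRatio_sq

/-- Only a sufficient condition, but it holds for all the roots met in the two longest words, so
that positivity can be decided in integers. -/
theorem goldVal_nonneg {x : ℤ × ℤ} (hx : Nonneg x) : 0 ≤ goldVal x :=
  add_nonneg (Int.cast_nonneg hx.1) (mul_nonneg (Int.cast_nonneg hx.2) goldenRatio_pos.le)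

/-- The vector with the given coordinates. -/
def goldComb (e : Fin 3 → V) (t : GoldVec) : V :=
  goldVal t.1 • e 0 + goldVal t.2.1 • e 1 + goldVal t.2.2 • e 2

theorem goldComb_unit (e : Fin 3 → V) (i : Fin 3) : goldComb e (unit i) = e i := by
  fin_cases i <;> simp [goldComb, unit, goldVal]

theorem goldComb_neg (e : Fin 3 → V) (t : GoldVec) : goldComb e (-t) = -goldComb e t := by
  simp only [goldComb, Prod.fst_neg, Prod.snd_neg, goldVal_neg]
  module

theorem goldComb_mem_hull (e : Fin 3 → V) {t : GoldVec} (ht : IsPos t) :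
    goldComb e t ∈ PointedCone.hull ℝ (Set.range e) := by
  have he : ∀ i, e i ∈ PointedCone.hull ℝ (Set.range e) := fun i =>
    Submodule.subset_span (Set.mem_range_self i)
  exact add_mem (add_mem (PointedCone.smul_mem _ (goldVal_nonneg ht.1) (he 0))
    (PointedCone.smul_mem _ (goldVal_nonneg ht.2.1) (he 1)))
    (PointedCone.smul_mem _ (goldVal_nonneg ht.2.2) (he 2))

theorem refl_goldComb {e : Fin 3 → V} (hB : ∀ x y, B x y = B y x) (hu : ∀ i, B (e i) (e i) = 1)
    {k : ℤ × ℤ} (h01 : B (e 0) (e 1) = -goldVal k / 2) (h12 : B (e 1) (e 2) = -1 / 2)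
    (h02 : B (e 0) (e 2) = 0) (i : Fin 3) (t : GoldVec) :
    refl B (e i) (goldComb e t) = goldComb e (step k i t) := by
  have h10 := (hB (e 1) (e 0)).trans h01
  have h21 := (hB (e 2) (e 1)).trans h12
  have h20 := (hB (e 2) (e 0)).trans h02
  rw [refl_apply (hu i)]
  fin_cases i <;>
  · simp only [goldComb, step, Fin.zero_eta, Fin.mk_one, Fin.reduceFinMk, map_add, map_smul, hu,
      h01, h12, h02, h10, h21, h20, smul_eq_mul, goldVal_add, goldVal_neg, goldVal_mul]
    module

theorem prod_refl_goldComb {e : Fin 3 → V} (hB : ∀ x y, B x y = B y x)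
    (hu : ∀ i, B (e i) (e i) = 1)
    {k : ℤ × ℤ} (h01 : B (e 0) (e 1) = -goldVal k / 2) (h12 : B (e 1) (e 2) = -1 / 2)
    (h02 : B (e 0) (e 2) = 0) (w : List (Fin 3)) (t : GoldVec) :
    (w.map fun i => refl B (e i)).prod (goldComb e t) = goldComb e (run k w t) := by
  induction w with
  | nil => rfl
  | cons i w ih =>
    rw [List.map_cons, List.prod_cons, LinearEquiv.mul_apply, ih,
      refl_goldComb hB hu h01 h12 h02]
    rfl

theorem IsRootBasis.longest_of_isLongestWord {e : Fin 3 → V} (h : IsRootBasis B (Set.range e))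
    {k : ℤ × ℤ} (h01 : B (e 0) (e 1) = -goldVal k / 2) (h12 : B (e 1) (e 2) = -1 / 2)
    (h02 : B (e 0) (e 2) = 0) {w : List (Fin 3)} (hw : IsLongestWord k w) :
    ∃ g ∈ longest B (Set.range e), rlen B (Set.range e) g = w.length := by
  have he : ∀ i, e i ∈ Set.range e := Set.mem_range_self
  have hrun := prod_refl_goldComb h.symm (fun i => h.unit _ (he i)) h01 h12 h02
  have hmem : ∀ v : List (Fin 3), (v.map fun i => refl B (e i)).prod ∈ reflGroup B (Set.range e) :=
    fun v => Subgroup.list_prod_mem _ fun s hs => by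
      obtain ⟨i, -, rfl⟩ := List.mem_map.1 hs
      exact refl_mem_reflGroup (he i)
  refine ⟨_, ⟨hmem w, ?_⟩, ?_⟩
  · rintro _ ⟨i, rfl⟩
    rw [← goldComb_unit e i, hrun, ← goldComb_neg]
    exact goldComb_mem_hull e (hw.2 i)
  -- Each prefix keeps the simple root of the next letter positive, so every letter increases the
  -- length.
  · have key : ∀ n ≤ w.length,
        rlen B (Set.range e) ((w.take n).map fun i => refl B (e i)).prod = n := by
      intro n
      induction n with
      | zero => simp [rlen]
      | succ n ih =>
        intro hn
        rw [List.take_succ_eq_append_getElem hn, List.map_append, List.prod_append,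
          List.map_singleton, List.prod_singleton,
          h.rlen_mul_refl_of_mem_hull (hmem _) (he _), ih (by omega)]
        rw [← goldComb_unit e, hrun]
        exact goldComb_mem_hull e (hw.1 ⟨n, hn⟩)
    simpa using key w.length le_rfl

end RankThree

end CoxeterDomino

end

noncomputable section

namespace CoxeterDomino

open PowerSeries

/-! ### Families of simple roots with given labels -/

section Family

variable {V : Type*} [AddCommGroup V] [Module ℝ V] {B : LinearMap.BilinForm ℝ V} {n : ℕ}

/-- A root basis, indexed by `Fin n`, whose Coxeter graph has the finite labels `m`. -/
structure CoxeterFamily (B : LinearMap.BilinForm ℝ V) (m : Fin n → Fin n → ℕ) (e : Fin n → V) :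
    Prop where
  basis : IsRootBasis B (Set.range e)
  gram : ∀ i j, B (e i) (e j) = -Real.cos (Real.pi / m i j)
  two_le : ∀ i j, i ≠ j → 2 ≤ m i j

/-- The inverse growth series of the parabolic subgroup that belongs to the index set `T`. -/
def parInv (B : LinearMap.BilinForm ℝ V) (e : Fin n → V) (T : Finset (Fin n)) : PowerSeries ℤ :=
  growthInv B (e '' (T : Set (Fin n)))

/-- The polynomial `[2][4][6][10]` as a power series. -/
def numS : PowerSeries ℤ := (1 + X) * (1 + X + X ^ 2 + X ^ 3) *
  (1 + X + X ^ 2 + X ^ 3 + X ^ 4 + X ^ 5) *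
  (1 + X + X ^ 2 + X ^ 3 + X ^ 4 + X ^ 5 + X ^ 6 + X ^ 7 + X ^ 8 + X ^ 9)

namespace CoxeterFamily

variable {m : Fin n → Fin n → ℕ} {e : Fin n → V}

theorem injective (h : CoxeterFamily B m e) : Function.Injective e := by
  intro i j hij
  by_contra hne
  have h₁ := h.gram i j
  have hm : (2 : ℝ) ≤ m i j := by exact_mod_cast h.two_le i j hne
  rw [← hij, h.basis.unit _ (Set.mem_range_self i)] at h₁
  have : 0 ≤ Real.cos (Real.pi / m i j) := by
    apply Real.cos_nonneg_of_neg_pi_div_two_le_of_le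
    · exact le_trans (b := 0) (by linarith [Real.pi_pos]) (by positivity)
    · gcongr
  linarith

theorem comp (h : CoxeterFamily B m e) {k : ℕ} {σ : Fin k → Fin n} (hσ : Function.Injective σ) :
    CoxeterFamily B (fun i j => m (σ i) (σ j)) (e ∘ σ) where
  basis := h.basis.mono (Set.range_comp_subset_range σ e)
  gram _ _ := h.gram _ _
  two_le _ _ hij := h.two_le _ _ (hσ.ne hij)

theorem isRootBasis_image (h : CoxeterFamily B m e) (T : Set (Fin n)) :
    IsRootBasis B (e '' T) := h.basis.mono (Set.image_subset_range e T)

theorem parInv_empty : parInv B e ∅ = 1 := by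
  rw [parInv, Finset.coe_empty, Set.image_empty, growthInv_empty]

theorem parInv_singleton (h : CoxeterFamily B m e) (i : Fin n) :
    parInv B e {i} * (1 + X) = 1 := by
  have := h.isRootBasis_image {i}
  rw [parInv, Finset.coe_singleton]
  rw [Set.image_singleton] at this ⊢
  exact this.growthInv_singleton

theorem parInv_pair (h : CoxeterFamily B m e) {i j : Fin n} (hij : i ≠ j) :
    parInv B e {i, j} * (1 + X) * (∑ k ∈ Finset.range (m i j), X ^ k) = 1 := by
  have := h.isRootBasis_image {i, j}
  rw [parInv, Finset.coe_pair]
  rw [Set.image_pair] at this ⊢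
  exact this.growthInv_pair (h.injective.ne hij) (h.two_le i j hij) (h.gram i j)

theorem parInv_insert (h : CoxeterFamily B m e) {f : Fin n} {T : Finset (Fin n)}
    (hf : ∀ i ∈ T, m f i = 2) : parInv B e (insert f T) * (1 + X) = parInv B e T := by
  have := h.isRootBasis_image (insert f (T : Set (Fin n)))
  rw [parInv, Finset.coe_insert]
  rw [Set.image_insert_eq] at this ⊢
  refine this.growthInv_insert (T.finite_toSet.image e) ?_
  rintro _ ⟨i, hi, rfl⟩
  rw [h.gram, hf i hi]
  simp

/-- The inverted Steinberg formula on index sets. Only the two possible values of the last term t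
matter: the one with a longest element, and 0. -/
theorem sum_parInv (h : CoxeterFamily B m e) (R : Finset (Fin n)) :
    ∃ t, (∀ g ∈ longest B (e '' (R : Set (Fin n))), t = (-1) ^ R.card *
        X ^ rlen B (e '' (R : Set (Fin n))) g * parInv B e R) ∧
      (longest B (e '' (R : Set (Fin n))) = ∅ → t = 0) ∧
      ∑ T ∈ R.powerset, (-1) ^ T.card * parInv B e T = (-1) ^ R.card * t := by
  classical
  have hb : ∀ T : Finset (Fin n), IsRootBasis B ((T.image e : Finset V) : Set V) := fun T => by
    rw [Finset.coe_image]
    exact h.isRootBasis_image T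
  refine ⟨growthTerm B (R.image e), fun g hg => ?_, fun h0 => ?_, ?_⟩
  · rw [← Finset.coe_image] at hg
    rw [(hb R).growthTerm_eq hg, Finset.card_image_of_injective _ h.injective, Finset.coe_image,
      parInv]
  · exact growthTerm_eq_zero (by rwa [Finset.coe_image])
  · refine sum_powerset_neg_one_pow_mul R (fun T => growthTerm B (T.image e)) _ fun T _ => ?_
    rw [parInv, ← Finset.coe_image, ← (hb T).sum_growthTerm, Finset.powerset_image,
      Finset.sum_image]
    exact fun U _ U' _ hU => Finset.image_injective h.injective hU

theorem sum_parInv_eq_zero (h : CoxeterFamily B m e) {R : Finset (Fin n)}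
    (hR : longest B (e '' (R : Set (Fin n))) = ∅) :
    ∑ T ∈ R.powerset, (-1) ^ T.card * parInv B e T = 0 := by
  obtain ⟨t, -, h0, ht⟩ := h.sum_parInv R
  rw [ht, h0 hR, mul_zero]

/-- The diagonal labels are 1 and cos π = -1, so the condition on c says that ∑ cᵢ eᵢ has
nonpositive product with every root. -/
theorem longest_eq_empty (h : CoxeterFamily B m e) (c : Fin n → ℝ) (hc : ∀ i, 0 ≤ c i)
    (hc' : ∃ i, c i ≠ 0) (hch : ∀ j, ∑ i, c i * Real.cos (Real.pi / m i j) ≥ 0) :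
    longest B (Set.range e) = ∅ := by
  refine h.basis.longest_eq_empty (c := ∑ i, c i • e i)
    (sum_mem fun i _ => PointedCone.smul_mem _ (hc i) (Submodule.subset_span ⟨i, rfl⟩)) ?_ ?_
  · obtain ⟨φ, hφ⟩ := h.basis.pos
    intro h0
    obtain ⟨i, hi⟩ := hc'
    have := congrArg φ h0
    rw [map_sum, map_zero] at this
    simp only [map_smul, smul_eq_mul] at this
    rw [Finset.sum_eq_zero_iff_of_nonneg
      fun i _ => mul_nonneg (hc i) (hφ _ (Set.mem_range_self i)).le] at this
    exact (mul_ne_zero hi (hφ _ (Set.mem_range_self i)).ne') (this i (Finset.mem_univ i))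
  · rintro _ ⟨j, rfl⟩
    rw [map_sum, LinearMap.sum_apply]
    simp only [map_smul, LinearMap.smul_apply, smul_eq_mul, h.gram, mul_neg,
      Finset.sum_neg_distrib]
    linarith [hch j]

theorem sum_powerset_three {i j k : Fin n} (hij : i ≠ j) (hik : i ≠ k) (hjk : j ≠ k)
    (f : Finset (Fin n) → PowerSeries ℤ) :
    ∑ T ∈ ({i, j, k} : Finset (Fin n)).powerset, (-1) ^ T.card * f T =
      f ∅ - f {i} - f {j} - f {k} + f {i, j} + f {i, k} + f {j, k} - f {i, j, k} := by
  have hs : ∀ g : Finset (Fin n) → PowerSeries ℤ,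
      ∑ T ∈ ({k} : Finset (Fin n)).powerset, g T = g ∅ + g {k} := fun g => by
    rw [← insert_empty_eq k, Finset.sum_powerset_insert (Finset.notMem_empty k)]
    simp
  simp only [Finset.sum_powerset_insert (show i ∉ ({j, k} : Finset (Fin n)) by simp [hij, hik]),
    Finset.sum_powerset_insert (show j ∉ ({k} : Finset (Fin n)) by simp [hjk]), hs,
    insert_empty_eq, Finset.card_empty, Finset.card_singleton,
    Finset.card_pair hij, Finset.card_pair hik, Finset.card_pair hjk,
    Finset.card_eq_three.2 ⟨i, j, k, hij, hik, hjk, rfl⟩]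
  ring

theorem parInv_three (h : CoxeterFamily B m e) {i j k : Fin n} (hij : i ≠ j) (hik : i ≠ k)
    (hjk : j ≠ k) {c : ℤ × ℤ} (hc : Real.cos (Real.pi / m i j) = goldVal c / 2)
    (h12 : m j k = 3) (h02 : m i k = 2) {w : List (Fin 3)} (hw : GoldVec.IsLongestWord c w) :
    parInv B e {i, j, k} * (1 - (-1) ^ 3 * X ^ w.length) =
      1 - parInv B e {i} - parInv B e {j} - parInv B e {k} + parInv B e {i, j}
        + parInv B e {i, k} + parInv B e {j, k} := by
  have hr : Set.range (e ∘ ![i, j, k]) = e '' (({i, j, k} : Finset (Fin n)) : Set (Fin n)) := by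
    rw [Set.range_comp]
    congr 1
    ext x
    simp [eq_comm]
    tauto
  have hb : IsRootBasis B (Set.range (e ∘ ![i, j, k])) := hr ▸ h.isRootBasis_image _
  obtain ⟨g, hg, hgl⟩ := hb.longest_of_isLongestWord (k := c)
    (by simp [h.gram, hc, neg_div]) (by simp [h.gram, h12, neg_div]) (by simp [h.gram, h02]) hw
  rw [hr] at hg hgl
  obtain ⟨t, ht, -, hsum⟩ := h.sum_parInv {i, j, k}
  rw [sum_powerset_three hij hik hjk, parInv_empty, ht g hg, hgl,
    Finset.card_eq_three.2 ⟨i, j, k, hij, hik, hjk, rfl⟩] at hsum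
  linear_combination -hsum

theorem one_add_X_pow_ne_zero (k : ℕ) : (1 + X ^ (k + 1) : PowerSeries ℤ) ≠ 0 := fun h0 => by
  simpa using congrArg constantCoeff h0

variable (h : CoxeterFamily B m e) {i j k : Fin n}
include h

/-- The factor [2][4][6][10] is a common multiple of the Poincaré polynomials [2], [2][m] for m = 2,
3, 5, [2]^3, [2][3][4] and [2][6][10] of the finite parabolic subgroups that occur, so that from
here on the inverse growth series become polynomials. -/
theorem num_mul_one (i : Fin n) : numS * parInv B e {i} = (1 + X + X ^ 2 + X ^ 3) *
    (1 + X + X ^ 2 + X ^ 3 + X ^ 4 + X ^ 5) *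
    (1 + X + X ^ 2 + X ^ 3 + X ^ 4 + X ^ 5 + X ^ 6 + X ^ 7 + X ^ 8 + X ^ 9) := by
  rw [numS]
  linear_combination ((1 + X + X ^ 2 + X ^ 3) * (1 + X + X ^ 2 + X ^ 3 + X ^ 4 + X ^ 5) *
    (1 + X + X ^ 2 + X ^ 3 + X ^ 4 + X ^ 5 + X ^ 6 + X ^ 7 + X ^ 8 + X ^ 9)) *
    h.parInv_singleton i

theorem num_mul_two (hij : i ≠ j) (hm : m i j = 2) : numS * parInv B e {i, j} =
    (1 + X ^ 2) * (1 + X + X ^ 2 + X ^ 3 + X ^ 4 + X ^ 5) *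
    (1 + X + X ^ 2 + X ^ 3 + X ^ 4 + X ^ 5 + X ^ 6 + X ^ 7 + X ^ 8 + X ^ 9) := by
  have := h.parInv_pair hij
  simp only [hm, Finset.sum_range_succ, Finset.sum_range_zero, zero_add, pow_zero, pow_one] at this
  rw [numS]
  linear_combination ((1 + X ^ 2) * (1 + X + X ^ 2 + X ^ 3 + X ^ 4 + X ^ 5) *
    (1 + X + X ^ 2 + X ^ 3 + X ^ 4 + X ^ 5 + X ^ 6 + X ^ 7 + X ^ 8 + X ^ 9)) * this

theorem num_mul_three (hij : i ≠ j) (hm : m i j = 3) : numS * parInv B e {i, j} =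
    (1 + X + X ^ 2 + X ^ 3) * (1 + X ^ 3) *
    (1 + X + X ^ 2 + X ^ 3 + X ^ 4 + X ^ 5 + X ^ 6 + X ^ 7 + X ^ 8 + X ^ 9) := by
  have := h.parInv_pair hij
  simp only [hm, Finset.sum_range_succ, Finset.sum_range_zero, zero_add, pow_zero, pow_one] at this
  rw [numS]
  linear_combination ((1 + X + X ^ 2 + X ^ 3) * (1 + X ^ 3) *
    (1 + X + X ^ 2 + X ^ 3 + X ^ 4 + X ^ 5 + X ^ 6 + X ^ 7 + X ^ 8 + X ^ 9)) * this

theorem num_mul_five (hij : i ≠ j) (hm : m i j = 5) : numS * parInv B e {i, j} =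
    (1 + X + X ^ 2 + X ^ 3) * (1 + X + X ^ 2 + X ^ 3 + X ^ 4 + X ^ 5) * (1 + X ^ 5) := by
  have := h.parInv_pair hij
  simp only [hm, Finset.sum_range_succ, Finset.sum_range_zero, zero_add, pow_zero, pow_one] at this
  rw [numS]
  linear_combination ((1 + X + X ^ 2 + X ^ 3) * (1 + X + X ^ 2 + X ^ 3 + X ^ 4 + X ^ 5) *
    (1 + X ^ 5)) * this

theorem num_mul_A1_A1_A1 (hjk : j ≠ k) (h01 : m i j = 2) (h12 : m j k = 2) (h02 : m i k = 2) :
    numS * parInv B e {i, j, k} = (1 + X) * (1 + X ^ 2) * (1 + X ^ 2 + X ^ 4) *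
      (1 + X ^ 2 + X ^ 4 + X ^ 6 + X ^ 8) := by
  have h₁ := h.num_mul_two hjk h12
  have h₂ := h.parInv_insert (f := i) (T := {j, k}) (by simp [h01, h02])
  refine mul_right_cancel₀ (one_add_X_pow_ne_zero 0) ?_
  linear_combination h₁ + numS * h₂

theorem num_mul_A3 (hij : i ≠ j) (hik : i ≠ k) (hjk : j ≠ k) (h01 : m i j = 3) (h12 : m j k = 3)
    (h02 : m i k = 2) : numS * parInv B e {i, j, k} = (1 + X ^ 3) *
      (1 + X + X ^ 2 + X ^ 3 + X ^ 4 + X ^ 5 + X ^ 6 + X ^ 7 + X ^ 8 + X ^ 9) := by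
  have h₁ := h.parInv_three hij hik hjk (c := (1, 0)) (by simp [h01, goldVal]) h12 h02
    GoldVec.isLongestWord_A3
  simp only [List.length_cons, List.length_nil] at h₁
  -- The lemma is about 1 + t^(k + 1): the factor cancelled is 1 + t^6, with 6 the length of the
  -- longest element.
  refine mul_right_cancel₀ (one_add_X_pow_ne_zero 5) ?_
  rw [mul_assoc]
  have hN : numS = (1 + X) * (1 + X + X ^ 2 + X ^ 3) * (1 + X + X ^ 2 + X ^ 3 + X ^ 4 + X ^ 5) *
    (1 + X + X ^ 2 + X ^ 3 + X ^ 4 + X ^ 5 + X ^ 6 + X ^ 7 + X ^ 8 + X ^ 9) := rfl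
  linear_combination numS * h₁ - h.num_mul_one i - h.num_mul_one j - h.num_mul_one k
    + h.num_mul_three hij h01 + h.num_mul_three hjk h12 + h.num_mul_two hik h02 + hN

theorem num_mul_H3 (hij : i ≠ j) (hik : i ≠ k) (hjk : j ≠ k) (h01 : m i j = 5) (h12 : m j k = 3)
    (h02 : m i k = 2) : numS * parInv B e {i, j, k} = 1 + X + X ^ 2 + X ^ 3 := by
  have h₁ := h.parInv_three hij hik hjk (c := (0, 1))
    (by rw [h01]; push_cast; rw [Real.cos_pi_div_five, goldVal, Real.goldenRatio]; push_cast; ring)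
    h12 h02 GoldVec.isLongestWord_H3
  simp only [List.length_cons, List.length_nil] at h₁
  refine mul_right_cancel₀ (one_add_X_pow_ne_zero 14) ?_
  rw [mul_assoc]
  have hN : numS = (1 + X) * (1 + X + X ^ 2 + X ^ 3) * (1 + X + X ^ 2 + X ^ 3 + X ^ 4 + X ^ 5) *
    (1 + X + X ^ 2 + X ^ 3 + X ^ 4 + X ^ 5 + X ^ 6 + X ^ 7 + X ^ 8 + X ^ 9) := rfl
  linear_combination numS * h₁ - h.num_mul_one i - h.num_mul_one j - h.num_mul_one k
    + h.num_mul_five hij h01 + h.num_mul_three hjk h12 + h.num_mul_two hik h02 + hN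

end CoxeterFamily

end Family

end CoxeterDomino

end

noncomputable section

namespace CoxeterDomino

open PowerSeries

/-! ### The orthogonal facets and the extended simplex -/

/-- The labels of the Coxeter graphs of the three types of orthogonal facets. -/
def tetraLabel : FacetType → Matrix (Fin 4) (Fin 4) ℕ
  | .A => !![1, 5, 2, 3;
      5, 1, 3, 2;
      2, 3, 1, 3;
      3, 2, 3, 1]
  | .B => !![1, 2, 2, 5;
      2, 1, 2, 3;
      2, 2, 1, 3;
      5, 3, 3, 1]
  | .C => !![1, 5, 2, 3;
      5, 1, 3, 2;
      2, 3, 1, 5;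
      3, 2, 5, 1]

/-- The polynomial `[2][4][6][10]` divided by the growth series of an orthogonal facet. -/
def tetraPoly : FacetType → PowerSeries ℤ
  | .A => 1 - X ^ 2 - X ^ 3 - 2 * X ^ 4 - 2 * X ^ 5 - 2 * X ^ 6 - X ^ 7 + X ^ 11 + 2 * X ^ 12 + 2 * X ^ 13 +
      2 * X ^ 14 + X ^ 15 + X ^ 16 - X ^ 18
  | .B => 1 - X ^ 3 - X ^ 4 - 2 * X ^ 5 - X ^ 6 - X ^ 7 + X ^ 11 + X ^ 12 + 2 * X ^ 13 + X ^ 14 + X ^ 15 -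
      X ^ 18
  | .C => 1 - X ^ 2 - 2 * X ^ 3 - 4 * X ^ 4 - 4 * X ^ 5 - 3 * X ^ 6 - 2 * X ^ 7 - X ^ 8 + X ^ 10 +
      2 * X ^ 11 + 3 * X ^ 12 + 4 * X ^ 13 + 4 * X ^ 14 + 2 * X ^ 15 + X ^ 16 - X ^ 18

section

variable {V : Type*} [AddCommGroup V] [Module ℝ V] {B : LinearMap.BilinForm ℝ V}

theorem sum_powerset_univ_four (f : Finset (Fin 4) → PowerSeries ℤ) :
    ∑ T ∈ (Finset.univ : Finset (Fin 4)).powerset, (-1) ^ T.card * f T =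
      f ∅ - f {0} - f {1} - f {2} - f {3} + f {0, 1} + f {0, 2} + f {0, 3} + f {1, 2} + f {1, 3}
        + f {2, 3} - f {0, 1, 2} - f {0, 1, 3} - f {0, 2, 3} - f {1, 2, 3} + f {0, 1, 2, 3} := by
  have hs : ∀ g : Finset (Fin 4) → PowerSeries ℤ,
      ∑ T ∈ ({3} : Finset (Fin 4)).powerset, g T = g ∅ + g {3} := fun g => by
    rw [← insert_empty_eq (3 : Fin 4), Finset.sum_powerset_insert (Finset.notMem_empty _)]
    simp
  rw [show (Finset.univ : Finset (Fin 4)) = {0, 1, 2, 3} by decide]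
  simp only [Finset.sum_powerset_insert (show (0 : Fin 4) ∉ ({1, 2, 3} : Finset (Fin 4)) by decide),
    Finset.sum_powerset_insert (show (1 : Fin 4) ∉ ({2, 3} : Finset (Fin 4)) by decide),
    Finset.sum_powerset_insert (show (2 : Fin 4) ∉ ({3} : Finset (Fin 4)) by decide),
    hs, insert_empty_eq]
  simp only [Finset.card_empty, Finset.card_singleton, show ({0, 1} : Finset (Fin 4)).card = 2 by decide,
    show ({0, 2} : Finset (Fin 4)).card = 2 by decide,
    show ({0, 3} : Finset (Fin 4)).card = 2 by decide,
    show ({1, 2} : Finset (Fin 4)).card = 2 by decide,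
    show ({1, 3} : Finset (Fin 4)).card = 2 by decide,
    show ({2, 3} : Finset (Fin 4)).card = 2 by decide,
    show ({0, 1, 2} : Finset (Fin 4)).card = 3 by decide,
    show ({0, 1, 3} : Finset (Fin 4)).card = 3 by decide,
    show ({0, 2, 3} : Finset (Fin 4)).card = 3 by decide,
    show ({1, 2, 3} : Finset (Fin 4)).card = 3 by decide,
    show ({0, 1, 2, 3} : Finset (Fin 4)).card = 4 by decide]
  ring

theorem sum_powerset_univ_five (f : Finset (Fin 5) → PowerSeries ℤ) :
    ∑ T ∈ (Finset.univ : Finset (Fin 5)).powerset, (-1) ^ T.card * f T =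
      f ∅ - f {0} - f {1} - f {2} - f {3} - f {4} + f {0, 1} + f {0, 2} + f {0, 3} + f {0, 4}
        + f {1, 2} + f {1, 3} + f {1, 4} + f {2, 3} + f {2, 4} + f {3, 4} - f {0, 1, 2}
        - f {0, 1, 3} - f {0, 1, 4} - f {0, 2, 3} - f {0, 2, 4} - f {0, 3, 4} - f {1, 2, 3}
        - f {1, 2, 4} - f {1, 3, 4} - f {2, 3, 4} + f {0, 1, 2, 3} + f {0, 1, 2, 4}
        + f {0, 1, 3, 4} + f {0, 2, 3, 4} + f {1, 2, 3, 4} - f {0, 1, 2, 3, 4} := by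
  have hs : ∀ g : Finset (Fin 5) → PowerSeries ℤ,
      ∑ T ∈ ({4} : Finset (Fin 5)).powerset, g T = g ∅ + g {4} := fun g => by
    rw [← insert_empty_eq (4 : Fin 5), Finset.sum_powerset_insert (Finset.notMem_empty _)]
    simp
  rw [show (Finset.univ : Finset (Fin 5)) = {0, 1, 2, 3, 4} by decide]
  simp only [Finset.sum_powerset_insert (show (0 : Fin 5) ∉ ({1, 2, 3, 4} : Finset (Fin 5)) by decide),
    Finset.sum_powerset_insert (show (1 : Fin 5) ∉ ({2, 3, 4} : Finset (Fin 5)) by decide),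
    Finset.sum_powerset_insert (show (2 : Fin 5) ∉ ({3, 4} : Finset (Fin 5)) by decide),
    Finset.sum_powerset_insert (show (3 : Fin 5) ∉ ({4} : Finset (Fin 5)) by decide),
    hs, insert_empty_eq]
  simp only [Finset.card_empty, Finset.card_singleton, show ({0, 1} : Finset (Fin 5)).card = 2 by decide,
    show ({0, 2} : Finset (Fin 5)).card = 2 by decide,
    show ({0, 3} : Finset (Fin 5)).card = 2 by decide,
    show ({0, 4} : Finset (Fin 5)).card = 2 by decide,
    show ({1, 2} : Finset (Fin 5)).card = 2 by decide,
    show ({1, 3} : Finset (Fin 5)).card = 2 by decide,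
    show ({1, 4} : Finset (Fin 5)).card = 2 by decide,
    show ({2, 3} : Finset (Fin 5)).card = 2 by decide,
    show ({2, 4} : Finset (Fin 5)).card = 2 by decide,
    show ({3, 4} : Finset (Fin 5)).card = 2 by decide,
    show ({0, 1, 2} : Finset (Fin 5)).card = 3 by decide,
    show ({0, 1, 3} : Finset (Fin 5)).card = 3 by decide,
    show ({0, 1, 4} : Finset (Fin 5)).card = 3 by decide,
    show ({0, 2, 3} : Finset (Fin 5)).card = 3 by decide,
    show ({0, 2, 4} : Finset (Fin 5)).card = 3 by decide,
    show ({0, 3, 4} : Finset (Fin 5)).card = 3 by decide,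
    show ({1, 2, 3} : Finset (Fin 5)).card = 3 by decide,
    show ({1, 2, 4} : Finset (Fin 5)).card = 3 by decide,
    show ({1, 3, 4} : Finset (Fin 5)).card = 3 by decide,
    show ({2, 3, 4} : Finset (Fin 5)).card = 3 by decide,
    show ({0, 1, 2, 3} : Finset (Fin 5)).card = 4 by decide,
    show ({0, 1, 2, 4} : Finset (Fin 5)).card = 4 by decide,
    show ({0, 1, 3, 4} : Finset (Fin 5)).card = 4 by decide,
    show ({0, 2, 3, 4} : Finset (Fin 5)).card = 4 by decide,
    show ({1, 2, 3, 4} : Finset (Fin 5)).card = 4 by decide,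
    show ({0, 1, 2, 3, 4} : Finset (Fin 5)).card = 5 by decide]
  ring

theorem CoxeterFamily.longest_tetra {t : FacetType} {e : Fin 4 → V}
    (h : CoxeterFamily B (tetraLabel t) e) : longest B (Set.range e) = ∅ := by
  have h5 : Real.cos (Real.pi / 5) = (1 + √5) / 4 := Real.cos_pi_div_five
  have hs : (√5 : ℝ) ^ 2 = 5 := Real.sq_sqrt (by norm_num)
  have hs0 : (2 : ℝ) ≤ √5 := Real.le_sqrt_of_sq_le (by norm_num)
  have hc0 : (0 : ℝ) ≤ (1 + √5) / 4 := by linarith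
  -- In a 4-cycle every node has two neighbours with cosines at least 1/2, so the all-ones vector
  -- works. In the star, giving the centre 1 and each leaf its cosine makes the product with every
  -- leaf 0; with the centre it is 1 - cos²(π/5) - 1/2 < 0.
  refine h.longest_eq_empty (match t with
    | .A => ![1, 1, 1, 1]
    | .B => ![(1 + √5) / 4, 1 / 2, 1 / 2, 1]
    | .C => ![1, 1, 1, 1]) ?_ ?_ ?_
  · intro i
    cases t <;> fin_cases i <;> simp <;> exact hc0
  · exact ⟨3, by cases t <;> simp⟩
  · intro j
    cases t <;> fin_cases j <;>
      simp [Fin.sum_univ_four, tetraLabel, h5] <;> nlinarith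

/-- The growth series of the orthogonal facets. -/
theorem CoxeterFamily.num_mul_tetra {t : FacetType} {e : Fin 4 → V}
    (h : CoxeterFamily B (tetraLabel t) e) :
    numS * growthInv B (Set.range e) = tetraPoly t := by
  -- Without a longest element the alternating sum over all subsets vanishes, and it expresses 1/W
  -- by the proper parabolic subgroups, all of them finite: the triples are A₁³, A₃ or H₃.
  have hsum := h.sum_parInv_eq_zero (R := Finset.univ) (by simpa using h.longest_tetra)
  rw [sum_powerset_univ_four, parInv_empty, show ({0, 1, 2, 3} : Finset (Fin 4)) = Finset.univ by decide,
    show parInv B e Finset.univ = growthInv B (Set.range e) by simp [parInv]] at hsum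
  have hN : numS = (1 + X) * (1 + X + X ^ 2 + X ^ 3) * (1 + X + X ^ 2 + X ^ 3 + X ^ 4 + X ^ 5) *
    (1 + X + X ^ 2 + X ^ 3 + X ^ 4 + X ^ 5 + X ^ 6 + X ^ 7 + X ^ 8 + X ^ 9) := rfl
  cases t
  · rw [tetraPoly]
    have t10 := h.num_mul_H3 (i := 0) (j := 1) (k := 2)
        (by decide) (by decide) (by decide) rfl rfl rfl
    have t11 := h.num_mul_H3 (i := 1) (j := 0) (k := 3)
        (by decide) (by decide) (by decide) rfl rfl rfl
    rw [show ({1, 0, 3} : Finset (Fin 4)) = {0, 1, 3} by decide] at t11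
    have t12 := h.num_mul_A3 (i := 0) (j := 3) (k := 2)
        (by decide) (by decide) (by decide) rfl rfl rfl
    rw [show ({0, 3, 2} : Finset (Fin 4)) = {0, 2, 3} by decide] at t12
    have t13 := h.num_mul_A3 (i := 1) (j := 2) (k := 3)
        (by decide) (by decide) (by decide) rfl rfl rfl
    linear_combination numS * hsum - hN + (h.num_mul_one 0)
      + (h.num_mul_one 1)
      + (h.num_mul_one 2)
      + (h.num_mul_one 3)
      - (h.num_mul_five (i := 0) (j := 1) (by decide) rfl)
      - (h.num_mul_two (i := 0) (j := 2) (by decide) rfl)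
      - (h.num_mul_three (i := 0) (j := 3) (by decide) rfl)
      - (h.num_mul_three (i := 1) (j := 2) (by decide) rfl)
      - (h.num_mul_two (i := 1) (j := 3) (by decide) rfl)
      - (h.num_mul_three (i := 2) (j := 3) (by decide) rfl)
      + t10
      + t11
      + t12
      + t13
  · rw [tetraPoly]
    have t10 := h.num_mul_A1_A1_A1 (i := 0) (j := 1) (k := 2) (by decide) rfl rfl rfl
    have t11 := h.num_mul_H3 (i := 0) (j := 3) (k := 1)
        (by decide) (by decide) (by decide) rfl rfl rfl
    rw [show ({0, 3, 1} : Finset (Fin 4)) = {0, 1, 3} by decide] at t11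
    have t12 := h.num_mul_H3 (i := 0) (j := 3) (k := 2)
        (by decide) (by decide) (by decide) rfl rfl rfl
    rw [show ({0, 3, 2} : Finset (Fin 4)) = {0, 2, 3} by decide] at t12
    have t13 := h.num_mul_A3 (i := 1) (j := 3) (k := 2)
        (by decide) (by decide) (by decide) rfl rfl rfl
    rw [show ({1, 3, 2} : Finset (Fin 4)) = {1, 2, 3} by decide] at t13
    linear_combination numS * hsum - hN + (h.num_mul_one 0)
      + (h.num_mul_one 1)
      + (h.num_mul_one 2)
      + (h.num_mul_one 3)
      - (h.num_mul_two (i := 0) (j := 1) (by decide) rfl)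
      - (h.num_mul_two (i := 0) (j := 2) (by decide) rfl)
      - (h.num_mul_five (i := 0) (j := 3) (by decide) rfl)
      - (h.num_mul_two (i := 1) (j := 2) (by decide) rfl)
      - (h.num_mul_three (i := 1) (j := 3) (by decide) rfl)
      - (h.num_mul_three (i := 2) (j := 3) (by decide) rfl)
      + t10
      + t11
      + t12
      + t13
  · rw [tetraPoly]
    have t10 := h.num_mul_H3 (i := 0) (j := 1) (k := 2)
        (by decide) (by decide) (by decide) rfl rfl rfl
    have t11 := h.num_mul_H3 (i := 1) (j := 0) (k := 3)
        (by decide) (by decide) (by decide) rfl rfl rfl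
    rw [show ({1, 0, 3} : Finset (Fin 4)) = {0, 1, 3} by decide] at t11
    have t12 := h.num_mul_H3 (i := 2) (j := 3) (k := 0)
        (by decide) (by decide) (by decide) rfl rfl rfl
    rw [show ({2, 3, 0} : Finset (Fin 4)) = {0, 2, 3} by decide] at t12
    have t13 := h.num_mul_H3 (i := 3) (j := 2) (k := 1)
        (by decide) (by decide) (by decide) rfl rfl rfl
    rw [show ({3, 2, 1} : Finset (Fin 4)) = {1, 2, 3} by decide] at t13
    linear_combination numS * hsum - hN + (h.num_mul_one 0)
      + (h.num_mul_one 1)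
      + (h.num_mul_one 2)
      + (h.num_mul_one 3)
      - (h.num_mul_five (i := 0) (j := 1) (by decide) rfl)
      - (h.num_mul_two (i := 0) (j := 2) (by decide) rfl)
      - (h.num_mul_three (i := 0) (j := 3) (by decide) rfl)
      - (h.num_mul_three (i := 1) (j := 2) (by decide) rfl)
      - (h.num_mul_two (i := 1) (j := 3) (by decide) rfl)
      - (h.num_mul_five (i := 2) (j := 3) (by decide) rfl)
      + t10
      + t11
      + t12
      + t13

/-- The growth series of the extended simplex. -/
theorem CoxeterFamily.num_mul_simplex {e : Fin 5 → V} (h : CoxeterFamily B label e) :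
    numS * growthInv B (Set.range e) = 1 - X - 2 * X ^ 2 - 3 * X ^ 3 - 3 * X ^ 4 - 3 * X ^ 5 -
      X ^ 6 + X ^ 7 + 4 * X ^ 8 + 4 * X ^ 9 + 5 * X ^ 10 + 7 * X ^ 11 + 8 * X ^ 12 + 9 * X ^ 13 +
      7 * X ^ 14 + 3 * X ^ 15 + X ^ 16 - X ^ 17 - 4 * X ^ 18 := by
  -- The five subsets of size four are the groups of the orthogonal facets. Being infinite, they
  -- enter with the series already found, and they deprive the simplex group of a longest element
  -- too.
  have quad : ∀ (t : FacetType) (σ : Fin 4 → Fin 5) (T : Finset (Fin 5)),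
      Finset.univ.image σ = T → Function.Injective σ →
      (∀ i j, label (σ i) (σ j) = tetraLabel t i j) →
      longest B (e '' (T : Set (Fin 5))) = ∅ ∧ numS * parInv B e T = tetraPoly t := by
    rintro t σ T rfl hσ hl
    have h' : CoxeterFamily B (tetraLabel t) (e ∘ σ) := by
      have := h.comp hσ
      rwa [show (fun i j => label (σ i) (σ j)) = tetraLabel t from
        funext fun i => funext fun j => hl i j] at this
    have hr : Set.range (e ∘ σ) = e '' ((Finset.univ.image σ : Finset (Fin 5)) : Set (Fin 5)) := by
      rw [Set.range_comp, Finset.coe_image, Finset.coe_univ, Set.image_univ]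
    rw [parInv, ← hr]
    exact ⟨h'.longest_tetra, h'.num_mul_tetra⟩
  have q0 := quad .A ![2, 3, 4, 1] {1, 2, 3, 4} (by decide) (by decide)
    fun i j => by fin_cases i <;> fin_cases j <;> rfl
  have q1 := quad .B ![2, 0, 4, 3] {0, 2, 3, 4} (by decide) (by decide)
    fun i j => by fin_cases i <;> fin_cases j <;> rfl
  have q2 := quad .A ![0, 1, 4, 3] {0, 1, 3, 4} (by decide) (by decide)
    fun i j => by fin_cases i <;> fin_cases j <;> rfl
  have q3 := quad .B ![0, 2, 4, 1] {0, 1, 2, 4} (by decide) (by decide)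
    fun i j => by fin_cases i <;> fin_cases j <;> rfl
  have q4 := quad .C ![0, 1, 2, 3] {0, 1, 2, 3} (by decide) (by decide)
    fun i j => by fin_cases i <;> fin_cases j <;> rfl
  have hsum := h.sum_parInv_eq_zero (R := Finset.univ) (by
    refine (h.isRootBasis_image _).longest_eq_empty_of_subset (Set.image_mono ?_) q4.1
    exact Finset.coe_subset.2 (Finset.subset_univ _))
  rw [sum_powerset_univ_five, parInv_empty, show ({0, 1, 2, 3, 4} : Finset (Fin 5)) = Finset.univ by decide,
    show parInv B e Finset.univ = growthInv B (Set.range e) by simp [parInv]] at hsum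
  have hN : numS = (1 + X) * (1 + X + X ^ 2 + X ^ 3) * (1 + X + X ^ 2 + X ^ 3 + X ^ 4 + X ^ 5) *
    (1 + X + X ^ 2 + X ^ 3 + X ^ 4 + X ^ 5 + X ^ 6 + X ^ 7 + X ^ 8 + X ^ 9) := rfl
  simp only [tetraPoly] at q0 q1 q2 q3 q4
  have t15 := h.num_mul_H3 (i := 0) (j := 1) (k := 2)
      (by decide) (by decide) (by decide) rfl rfl rfl
  have t16 := h.num_mul_H3 (i := 1) (j := 0) (k := 3)
      (by decide) (by decide) (by decide) rfl rfl rfl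
  rw [show ({1, 0, 3} : Finset (Fin 5)) = {0, 1, 3} by decide] at t16
  have t17 := h.num_mul_H3 (i := 0) (j := 1) (k := 4)
      (by decide) (by decide) (by decide) rfl rfl rfl
  have t18 := h.num_mul_H3 (i := 2) (j := 3) (k := 0)
      (by decide) (by decide) (by decide) rfl rfl rfl
  rw [show ({2, 3, 0} : Finset (Fin 5)) = {0, 2, 3} by decide] at t18
  have t19 := h.num_mul_A1_A1_A1 (i := 0) (j := 2) (k := 4) (by decide) rfl rfl rfl
  have t20 := h.num_mul_A3 (i := 0) (j := 3) (k := 4)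
      (by decide) (by decide) (by decide) rfl rfl rfl
  have t21 := h.num_mul_H3 (i := 3) (j := 2) (k := 1)
      (by decide) (by decide) (by decide) rfl rfl rfl
  rw [show ({3, 2, 1} : Finset (Fin 5)) = {1, 2, 3} by decide] at t21
  have t22 := h.num_mul_A3 (i := 2) (j := 1) (k := 4)
      (by decide) (by decide) (by decide) rfl rfl rfl
  rw [show ({2, 1, 4} : Finset (Fin 5)) = {1, 2, 4} by decide] at t22
  have t23 := h.num_mul_A3 (i := 1) (j := 4) (k := 3)
      (by decide) (by decide) (by decide) rfl rfl rfl
  rw [show ({1, 4, 3} : Finset (Fin 5)) = {1, 3, 4} by decide] at t23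
  have t24 := h.num_mul_H3 (i := 2) (j := 3) (k := 4)
      (by decide) (by decide) (by decide) rfl rfl rfl
  linear_combination -numS * hsum + hN - (h.num_mul_one 0)
    - (h.num_mul_one 1)
    - (h.num_mul_one 2)
    - (h.num_mul_one 3)
    - (h.num_mul_one 4)
    + (h.num_mul_five (i := 0) (j := 1) (by decide) rfl)
    + (h.num_mul_two (i := 0) (j := 2) (by decide) rfl)
    + (h.num_mul_three (i := 0) (j := 3) (by decide) rfl)
    + (h.num_mul_two (i := 0) (j := 4) (by decide) rfl)
    + (h.num_mul_three (i := 1) (j := 2) (by decide) rfl)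
    + (h.num_mul_two (i := 1) (j := 3) (by decide) rfl)
    + (h.num_mul_three (i := 1) (j := 4) (by decide) rfl)
    + (h.num_mul_five (i := 2) (j := 3) (by decide) rfl)
    + (h.num_mul_two (i := 2) (j := 4) (by decide) rfl)
    + (h.num_mul_three (i := 3) (j := 4) (by decide) rfl)
    - t15
    - t16
    - t17
    - t18
    - t19
    - t20
    - t21
    - t22
    - t23
    - t24 + q0.2 + q1.2 + q2.2 + q3.2 + q4.2

end

end CoxeterDomino

end

noncomputable section

namespace CoxeterDomino

/-! ## Lorentzian geometry -/

section Lorentz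

/-- The Lorentzian inner product as a bilinear form. -/
def lorForm : LinearMap.BilinForm ℝ LSpace :=
  LinearMap.mk₂ ℝ lor
    (fun x y z => by simp only [lor, Pi.add_apply, add_mul, Finset.sum_add_distrib]; ring)
    (fun c x y => by
      simp only [lor, Pi.smul_apply, smul_eq_mul, mul_assoc, ← Finset.mul_sum]; ring)
    (fun x y z => by simp only [lor, Pi.add_apply, mul_add, Finset.sum_add_distrib]; ring)
    (fun c x y => by
      simp only [lor, Pi.smul_apply, smul_eq_mul, mul_left_comm _ c, ← Finset.mul_sum]; ring)

@[simp]
theorem lorForm_apply (x y : LSpace) : lorForm x y = lor x y := rfl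

theorem lor_comm (x y : LSpace) : lor x y = lor y x := by simp only [lor, mul_comm]

theorem lor_add_left (x y z : LSpace) : lor (x + y) z = lor x z + lor y z := by
  simp [← lorForm_apply]

theorem lor_add_right (x y z : LSpace) : lor x (y + z) = lor x y + lor x z := by
  simp [← lorForm_apply]

theorem lor_sub_left (x y z : LSpace) : lor (x - y) z = lor x z - lor y z := by
  simp [← lorForm_apply]

theorem lor_sub_right (x y z : LSpace) : lor x (y - z) = lor x y - lor x z := by
  simp [← lorForm_apply]

theorem lor_smul_left (c : ℝ) (x y : LSpace) : lor (c • x) y = c * lor x y := by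
  simp [← lorForm_apply]

theorem lor_smul_right (c : ℝ) (x y : LSpace) : lor x (c • y) = c * lor x y := by
  simp [← lorForm_apply]

theorem lor_neg_left (x y : LSpace) : lor (-x) y = -lor x y := by
  simp [← lorForm_apply]

theorem lor_neg_right (x y : LSpace) : lor x (-y) = -lor x y := by
  simp [← lorForm_apply]

@[simp]
theorem lor_zero_left (y : LSpace) : lor 0 y = 0 := by
  simp [← lorForm_apply]

@[simp]
theorem lor_zero_right (y : LSpace) : lor y 0 = 0 := by
  simp [← lorForm_apply]

theorem lor_sum_left {ι : Type*} (s : Finset ι) (x : ι → LSpace) (y : LSpace) :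
    lor (∑ i ∈ s, x i) y = ∑ i ∈ s, lor (x i) y := by
  simp [← lorForm_apply]

theorem lor_sum_right {ι : Type*} (s : Finset ι) (x : ι → LSpace) (y : LSpace) :
    lor y (∑ i ∈ s, x i) = ∑ i ∈ s, lor y (x i) := by
  simp [← lorForm_apply]

theorem eq_zero_of_forall_lor_eq_zero {x : LSpace} (h : ∀ y, lor y x = 0) : x = 0 := by
  -- The test vector is x with its last coordinate negated, which makes the product the Euclidean
  -- square norm.
  have h₁ := h (Fin.snoc (fun i : Fin 4 => x i.castSucc) (-x (Fin.last 4)))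
  simp only [lor, Fin.snoc_castSucc, Fin.snoc_last, neg_mul, sub_neg_eq_add] at h₁
  have h₂ : 0 ≤ ∑ i : Fin 4, x i.castSucc * x i.castSucc :=
    Finset.sum_nonneg fun i _ => mul_self_nonneg _
  have h₃ := mul_self_nonneg (x (Fin.last 4))
  have h₄ := (Finset.sum_eq_zero_iff_of_nonneg fun i _ => mul_self_nonneg _).1
    (show ∑ i : Fin 4, x i.castSucc * x i.castSucc = 0 by linarith)
  ext i
  refine Fin.lastCases ?_ (fun j => ?_) i
  · exact mul_self_eq_zero.1 (by linarith)
  · exact mul_self_eq_zero.1 (h₄ j (Finset.mem_univ j))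

theorem lor_nonpos_of_causal {x y : LSpace} (hx : lor x x ≤ 0) (hy : lor y y ≤ 0)
    (hx0 : 0 ≤ x (Fin.last 4)) (hy0 : 0 ≤ y (Fin.last 4)) : lor x y ≤ 0 := by
  have cs := Finset.sum_mul_sq_le_sq_mul_sq Finset.univ (fun i : Fin 4 => x i.castSucc)
    (fun i : Fin 4 => y i.castSucc)
  simp only [lor, ← pow_two] at hx hy ⊢
  have h₁ : (∑ i : Fin 4, x i.castSucc * y i.castSucc) ^ 2 ≤
      (x (Fin.last 4) * y (Fin.last 4)) ^ 2 := by
    refine cs.trans ?_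
    rw [mul_pow]
    exact mul_le_mul (by linarith) (by linarith) (Finset.sum_nonneg fun i _ => sq_nonneg _)
      (sq_nonneg _)
  linarith [abs_le_of_sq_le_sq' h₁ (mul_nonneg hx0 hy0)]

/-- The spatial part of q is strictly shorter than its last coordinate, so Cauchy–Schwarz is strict:
a causal y with negative last coordinate has positive product with q. -/
theorem nonneg_last_of_lor_nonpos {q y : LSpace} (hq : q ∈ hyp4) (hy : lor y y ≤ 0)
    (hqy : lor q y ≤ 0) : 0 ≤ y (Fin.last 4) := by
  by_contra! hlt
  have cs := Finset.sum_mul_sq_le_sq_mul_sq Finset.univ (fun i : Fin 4 => q i.castSucc)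
    (fun i : Fin 4 => y i.castSucc)
  obtain ⟨hq1, hq0⟩ := hq
  simp only [lor, ← pow_two] at hq1 hy hqy cs
  have h₁ : (∑ i : Fin 4, q i.castSucc * y i.castSucc) ^ 2 <
      (q (Fin.last 4) * -y (Fin.last 4)) ^ 2 := by
    refine cs.trans_lt ?_
    rw [mul_pow, neg_sq]
    have hq2 : ∑ i : Fin 4, q i.castSucc ^ 2 = q (Fin.last 4) ^ 2 - 1 := by linarith
    have hy2 : 0 < y (Fin.last 4) ^ 2 := sq_pos_of_neg hlt
    have : 0 ≤ ∑ i : Fin 4, q i.castSucc ^ 2 := Finset.sum_nonneg fun i _ => sq_nonneg _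
    calc (∑ i : Fin 4, q i.castSucc ^ 2) * ∑ i : Fin 4, y i.castSucc ^ 2
        ≤ (∑ i : Fin 4, q i.castSucc ^ 2) * y (Fin.last 4) ^ 2 :=
          mul_le_mul_of_nonneg_left (by linarith) this
      _ < _ := by rw [hq2]; linarith
  have := (abs_lt_of_sq_lt_sq' h₁ (by nlinarith)).1
  linarith

/-- The future-pointing time-like vectors. -/
def IsFuture (x : LSpace) : Prop := lor x x < 0 ∧ 0 < x (Fin.last 4)

theorem isFuture_of_mem_hyp4 {x : LSpace} (hx : x ∈ hyp4) : IsFuture x :=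
  ⟨by rw [hx.1]; norm_num, hx.2⟩

theorem IsFuture.exists_smul_mem_hyp4 {x : LSpace} (hx : IsFuture x) :
    ∃ c : ℝ, 0 < c ∧ c • x ∈ hyp4 := by
  have h : 0 < √(-lor x x) := Real.sqrt_pos.2 (neg_pos.2 hx.1)
  refine ⟨(√(-lor x x))⁻¹, inv_pos.2 h, ?_, mul_pos (inv_pos.2 h) hx.2⟩
  rw [lor_smul_left, lor_smul_right, ← mul_assoc, ← mul_inv,
    Real.mul_self_sqrt (neg_pos.2 hx.1).le, inv_neg, neg_mul, inv_mul_cancel₀ hx.1.ne]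

theorem isFuture_of_lor_nonpos {q x : LSpace} (hq : q ∈ hyp4) (hx : lor x x < 0)
    (hqx : lor q x ≤ 0) : IsFuture x := by
  refine ⟨hx, (nonneg_last_of_lor_nonpos hq hx.le hqx).lt_of_ne' fun h0 => ?_⟩
  rw [lor, h0, mul_zero, sub_zero] at hx
  exact absurd hx (not_lt.2 (Finset.sum_nonneg fun i _ => mul_self_nonneg _))

theorem isFuture_sum {ι : Type*} {s : Finset ι} (hs : s.Nonempty) {p : ι → LSpace}
    (hp : ∀ i ∈ s, p i ∈ hyp4) : IsFuture (∑ i ∈ s, p i) := by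
  have hle : ∀ i ∈ s, ∀ j ∈ s, lor (p i) (p j) ≤ 0 := fun i hi j hj =>
    lor_nonpos_of_causal (isFuture_of_mem_hyp4 (hp i hi)).1.le
      (isFuture_of_mem_hyp4 (hp j hj)).1.le (hp i hi).2.le (hp j hj).2.le
  constructor
  · rw [lor_sum_left]
    refine Finset.sum_neg (fun i hi => ?_) hs
    rw [lor_sum_right]
    refine Finset.sum_neg' (fun j hj => hle i hi j hj) ⟨i, hi, ?_⟩
    rw [(hp i hi).1]
    norm_num
  · rw [Finset.sum_apply]
    exact Finset.sum_pos (fun i hi => (hp i hi).2) hs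

theorem exists_pos_perturbation {s : LSpace} (hs : IsFuture s) (y : LSpace) (C : Finset LSpace)
    (hC : ∀ c ∈ C, lor s c < 0) :
    ∃ ε : ℝ, 0 < ε ∧ IsFuture (s + ε • y) ∧ ∀ c ∈ C, lor (s + ε • y) c < 0 := by
  have h₁ : ∀ᶠ ε : ℝ in nhds 0, lor (s + ε • y) (s + ε • y) < 0 := by
    have hc : Continuous fun ε : ℝ => lor (s + ε • y) (s + ε • y) := by
      simp only [lor_add_left, lor_add_right, lor_smul_left, lor_smul_right]
      fun_prop
    exact hc.continuousAt.eventually_lt continuousAt_const (by simpa using hs.1)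
  have h₂ : ∀ᶠ ε : ℝ in nhds 0, 0 < (s + ε • y) (Fin.last 4) := by
    have hc : Continuous fun ε : ℝ => (s + ε • y) (Fin.last 4) := by
      simp only [Pi.add_apply, Pi.smul_apply, smul_eq_mul]
      fun_prop
    exact continuousAt_const.eventually_lt hc.continuousAt (by simpa using hs.2)
  have h₃ : ∀ᶠ ε : ℝ in nhds 0, ∀ c ∈ C, lor (s + ε • y) c < 0 := by
    rw [Filter.eventually_all_finset]
    intro c hc
    have hcont : Continuous fun ε : ℝ => lor (s + ε • y) c := by
      simp only [lor_add_left, lor_smul_left]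
      fun_prop
    exact hcont.continuousAt.eventually_lt continuousAt_const (by simpa using hC c hc)
  obtain ⟨ε, ⟨⟨h1, h2⟩, h3⟩, hε⟩ := ((((h₁.and h₂).and h₃).filter_mono nhdsWithin_le_nhds).and
    (self_mem_nhdsWithin (s := Set.Ioi (0 : ℝ)))).exists
  exact ⟨ε, hε, ⟨h1, h2⟩, h3⟩

end Lorentz

/-! ## Facet systems -/

/-- `C` is the system of outward unit normals of the facets of the polytope `F` in the hyperbolic
subspace orthogonal to `f`, where `f` is `0` or a unit vector. -/
structure IsFacetSystem (f : LSpace) (F : Set LSpace) (C : Finset LSpace) : Prop where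
  eq : F = {x | x ∈ hyp4 ∧ lor x f = 0 ∧ ∀ c ∈ C, lor x c ≤ 0}
  unit : ∀ c ∈ C, lor c c = 1
  orth : ∀ c ∈ C, lor c f = 0
  interior : ∃ x ∈ F, ∀ c ∈ C, lor x c < 0
  span : ∀ c ∈ C, ∀ y, lor y f = 0 → lor y c = 0 → y ∈ Submodule.span ℝ (F ∩ perp c)

namespace IsFacetSystem

variable {f : LSpace} {F : Set LSpace} {C C' : Finset LSpace}

theorem mem_iff (h : IsFacetSystem f F C) {x : LSpace} :
    x ∈ F ↔ x ∈ hyp4 ∧ lor x f = 0 ∧ ∀ c ∈ C, lor x c ≤ 0 := by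
  rw [h.eq]
  rfl

/-- If F ∩ e^L lies in some c^L with c in C, then e and c are proportional, and an interior point
fixes the sign. Otherwise F ∩ e^L has, for each c, a point off c^L; the sum of these points is
strictly inside all half spaces of C, and it can be moved in direction e within the cone over F,
where x ∘ e would become positive. -/
theorem mem_of_normal (h : IsFacetSystem f F C) (hC : C.Nonempty) (hf : f = 0 ∨ lor f f = 1)
    {e : LSpace} (he : lor e e = 1) (hef : lor e f = 0) (hle : ∀ x ∈ F, lor x e ≤ 0)
    (hspan : ∀ y, lor y f = 0 → lor y e = 0 → y ∈ Submodule.span ℝ (F ∩ perp e)) : e ∈ C := by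
  by_cases hcase : ∃ c ∈ C, ∀ x ∈ F ∩ perp e, lor x c = 0
  · obtain ⟨c, hc, hx⟩ := hcase
    have hy : ∀ y, lor y f = 0 → lor y e = 0 → lor y c = 0 := by
      intro y hyf hye
      have := hspan y hyf hye
      clear hyf hye
      induction this using Submodule.span_induction with
      | mem y hy => exact hx y hy
      | zero => simp
      | add y z _ _ hy hz => rw [lor_add_left, hy, hz, add_zero]
      | smul a y _ hy => rw [lor_smul_left, hy, mul_zero]
    have hz : c - lor c e • e = 0 := by
      refine eq_zero_of_forall_lor_eq_zero fun v => ?_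
      -- The component of v orthogonal to e and f; if f = 0, the last term disappears.
      have h₁ := hy (v - lor v e • e - lor v f • f) (by
          rw [lor_sub_left, lor_sub_left, lor_smul_left, lor_smul_left, hef]
          rcases hf with rfl | hf
          · simp
          · rw [hf]; ring) (by
          rw [lor_sub_left, lor_sub_left, lor_smul_left, lor_smul_left, he, lor_comm f, hef]
          ring)
      rw [lor_sub_left, lor_sub_left, lor_smul_left, lor_smul_left, lor_comm f, h.orth c hc] at h₁
      rw [lor_sub_right, lor_smul_right, lor_comm c]
      linarith
    have hce : c = lor c e • e := sub_eq_zero.1 hz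
    have hsq : lor c e * lor c e = 1 := by
      have := h.unit c hc
      rw [hce, lor_smul_left, lor_smul_right, he, mul_one] at this
      exact this
    obtain ⟨x, hxF, hxC⟩ := h.interior
    have h₁ := hxC c hc
    rw [hce, lor_smul_right] at h₁
    have h₂ := hle x hxF
    have h₃ : lor c e = 1 := by
      rcases mul_self_eq_one_iff.1 hsq with h' | h'
      · exact h'
      · rw [h'] at h₁
        linarith
    rw [h₃, one_smul] at hce
    exact hce ▸ hc
  · exfalso
    push Not at hcase
    choose! p hpF hp using hcase
    have hpm := fun c hc => h.mem_iff.1 (hpF c hc).1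
    have hfut := isFuture_sum hC fun c hc => (hpm c hc).1
    obtain ⟨ε, hε, hfut', hlt⟩ := exists_pos_perturbation hfut e C fun c hc => by
      rw [lor_sum_left]
      exact Finset.sum_neg' (fun d hd => (hpm d hd).2.2 c hc)
        ⟨c, hc, ((hpm c hc).2.2 c hc).lt_of_ne (hp c hc)⟩
    obtain ⟨r, hr, hmem⟩ := hfut'.exists_smul_mem_hyp4
    have h₁ := hle _ (h.mem_iff.2 ⟨hmem, ?_, fun c hc => ?_⟩)
    · rw [lor_smul_left, lor_add_left, lor_smul_left, he, lor_sum_left,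
        Finset.sum_eq_zero fun c hc => (hpF c hc).2] at h₁
      nlinarith [mul_pos hr hε]
    · rw [lor_smul_left, lor_add_left, lor_smul_left, hef, lor_sum_left,
        Finset.sum_eq_zero fun c hc => (hpm c hc).2.1]
      ring
    · rw [lor_smul_left]
      exact (mul_neg_of_pos_of_neg hr (hlt c hc)).le

theorem subset (h : IsFacetSystem f F C) (h' : IsFacetSystem f F C') (hC : C.Nonempty)
    (hf : f = 0 ∨ lor f f = 1) : C' ⊆ C := fun c hc =>
  h.mem_of_normal hC hf (h'.unit c hc) (h'.orth c hc) (fun _ hx => (h'.mem_iff.1 hx).2.2 c hc)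
    (h'.span c hc)

/-- In a gluing, the common facet is given only as a set; this identifies its normals in the two
polytopes. -/
theorem unique (h : IsFacetSystem f F C) (h' : IsFacetSystem f F C') (hC : C.Nonempty)
    (hC' : C'.Nonempty) (hf : f = 0 ∨ lor f f = 1) : C = C' :=
  (h'.subset h hC' hf).antisymm (h.subset h' hC hf)

theorem facetNormals_eq {P : Set LSpace} (h : IsFacetSystem 0 P C) (hC : C.Nonempty) :
    facetNormals P = C := by
  ext e
  constructor
  · rintro ⟨he, hle, hspan⟩
    exact h.mem_of_normal hC (Or.inl rfl) he (by simp) hle fun y _ hy => hspan y hy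
  · intro he
    exact ⟨h.unit e he, fun x hx => (h.mem_iff.1 hx).2.2 e he, fun y hy =>
      h.span e he y (by simp) hy⟩

/-- A criterion for the facet `F ∩ c^L` to have full dimension. -/
theorem mem_span_of_point (hF : F = {x | x ∈ hyp4 ∧ lor x f = 0 ∧ ∀ c ∈ C, lor x c ≤ 0})
    {c q : LSpace} (hq : IsFuture q) (hqf : lor q f = 0) (hqc : lor q c = 0)
    (hlt : ∀ d ∈ C, d ≠ c → lor q d < 0) {y : LSpace} (hyf : lor y f = 0) (hyc : lor y c = 0) :
    y ∈ Submodule.span ℝ (F ∩ perp c) := by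
  classical
  -- Vectors near q in the two hyperplanes are multiples of points of the facet. This applies to q
  -- and to q + εy, and y is a multiple of their difference.
  have key : ∀ x, IsFuture x → lor x f = 0 → lor x c = 0 → (∀ d ∈ C.erase c, lor x d < 0) →
      x ∈ Submodule.span ℝ (F ∩ perp c) := by
    intro x hx hxf hxc hxd
    obtain ⟨r, hr, hmem⟩ := hx.exists_smul_mem_hyp4
    rw [← inv_smul_smul₀ hr.ne' x]
    refine Submodule.smul_mem _ _ (Submodule.subset_span ⟨?_, ?_⟩)
    · rw [hF]
      refine ⟨hmem, by rw [lor_smul_left, hxf, mul_zero], fun d hd => ?_⟩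
      rw [lor_smul_left]
      by_cases hdc : d = c
      · rw [hdc, hxc, mul_zero]
      · exact (mul_neg_of_pos_of_neg hr (hxd d (Finset.mem_erase.2 ⟨hdc, hd⟩))).le
    · exact show lor _ _ = 0 by rw [lor_smul_left, hxc, mul_zero]
  have hlt' : ∀ d ∈ C.erase c, lor q d < 0 := fun d hd =>
    hlt d (Finset.mem_of_mem_erase hd) (Finset.ne_of_mem_erase hd)
  obtain ⟨ε, hε, hfut, hpert⟩ := exists_pos_perturbation hq y (C.erase c) hlt'
  have h₁ := key _ hfut (by rw [lor_add_left, lor_smul_left, hqf, hyf]; ring)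
    (by rw [lor_add_left, lor_smul_left, hqc, hyc]; ring) hpert
  have h₂ := sub_mem h₁ (key q hq hqf hqc hlt')
  rw [add_sub_cancel_left] at h₂
  rw [← inv_smul_smul₀ hε.ne' y]
  exact Submodule.smul_mem _ _ h₂

theorem neg (h : IsFacetSystem f F C) : IsFacetSystem (-f) F C where
  eq := by simp only [lor_neg_right, neg_eq_zero]; exact h.eq
  unit := h.unit
  orth c hc := by rw [lor_neg_right, h.orth c hc, neg_zero]
  interior := h.interior
  span c hc y hy := h.span c hc y (by rwa [lor_neg_right, neg_eq_zero] at hy)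

end IsFacetSystem

end CoxeterDomino

end

noncomputable section

namespace CoxeterDomino

open PowerSeries

/-! ## Gluing -/

theorem coe_denQ (l m n : ℤ) : (denQ l m n : PowerSeries ℤ) =
    X ^ 18 - (4 * C n + 6) * X ^ 17 + (2 * C n - C m + 3) * X ^ 16
    - (3 * C n - C m + C l + 5) * X ^ 15 + (5 * C n - 3 * C m + 5) * X ^ 14
    - (C n - 4 * C m + 1) * X ^ 13 + (8 * C n - 4 * C m + C l + 9) * X ^ 12
    + (5 * C m - C l) * X ^ 11 + (10 * C n - 5 * C m + C l + 11) * X ^ 10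
    - (2 * C n - 6 * C m + 2) * X ^ 9 + (10 * C n - 5 * C m + C l + 11) * X ^ 8
    + (5 * C m - C l) * X ^ 7 + (8 * C n - 4 * C m + C l + 9) * X ^ 6
    - (C n - 4 * C m + 1) * X ^ 5 + (5 * C n - 3 * C m + 5) * X ^ 4
    - (3 * C n - C m + C l + 5) * X ^ 3 + (2 * C n - C m + 3) * X ^ 2
    - (4 * C n + 6) * X + 1 := by
  have hX : Polynomial.coeToPowerSeries.ringHom (R := ℤ) Polynomial.X = X := Polynomial.coe_X
  have hC : ∀ k : ℤ, Polynomial.coeToPowerSeries.ringHom (Polynomial.C k) = C k :=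
    Polynomial.coe_C
  rw [← Polynomial.coeToPowerSeries.ringHom_apply]
  simp only [denQ, map_add, map_sub, map_mul, map_pow, map_one, map_ofNat, hX, hC]

/-- The data of a polytope glued from truncated simplices: `R` is the system of its facet
normals. -/
structure IsDominoSystem (l m n : ℕ) (P : Set LSpace) (O : FacetType → Set LSpace)
    (R : Finset LSpace) : Prop where
  facet : IsFacetSystem 0 P R
  nonempty : R.Nonempty
  pair : ∀ a ∈ R, ∀ b ∈ R, a ≠ b → CoxeterProduct (lor a b)
  mem : ∀ t, ∀ f ∈ O t, f ∈ R
  -- Product at most -1 means that the hyperplanes do not cross in hyperbolic space. Hence the facet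
  -- on f is cut out by the four orthogonal normals alone.
  orth : ∀ t, ∀ f ∈ O t, ∃ e : Fin 4 → LSpace, (∀ k, e k ∈ R) ∧
    (∀ i j, lor (e i) (e j) = -Real.cos (Real.pi / tetraLabel t i j)) ∧
    IsFacetSystem f (P ∩ perp f) (Finset.univ.image e) ∧
    ∀ a ∈ R, a ∉ Finset.univ.image e → a ≠ f → lor a f ≤ -1
  sep : ∀ t, ∀ f ∈ O t, ∀ t', ∀ g ∈ O t', f ≠ g → lor f g ≤ -1
  -- The factor 1 + t clears the denominators introduced by orthogonal roots; it is cancelled only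
  -- at the end.
  growth : (1 + X) * numS * growthInv lorForm (R : Set LSpace) =
    (1 + X) * (denQ l m n : PowerSeries ℤ)
  le : l + m ≤ n

/-- Minus the product with an interior point is a functional positive on all outward normals. -/
theorem IsFacetSystem.isRootBasis {P : Set LSpace} {R : Finset LSpace}
    (h : IsFacetSystem 0 P R) (hp : ∀ a ∈ R, ∀ b ∈ R, a ≠ b → CoxeterProduct (lor a b)) :
    IsRootBasis lorForm (R : Set LSpace) where
  symm := lor_comm
  unit a ha := h.unit a ha
  pair a ha b hb := hp a ha b hb
  pos := by
    obtain ⟨x, -, hx⟩ := h.interior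
    exact ⟨-lorForm x, fun a ha => neg_pos.2 (hx a ha)⟩

theorem tetraLabel_two_le (t : FacetType) (i j : Fin 4) (h : i ≠ j) : 2 ≤ tetraLabel t i j := by
  cases t <;> fin_cases i <;> fin_cases j <;> first | exact absurd rfl h | decide

/-- Q is affine in its parameters, so its excess over Q₁ + Q₂ depends on the type only; it is the
facet term of the gluing formula. -/
theorem one_add_X_mul_sub (t : FacetType) (l₁ m₁ n₁ l₂ m₂ n₂ : ℕ) :
    (1 + X) * ((denQ (l₁ + l₂ + if t = .A then 1 else 0 : ℕ) (m₁ + m₂ + if t = .B then 1 else 0 : ℕ)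
      (n₁ + n₂ + 1 : ℕ) : Polynomial ℤ) : PowerSeries ℤ) =
    (1 + X) * (denQ l₁ m₁ n₁ : PowerSeries ℤ) + (1 + X) * (denQ l₂ m₂ n₂ : PowerSeries ℤ)
      + (X - 1) * tetraPoly t := by
  simp only [coe_denQ]
  cases t <;> simp [tetraPoly] <;> ring

/-- The inverse growth series before and after the removal of an orthogonal facet. -/
theorem growthInv_erase {R E : Finset LSpace} {f : LSpace}
    (h : IsRootBasis lorForm (R : Set LSpace)) (hf : f ∈ R) (hE : E ⊆ R)
    (hEf : ∀ a ∈ E, lor a f = 0) (hR : ∀ a ∈ R, a ∉ E → a ≠ f → lor a f ≤ -1) :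
    (1 + X) * growthInv lorForm (R : Set LSpace) + X * growthInv lorForm (E : Set LSpace) =
      (1 + X) * growthInv lorForm ((R.erase f : Finset LSpace) : Set LSpace) := by
  have hfE : f ∉ E := fun hfE => by
    have h₁ : lor f f = 1 := h.unit f hf
    rw [hEf f hfE] at h₁
    exact zero_ne_one h₁
  have hun : R.erase f ∪ insert f E = R := by
    ext a
    simp only [Finset.mem_union, Finset.mem_erase, Finset.mem_insert]
    constructor
    · rintro (h | rfl | h)
      exacts [h.2, hf, hE h]
    · tauto
  have hin : R.erase f ∩ insert f E = E := by
    ext a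
    simp only [Finset.mem_inter, Finset.mem_erase, Finset.mem_insert]
    constructor
    · rintro ⟨h, h' | h'⟩
      exacts [absurd h' h.1, h']
    · exact fun ha => ⟨⟨fun h => hfE (h ▸ ha), hE ha⟩, Or.inr ha⟩
  -- The group of R is the amalgam of those of R \ {f} and E ∪ {f} over that of E, and f is
  -- orthogonal to E.
  have h₁ := IsRootBasis.growthInv_union_add_inter (R₁ := R.erase f) (R₂ := insert f E)
    (B := lorForm) (by rwa [hun]) (by
      intro a ha ha' b hb hb'
      have hbf : b = f := by
        by_contra hne
        exact hb' (Finset.mem_erase.2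
          ⟨hne, hE ((Finset.mem_insert.1 hb).resolve_left hne)⟩)
      rw [hbf]
      exact hR a (Finset.mem_of_mem_erase ha) (fun h => ha' (Finset.mem_insert_of_mem h))
        (Finset.ne_of_mem_erase ha))
  rw [hun, hin, Finset.coe_insert] at h₁
  have h₂ := IsRootBasis.growthInv_insert (B := lorForm) (R := (E : Set LSpace)) (f := f)
    (h.mono (by
      rw [← Finset.coe_insert]
      exact Finset.coe_subset.2 (Finset.insert_subset hf hE))) E.finite_toSet
    fun a ha => (lor_comm f a).trans (hEf a ha)
  linear_combination (1 + X) * h₁ + h₂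

/-! ### Separation by a common hyperplane, and the gluing step. -/

namespace IsDominoSystem

variable {l m n : ℕ} {P : Set LSpace} {O : FacetType → Set LSpace} {R : Finset LSpace}

/-- A vector `a` with `a ∘ f ≤ -1`, one of whose half spaces contains a point of `f^L`, has its
component orthogonal to `f` in the closed forward cone. -/
theorem _root_.CoxeterDomino.causal_component {a f q : LSpace} (ha : lor a a = 1)
    (hf : lor f f = 1) (haf : lor a f ≤ -1) (hq : q ∈ hyp4) (hqf : lor q f = 0)
    (hqa : lor q a ≤ 0) :
    lor (a - lor a f • f) (a - lor a f • f) ≤ 0 ∧ 0 ≤ (a - lor a f • f) (Fin.last 4) := by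
  have h₁ : lor (a - lor a f • f) (a - lor a f • f) ≤ 0 := by
    simp only [lor_sub_left, lor_sub_right, lor_smul_left, lor_smul_right, ha, hf, lor_comm f a]
    nlinarith
  refine ⟨h₁, nonneg_last_of_lor_nonpos hq h₁ ?_⟩
  rw [lor_sub_right, lor_smul_right, hqf]
  linarith

/-- Both x and the component of a orthogonal to f lie in the closed forward cone. In particular the
half space of a contains the whole side x ∘ f ≥ 0 of f^L. -/
theorem _root_.CoxeterDomino.lor_nonpos_of_separated {a f q x : LSpace} (ha : lor a a = 1)
    (hf : lor f f = 1) (haf : lor a f ≤ -1) (hq : q ∈ hyp4) (hqf : lor q f = 0)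
    (hqa : lor q a ≤ 0) (hx : x ∈ hyp4) : lor x a ≤ lor a f * lor x f := by
  obtain ⟨h₁, h₂⟩ := causal_component ha hf haf hq hqf hqa
  have hx' := isFuture_of_mem_hyp4 hx
  have := lor_nonpos_of_causal hx'.1.le h₁ hx'.2.le h₂
  rw [lor_sub_right, lor_smul_right] at this
  linarith

/-- The components of a and b orthogonal to f are both in the closed forward cone, so a ∘ b ≤ (a ∘
f)(b ∘ f), and the factors are at most -1 and at least 1. -/
theorem _root_.CoxeterDomino.lor_le_neg_one_of_separated {a b f q : LSpace} (ha : lor a a = 1)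
    (hb : lor b b = 1) (hf : lor f f = 1) (haf : lor a f ≤ -1) (hbf : lor b (-f) ≤ -1)
    (hq : q ∈ hyp4) (hqf : lor q f = 0) (hqa : lor q a ≤ 0) (hqb : lor q b ≤ 0) :
    lor a b ≤ -1 := by
  obtain ⟨h₁, h₂⟩ := causal_component ha hf haf hq hqf hqa
  obtain ⟨h₃, h₄⟩ := causal_component (f := -f) hb (by simpa [lor_neg_left, lor_neg_right] using hf)
    hbf hq (by rw [lor_neg_right, hqf, neg_zero]) hqb
  have := lor_nonpos_of_causal h₁ h₃ h₂ h₄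
  simp only [lor_sub_left, lor_sub_right, lor_smul_left, lor_smul_right, lor_neg_right, hf,
    lor_comm f b] at this hbf
  nlinarith

theorem glue {l₁ m₁ n₁ l₂ m₂ n₂ : ℕ} {P₁ P₂ : Set LSpace} {O₁ O₂ : FacetType → Set LSpace}
    {R₁ R₂ : Finset LSpace} (h₁ : IsDominoSystem l₁ m₁ n₁ P₁ O₁ R₁)
    (h₂ : IsDominoSystem l₂ m₂ n₂ P₂ O₂ R₂) {t : FacetType} {f : LSpace} (hf₁ : f ∈ O₁ t)
    (hf₂ : -f ∈ O₂ t) (hF : P₁ ∩ perp f = P₂ ∩ perp f) :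
    IsDominoSystem (l₁ + l₂ + if t = .A then 1 else 0) (m₁ + m₂ + if t = .B then 1 else 0)
      (n₁ + n₂ + 1) (P₁ ∪ P₂) (fun Y => (O₁ Y \ {f}) ∪ (O₂ Y \ {-f}))
      (R₁.erase f ∪ R₂.erase (-f)) := by
  obtain ⟨e₁, he₁R, he₁g, he₁F, he₁⟩ := h₁.orth t f hf₁
  obtain ⟨e₂, he₂R, -, he₂F, he₂⟩ := h₂.orth t (-f) hf₂
  have hfR := h₁.mem t f hf₁
  have hfR' := h₂.mem t (-f) hf₂
  have hff := h₁.facet.unit f hfR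
  have hperp : perp (-f) = perp f := by ext x; simp [perp, lor_neg_right]
  rw [hperp, ← hF] at he₂F
  -- Both sets are facet systems of the same tetrahedron in f^L; passing from -f to f changes
  -- nothing.
  have hEE : Finset.univ.image e₂ = Finset.univ.image e₁ :=
    he₁F.unique (by simpa using he₂F.neg) (Finset.univ_nonempty.image _)
      (Finset.univ_nonempty.image _) (Or.inr hff) |>.symm
  set E := Finset.univ.image e₁ with hE
  rw [hEE] at he₂
  have hER₁ : E ⊆ R₁ := by
    rw [hE, Finset.image_subset_iff]
    exact fun k _ => he₁R k
  have hER₂ : E ⊆ R₂ := by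
    rw [← hEE, Finset.image_subset_iff]
    exact fun k _ => he₂R k
  have hEf : ∀ a ∈ E, lor a f = 0 := he₁F.orth
  obtain ⟨q, ⟨hqP₁, hqf⟩, -⟩ := he₁F.interior
  have hqP₂ : q ∈ P₂ := (hF.subset ⟨hqP₁, hqf⟩).1
  have hqm₁ := h₁.facet.mem_iff.1 hqP₁
  have hqm₂ := h₂.facet.mem_iff.1 hqP₂
  have hff' : lor (-f) (-f) = 1 := by rw [lor_neg_left, lor_neg_right, neg_neg, hff]
  have hqf' : lor q (-f) = 0 := by rw [lor_neg_right, show lor q f = 0 from hqf, neg_zero]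
  -- the three possible positions of a facet normal
  have cases₁ : ∀ a ∈ R₁.erase f, a ∈ E ∨ lor a f ≤ -1 := fun a ha => by
    by_cases haE : a ∈ E
    · exact Or.inl haE
    · exact Or.inr (he₁ a (Finset.mem_of_mem_erase ha) haE (Finset.ne_of_mem_erase ha))
  have cases₂ : ∀ a ∈ R₂.erase (-f), a ∈ E ∨ lor a (-f) ≤ -1 := fun a ha => by
    by_cases haE : a ∈ E
    · exact Or.inl haE
    · exact Or.inr (he₂ a (Finset.mem_of_mem_erase ha) haE (Finset.ne_of_mem_erase ha))
  have hEe₁ : ∀ a ∈ E, a ∈ R₁.erase f := fun a ha => Finset.mem_erase.2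
    ⟨fun h => by have := hEf a ha; rw [h, hff] at this; exact one_ne_zero this, hER₁ ha⟩
  have hEe₂ : ∀ a ∈ E, a ∈ R₂.erase (-f) := fun a ha => Finset.mem_erase.2
    ⟨fun h => by
      have := hEf a ha
      rw [h, lor_neg_left, hff] at this
      norm_num at this, hER₂ ha⟩
  have hcross : ∀ a ∈ R₁.erase f, a ∉ E → ∀ b ∈ R₂.erase (-f), b ∉ E → lor a b ≤ -1 :=
    fun a ha haE b hb hbE => lor_le_neg_one_of_separated
      (h₁.facet.unit a (Finset.mem_of_mem_erase ha)) (h₂.facet.unit b (Finset.mem_of_mem_erase hb))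
      hff ((cases₁ a ha).resolve_left haE) ((cases₂ b hb).resolve_left hbE) hqm₁.1 hqf
      (hqm₁.2.2 a (Finset.mem_of_mem_erase ha)) (hqm₂.2.2 b (Finset.mem_of_mem_erase hb))
  -- On the far side of f^L the inequalities of P₁ outside E hold automatically, and those in E are
  -- shared. So each polytope satisfies the remaining inequalities of the other, and the union is
  -- convex.
  have hbound₁ : ∀ a ∈ R₁.erase f, ∀ x ∈ hyp4, lor x (-f) ≤ 0 → a ∉ E →
      lor x a ≤ lor x (-f) := fun a ha x hx hxf haE => by
    have haf := (cases₁ a ha).resolve_left haE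
    have := lor_nonpos_of_separated (h₁.facet.unit a (Finset.mem_of_mem_erase ha)) hff haf
      hqm₁.1 hqf (hqm₁.2.2 a (Finset.mem_of_mem_erase ha)) hx
    rw [lor_neg_right] at hxf ⊢
    nlinarith
  have hbound₂ : ∀ a ∈ R₂.erase (-f), ∀ x ∈ hyp4, lor x f ≤ 0 → a ∉ E →
      lor x a ≤ lor x f := fun a ha x hx hxf haE => by
    have haf := (cases₂ a ha).resolve_left haE
    have := lor_nonpos_of_separated (h₂.facet.unit a (Finset.mem_of_mem_erase ha)) hff' haf
      hqm₂.1 hqf' (hqm₂.2.2 a (Finset.mem_of_mem_erase ha)) hx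
    rw [lor_neg_right x] at this
    nlinarith
  have hsub₁ : ∀ x ∈ P₁, ∀ a ∈ R₂.erase (-f), lor x a ≤ 0 := fun x hx a ha => by
    have hxm := h₁.facet.mem_iff.1 hx
    by_cases haE : a ∈ E
    · exact hxm.2.2 a (hER₁ haE)
    · exact (hbound₂ a ha x hxm.1 (hxm.2.2 f hfR) haE).trans (hxm.2.2 f hfR)
  have hsub₂ : ∀ x ∈ P₂, ∀ a ∈ R₁.erase f, lor x a ≤ 0 := fun x hx a ha => by
    have hxm := h₂.facet.mem_iff.1 hx
    by_cases haE : a ∈ E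
    · exact hxm.2.2 a (hER₂ haE)
    · exact (hbound₁ a ha x hxm.1 (hxm.2.2 _ hfR') haE).trans (hxm.2.2 _ hfR')
  have hP : P₁ ∪ P₂ = {x | x ∈ hyp4 ∧ lor x 0 = 0 ∧
      ∀ c ∈ R₁.erase f ∪ R₂.erase (-f), lor x c ≤ 0} := by
    ext x
    constructor
    · rintro (hx | hx)
      · have hxm := h₁.facet.mem_iff.1 hx
        exact ⟨hxm.1, by simp, fun c hc => (Finset.mem_union.1 hc).elim
          (fun hc => hxm.2.2 c (Finset.mem_of_mem_erase hc)) (hsub₁ x hx c)⟩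
      · have hxm := h₂.facet.mem_iff.1 hx
        exact ⟨hxm.1, by simp, fun c hc => (Finset.mem_union.1 hc).elim (hsub₂ x hx c)
          (fun hc => hxm.2.2 c (Finset.mem_of_mem_erase hc))⟩
    · rintro ⟨hx, -, hc⟩
      rcases le_total (lor x f) 0 with hxf | hxf
      · refine Or.inl (h₁.facet.mem_iff.2 ⟨hx, by simp, fun c hcR => ?_⟩)
        by_cases hcf : c = f
        · rwa [hcf]
        · exact hc c (Finset.mem_union_left _ (Finset.mem_erase.2 ⟨hcf, hcR⟩))
      · refine Or.inr (h₂.facet.mem_iff.2 ⟨hx, by simp, fun c hcR => ?_⟩)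
        by_cases hcf : c = -f
        · rw [hcf, lor_neg_right]
          linarith
        · exact hc c (Finset.mem_union_right _ (Finset.mem_erase.2 ⟨hcf, hcR⟩))
  have hinter : R₁.erase f ∩ R₂.erase (-f) = E := by
    ext a
    rw [Finset.mem_inter]
    constructor
    · rintro ⟨ha₁, ha₂⟩
      by_contra haE
      have h₃ := (cases₁ a ha₁).resolve_left haE
      have h₄ := (cases₂ a ha₂).resolve_left haE
      rw [lor_neg_right] at h₄
      linarith
    · exact fun ha => ⟨hEe₁ a ha, hEe₂ a ha⟩
  have hpair : ∀ a ∈ R₁.erase f ∪ R₂.erase (-f), ∀ b ∈ R₁.erase f ∪ R₂.erase (-f), a ≠ b →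
      CoxeterProduct (lor a b) := by
    have hmix : ∀ a ∈ R₁.erase f, ∀ b ∈ R₂.erase (-f), a ≠ b → CoxeterProduct (lor a b) := by
      intro a ha b hb hab
      by_cases haE : a ∈ E
      · exact h₂.pair a (hER₂ haE) b (Finset.mem_of_mem_erase hb) hab
      · by_cases hbE : b ∈ E
        · exact h₁.pair a (Finset.mem_of_mem_erase ha) b (hER₁ hbE) hab
        · exact Or.inl (hcross a ha haE b hb hbE)
    intro a ha b hb hab
    rcases Finset.mem_union.1 ha with ha | ha <;> rcases Finset.mem_union.1 hb with hb | hb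
    · exact h₁.pair a (Finset.mem_of_mem_erase ha) b (Finset.mem_of_mem_erase hb) hab
    · exact hmix a ha b hb hab
    · rw [lor_comm]
      exact hmix b hb a ha hab.symm
    · exact h₂.pair a (Finset.mem_of_mem_erase ha) b (Finset.mem_of_mem_erase hb) hab
  have hfacet : IsFacetSystem 0 (P₁ ∪ P₂) (R₁.erase f ∪ R₂.erase (-f)) := by
    refine ⟨hP, fun c hc => ?_, fun c _ => by simp, ?_, fun c hc y hy0 hyc => ?_⟩
    · exact (Finset.mem_union.1 hc).elim (fun hc => h₁.facet.unit c (Finset.mem_of_mem_erase hc))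
        (fun hc => h₂.facet.unit c (Finset.mem_of_mem_erase hc))
    · obtain ⟨x, hxP, hx⟩ := h₁.facet.interior
      refine ⟨x, Or.inl hxP, fun c hc => ?_⟩
      rcases Finset.mem_union.1 hc with hc | hc
      · exact hx c (Finset.mem_of_mem_erase hc)
      · by_cases hcE : c ∈ E
        · exact hx c (hER₁ hcE)
        · exact (hbound₂ c hc x (h₁.facet.mem_iff.1 hxP).1 (hx f hfR).le hcE).trans_lt (hx f hfR)
    · rcases Finset.mem_union.1 hc with hc | hc
      · exact Submodule.span_mono (Set.inter_subset_inter_left _ Set.subset_union_left)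
          (h₁.facet.span c (Finset.mem_of_mem_erase hc) y hy0 hyc)
      · exact Submodule.span_mono (Set.inter_subset_inter_left _ Set.subset_union_right)
          (h₂.facet.span c (Finset.mem_of_mem_erase hc) y hy0 hyc)
  -- orthogonal facets are disjoint from the facet along which the polytopes are glued
  have hO₁ : ∀ Y, ∀ g ∈ O₁ Y, g ≠ f → g ∈ R₁.erase f ∧ g ∉ E := fun Y g hg hgf => by
    refine ⟨Finset.mem_erase.2 ⟨hgf, h₁.mem Y g hg⟩, fun hgE => ?_⟩
    have h₃ := h₁.sep Y g hg t f hf₁ hgf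
    rw [hEf g hgE] at h₃
    norm_num at h₃
  have hO₂ : ∀ Y, ∀ g ∈ O₂ Y, g ≠ -f → g ∈ R₂.erase (-f) ∧ g ∉ E := fun Y g hg hgf => by
    refine ⟨Finset.mem_erase.2 ⟨hgf, h₂.mem Y g hg⟩, fun hgE => ?_⟩
    have h₃ := h₂.sep Y g hg t _ hf₂ hgf
    rw [lor_neg_right, hEf g hgE] at h₃
    norm_num at h₃
  refine ⟨hfacet, ⟨e₁ 0, Finset.mem_union_left _ (hEe₁ _ (Finset.mem_image_of_mem _
    (Finset.mem_univ _)))⟩, hpair, ?_, ?_, ?_, ?_, ?_⟩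
  · rintro Y g (⟨hg, hgf⟩ | ⟨hg, hgf⟩)
    · exact Finset.mem_union_left _ (hO₁ Y g hg hgf).1
    · exact Finset.mem_union_right _ (hO₂ Y g hg hgf).1
  · rintro Y g (⟨hg, hgf⟩ | ⟨hg, hgf⟩)
    · obtain ⟨e, heR, heg, heF, he⟩ := h₁.orth Y g hg
      obtain ⟨hgR, hgE⟩ := hO₁ Y g hg hgf
      have heg0 : ∀ k, lor (e k) g = 0 := fun k =>
        heF.orth _ (Finset.mem_image_of_mem _ (Finset.mem_univ k))
      have heR' : ∀ k, e k ∈ R₁.erase f := fun k => Finset.mem_erase.2 ⟨fun hk => by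
        have h₃ := heg0 k
        have h₄ := h₁.sep Y g hg t f hf₁ hgf
        rw [hk, lor_comm] at h₃
        rw [h₃] at h₄
        norm_num at h₄, heR k⟩
      refine ⟨e, fun k => Finset.mem_union_left _ (heR' k), heg, ?_, ?_⟩
      · have hPg : (P₁ ∪ P₂) ∩ perp g = P₁ ∩ perp g := by
          refine Set.Subset.antisymm ?_ (Set.inter_subset_inter_left _ Set.subset_union_left)
          rintro x ⟨hx, hxg⟩
          have hxm := hfacet.mem_iff.1 hx
          refine heF.mem_iff.2 ⟨hxm.1, hxg, fun c hc => hxm.2.2 c ?_⟩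
          obtain ⟨k, -, rfl⟩ := Finset.mem_image.1 hc
          exact Finset.mem_union_left _ (heR' k)
        rwa [hPg]
      · intro a ha hae hag
        rcases Finset.mem_union.1 ha with ha | ha
        · exact he a (Finset.mem_of_mem_erase ha) hae hag
        · by_cases haE : a ∈ E
          · exact he a (hER₁ haE) hae hag
          · rw [lor_comm]
            exact hcross g hgR hgE a ha haE
    · obtain ⟨e, heR, heg, heF, he⟩ := h₂.orth Y g hg
      obtain ⟨hgR, hgE⟩ := hO₂ Y g hg hgf
      have heg0 : ∀ k, lor (e k) g = 0 := fun k =>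
        heF.orth _ (Finset.mem_image_of_mem _ (Finset.mem_univ k))
      have heR' : ∀ k, e k ∈ R₂.erase (-f) := fun k => Finset.mem_erase.2 ⟨fun hk => by
        have h₃ := heg0 k
        have h₄ := h₂.sep Y g hg t _ hf₂ hgf
        rw [hk, lor_comm] at h₃
        rw [h₃] at h₄
        norm_num at h₄, heR k⟩
      refine ⟨e, fun k => Finset.mem_union_right _ (heR' k), heg, ?_, ?_⟩
      · have hPg : (P₁ ∪ P₂) ∩ perp g = P₂ ∩ perp g := by
          refine Set.Subset.antisymm ?_ (Set.inter_subset_inter_left _ Set.subset_union_right)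
          rintro x ⟨hx, hxg⟩
          have hxm := hfacet.mem_iff.1 hx
          refine heF.mem_iff.2 ⟨hxm.1, hxg, fun c hc => hxm.2.2 c ?_⟩
          obtain ⟨k, -, rfl⟩ := Finset.mem_image.1 hc
          exact Finset.mem_union_right _ (heR' k)
        rwa [hPg]
      · intro a ha hae hag
        rcases Finset.mem_union.1 ha with ha | ha
        · by_cases haE : a ∈ E
          · exact he a (hER₂ haE) hae hag
          · exact hcross a ha haE g hgR hgE
        · exact he a (Finset.mem_of_mem_erase ha) hae hag
  · rintro Y g (⟨hg, hgf⟩ | ⟨hg, hgf⟩) Y' g' (⟨hg', hgf'⟩ | ⟨hg', hgf'⟩) hne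
    · exact h₁.sep Y g hg Y' g' hg' hne
    · exact hcross g (hO₁ Y g hg hgf).1 (hO₁ Y g hg hgf).2 g' (hO₂ Y' g' hg' hgf').1
        (hO₂ Y' g' hg' hgf').2
    · rw [lor_comm]
      exact hcross g' (hO₁ Y' g' hg' hgf').1 (hO₁ Y' g' hg' hgf').2 g (hO₂ Y g hg hgf).1
        (hO₂ Y g hg hgf).2
    · exact h₂.sep Y g hg Y' g' hg' hne
  · have hb₁ := h₁.facet.isRootBasis h₁.pair
    have hb₂ := h₂.facet.isRootBasis h₂.pair
    have g₁ := growthInv_erase hb₁ hfR hER₁ hEf he₁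
    have g₂ := growthInv_erase hb₂ hfR' hER₂
      (fun a ha => by rw [lor_neg_right, hEf a ha, neg_zero]) he₂
    have g := (hfacet.isRootBasis hpair).growthInv_union_add_inter fun a ha ha' b hb hb' =>
      hcross a ha (fun h => ha' (hEe₂ a h)) b hb (fun h => hb' (hEe₁ b h))
    rw [hinter] at g
    have hfam : CoxeterFamily lorForm (tetraLabel t) e₁ :=
      ⟨hb₁.mono (by rintro _ ⟨k, rfl⟩; exact he₁R k), he₁g, tetraLabel_two_le t⟩
    have gE := hfam.num_mul_tetra
    rw [show Set.range e₁ = (E : Set LSpace) by simp [hE]] at gE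
    -- Amalgamation over E gives 1/W = 1/W_{R₁ \ f} + 1/W_{R₂ \ -f} - 1/W_E, and restoring each
    -- deleted normal turns the factor of 1/W_E, after multiplication by 1 + t, into 2t - (1 + t) =
    -- t - 1.
    rw [one_add_X_mul_sub]
    linear_combination (1 + X) * numS * g - numS * g₁ - numS * g₂ + h₁.growth + h₂.growth
      + (X - 1) * gE
  · have := h₁.le
    have := h₂.le
    cases t <;> simp <;> omega

end IsDominoSystem

end CoxeterDomino

end

noncomputable section

namespace CoxeterDomino

/-! ## The totally truncated simplex -/

section Gram

theorem gram_eq : gram = !![1, -(1 + √5) / 4, 0, -1 / 2, 0;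
    -(1 + √5) / 4, 1, -1 / 2, 0, -1 / 2;
    0, -1 / 2, 1, -(1 + √5) / 4, 0;
    -1 / 2, 0, -(1 + √5) / 4, 1, -1 / 2;
    0, -1 / 2, 0, -1 / 2, 1] := by
  ext i j
  fin_cases i <;> fin_cases j <;>
  · simp [gram, label, Real.cos_pi_div_five]
    try ring

theorem det_gram : gram.det = (-15 - 9 * √5) / 32 := by
  have hs : √5 ^ 2 = 5 := Real.sq_sqrt (by norm_num)
  rw [gram_eq]
  simp [Matrix.det_succ_row_zero, Fin.sum_univ_succ, Fin.succAbove, Matrix.submatrix]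
  ring_nf
  linear_combination (√5 ^ 2 / 256 + √5 / 64 - 21 / 256) * hs

/-- The adjugate of the Gram matrix. -/
def gramAdj : Matrix (Fin 5) (Fin 5) ℝ :=
  !![(-1 - 5 * √5) / 32, (1 + √5) / 8, (11 + 7 * √5) / 32, (4 + √5) / 8, (5 + 2 * √5) / 16;
    (1 + √5) / 8, (1 - √5) / 8, (4 + √5) / 8, (2 + √5) / 4, (5 + √5) / 16;
    (11 + 7 * √5) / 32, (4 + √5) / 8, (-1 - 5 * √5) / 32, (1 + √5) / 8, (5 + 2 * √5) / 16;
    (4 + √5) / 8, (2 + √5) / 4, (1 + √5) / 8, (1 - √5) / 8, (5 + √5) / 16;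
    (5 + 2 * √5) / 16, (5 + √5) / 16, (5 + 2 * √5) / 16, (5 + √5) / 16, (-5 - 7 * √5) / 32]

theorem gram_mul_gramAdj : gram * gramAdj = ((-15 - 9 * √5) / 32) • (1 : Matrix _ _ ℝ) := by
  have hs : √5 ^ 2 = 5 := Real.sq_sqrt (by norm_num)
  rw [gram_eq, gramAdj]
  ext i j
  fin_cases i <;> fin_cases j <;>
  · simp [Matrix.mul_apply, Fin.sum_univ_five]
    linarith [hs]

theorem det_gram_neg : gram.det < 0 := by
  rw [det_gram]
  linarith [Real.sqrt_nonneg 5]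

theorem adjugate_gram : gram.adjugate = gramAdj := by
  have h : gram.adjugate * (gram * gramAdj) = gram.det • gramAdj := by
    rw [← Matrix.mul_assoc, Matrix.adjugate_mul, Matrix.smul_mul, Matrix.one_mul]
  rw [gram_mul_gramAdj, ← det_gram, Matrix.mul_smul, Matrix.mul_one] at h
  exact smul_right_injective _ det_gram_neg.ne h

theorem sqrt_five_bounds : 2.236 < √5 ∧ √5 < 2.2361 :=
  ⟨Real.lt_sqrt_of_sq_lt (by norm_num), (Real.sqrt_lt' (by norm_num)).2 (by norm_num)⟩

theorem gramAdj_symm (i j : Fin 5) : gramAdj i j = gramAdj j i := by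
  fin_cases i <;> fin_cases j <;> rfl

theorem gramAdj_pos {i j : Fin 5} (h : i ≠ j) : 0 < gramAdj i j := by
  obtain ⟨h₁, h₂⟩ := sqrt_five_bounds
  fin_cases i <;> fin_cases j <;> first
    | exact absurd rfl h
    | (simp [gramAdj]; linarith)

/-- Since eᵢ ∘ vᵢ = det / √(det · Aᵢᵢ) with A the adjugate and both numbers negative, this says that
eᵢ ∘ vᵢ ≤ -1. -/
theorem det_gram_le (i : Fin 5) : gram.det ≤ gramAdj i i := by
  obtain ⟨h₁, h₂⟩ := sqrt_five_bounds
  rw [det_gram]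
  fin_cases i <;> simp [gramAdj] <;> linarith

theorem gramAdj_neg (i : Fin 5) : gramAdj i i < 0 := by
  obtain ⟨h₁, h₂⟩ := sqrt_five_bounds
  fin_cases i <;> simp [gramAdj] <;> linarith

/-- With the positivity of the off-diagonal entries this gives vᵢ ∘ vⱼ = -Aᵢⱼ / √(Aᵢᵢ Aⱼⱼ) < -1. -/
theorem gramAdj_mul_lt_sq {i j : Fin 5} (h : i ≠ j) :
    gramAdj i i * gramAdj j j < gramAdj i j ^ 2 := by
  obtain ⟨h₁, h₂⟩ := sqrt_five_bounds
  have hs : √5 ^ 2 = 5 := Real.sq_sqrt (by norm_num)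
  fin_cases i <;> fin_cases j <;> first
    | exact absurd rfl h
    | (simp [gramAdj]; nlinarith)

theorem sum_gramAdj_pos (i k : Fin 5) : 0 < ∑ l, (if l = i then 0 else 1) * gramAdj l k := by
  obtain ⟨h₁, h₂⟩ := sqrt_five_bounds
  fin_cases i <;> fin_cases k <;>
  · simp [gramAdj, Fin.sum_univ_five]
    linarith

end Gram

end CoxeterDomino

end

noncomputable section

namespace CoxeterDomino

open PowerSeries

/-! ### The truncated simplex in the basis of the vectors wᵢ. -/

namespace IsSimplexFrame

variable {e : Fin 5 → LSpace}

theorem lor_dualVec (he : IsSimplexFrame e) (i j : Fin 5) :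
    lor (dualVec e i) (e j) = if i = j then gram.det else 0 := by
  have h := congrFun (congrFun (Matrix.adjugate_mul gram) i) j
  rw [Matrix.smul_apply, Matrix.one_apply, smul_eq_mul, mul_ite, mul_one, mul_zero] at h
  rw [← h, Matrix.mul_apply, dualVec, lor_sum_left]
  exact Finset.sum_congr rfl fun k _ => by rw [lor_smul_left, he.1]

theorem lor_dualVec_dualVec (he : IsSimplexFrame e) (i j : Fin 5) :
    lor (dualVec e i) (dualVec e j) = gram.det * gramAdj i j := by
  rw [show dualVec e j = ∑ k, gram.adjugate j k • e k from rfl, lor_sum_right,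
    Finset.sum_eq_single i]
  · rw [lor_smul_right, he.lor_dualVec, if_pos rfl, adjugate_gram, gramAdj_symm, mul_comm]
  · intro k _ hk
    rw [lor_smul_right, he.lor_dualVec, if_neg hk.symm, mul_zero]
  · simp

theorem eq_zero_of_lor_eq_zero (he : IsSimplexFrame e) {x : LSpace}
    (hx : ∀ k, lor (e k) x = 0) : x = 0 := by
  have hli : LinearIndependent ℝ e := by
    rw [Fintype.linearIndependent_iff]
    intro g hg
    have : Matrix.vecMul g gram = 0 := by
      ext j
      have := congrArg (lor · (e j)) hg
      simp only [lor_sum_left, lor_smul_left, he.1, lor_zero_left] at this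
      exact this
    exact congrFun (Matrix.eq_zero_of_vecMul_eq_zero det_gram_neg.ne this)
  have hspan := hli.span_eq_top_of_card_eq_finrank' (by simp)
  refine eq_zero_of_forall_lor_eq_zero fun y => ?_
  have hy : y ∈ Submodule.span ℝ (Set.range e) := hspan ▸ Submodule.mem_top
  induction hy using Submodule.span_induction with
  | mem y hy => obtain ⟨k, rfl⟩ := hy; exact hx k
  | zero => simp
  | add y z _ _ hy hz => rw [lor_add_left, hy, hz, add_zero]
  | smul a y _ hy => rw [lor_smul_left, hy, mul_zero]

/-- A linear combination of the vectors `wᵢ`. -/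
def _root_.CoxeterDomino.dualComb (e : Fin 5 → LSpace) (c : Fin 5 → ℝ) : LSpace :=
  ∑ l, c l • dualVec e l

theorem lor_dualComb (he : IsSimplexFrame e) (c : Fin 5 → ℝ) (j : Fin 5) :
    lor (dualComb e c) (e j) = c j * gram.det := by
  rw [dualComb, lor_sum_left, Finset.sum_eq_single j]
  · rw [lor_smul_left, he.lor_dualVec, if_pos rfl]
  · intro k _ hk
    rw [lor_smul_left, he.lor_dualVec, if_neg hk, mul_zero]
  · simp

theorem lor_dualComb_dualVec (he : IsSimplexFrame e) (c : Fin 5 → ℝ) (k : Fin 5) :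
    lor (dualComb e c) (dualVec e k) = gram.det * ∑ l, c l * gramAdj l k := by
  rw [dualComb, lor_sum_left, Finset.mul_sum]
  exact Finset.sum_congr rfl fun l _ => by rw [lor_smul_left, he.lor_dualVec_dualVec]; ring

theorem lor_dualComb_dualComb (he : IsSimplexFrame e) (c d : Fin 5 → ℝ) :
    lor (dualComb e c) (dualComb e d) = gram.det * ∑ k, d k * ∑ l, c l * gramAdj l k := by
  rw [show dualComb e d = ∑ k, d k • dualVec e k from rfl, lor_sum_right, Finset.mul_sum]
  exact Finset.sum_congr rfl fun l _ => by rw [lor_smul_right, he.lor_dualComb_dualVec]; ring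

/-- The square norm is det · ∑ cₖ (cA)ₖ < 0. The sheet is found by comparison with a point q of the
simplex, whose coefficients (q ∘ eₖ)/det are nonnegative; here nonemptiness fixes the sign of the
frame. -/
theorem isFuture_dualComb (he : IsSimplexFrame e) {c : Fin 5 → ℝ} (hc : ∀ l, 0 ≤ c l)
    (hd : ∀ k, 0 ≤ ∑ l, c l * gramAdj l k) (hpos : ∃ k, 0 < c k ∧ 0 < ∑ l, c l * gramAdj l k) :
    IsFuture (dualComb e c) := by
  obtain ⟨q, hq, hqe⟩ := he.2
  have hqc : q = dualComb e fun k => lor q (e k) / gram.det := by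
    rw [← sub_eq_zero]
    refine he.eq_zero_of_lor_eq_zero fun k => ?_
    rw [lor_comm, lor_sub_left, he.lor_dualComb, div_mul_cancel₀ _ det_gram_neg.ne, sub_self]
  refine isFuture_of_lor_nonpos hq ?_ ?_
  · rw [he.lor_dualComb_dualComb]
    refine mul_neg_of_neg_of_pos det_gram_neg ?_
    obtain ⟨k, hk, hk'⟩ := hpos
    exact Finset.sum_pos' (fun k _ => mul_nonneg (hc k) (hd k))
      ⟨k, Finset.mem_univ k, mul_pos hk hk'⟩
  · rw [hqc, lor_comm, he.lor_dualComb_dualComb]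
    refine mul_nonpos_of_nonpos_of_nonneg det_gram_neg.le
      (Finset.sum_nonneg fun k _ => mul_nonneg ?_ (hd k))
    exact div_nonneg_of_nonpos (hqe k) det_gram_neg.le

/-! ### The ultraideal vertices -/

theorem dualVec_sq_pos (he : IsSimplexFrame e) (i : Fin 5) :
    0 < lor (dualVec e i) (dualVec e i) := by
  rw [he.lor_dualVec_dualVec]
  exact mul_pos_of_neg_of_neg det_gram_neg (gramAdj_neg i)

theorem inv_sqrt_pos (he : IsSimplexFrame e) (i : Fin 5) :
    0 < (√(lor (dualVec e i) (dualVec e i)))⁻¹ :=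
  inv_pos.2 (Real.sqrt_pos.2 (he.dualVec_sq_pos i))

theorem lor_vertex_self (he : IsSimplexFrame e) (i : Fin 5) :
    lor (vertex e i) (vertex e i) = 1 := by
  have h := he.dualVec_sq_pos i
  rw [vertex, lor_smul_left, lor_smul_right, ← mul_assoc, ← mul_inv, Real.mul_self_sqrt h.le,
    inv_mul_cancel₀ h.ne']

theorem lor_vertex_of_ne (he : IsSimplexFrame e) {i j : Fin 5} (h : j ≠ i) :
    lor (e j) (vertex e i) = 0 := by
  rw [vertex, lor_smul_right, lor_comm (e j), he.lor_dualVec, if_neg h.symm, mul_zero]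

theorem lor_vertex_same (he : IsSimplexFrame e) (i : Fin 5) : lor (e i) (vertex e i) ≤ -1 := by
  have h := he.dualVec_sq_pos i
  rw [vertex, lor_smul_right, lor_comm (e i), he.lor_dualVec, if_pos rfl, inv_mul_eq_div,
    div_le_iff₀ (Real.sqrt_pos.2 h)]
  have : √(lor (dualVec e i) (dualVec e i)) ≤ -gram.det := by
    rw [Real.sqrt_le_left (by linarith [det_gram_neg]), he.lor_dualVec_dualVec]
    nlinarith [det_gram_neg, det_gram_le i]
  linarith

theorem lor_vertex_vertex (he : IsSimplexFrame e) {i j : Fin 5} (h : i ≠ j) :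
    lor (vertex e i) (vertex e j) ≤ -1 := by
  have hi := he.dualVec_sq_pos i
  have hj := he.dualVec_sq_pos j
  rw [vertex, vertex, lor_smul_left, lor_smul_right, ← mul_assoc, ← mul_inv, inv_mul_eq_div,
    div_le_iff₀ (mul_pos (Real.sqrt_pos.2 hi) (Real.sqrt_pos.2 hj)), ← Real.sqrt_mul hi.le]
  have hd := det_gram_neg
  have hA := gramAdj_pos h
  have : √(lor (dualVec e i) (dualVec e i) * lor (dualVec e j) (dualVec e j)) ≤
      -gram.det * gramAdj i j := by
    rw [Real.sqrt_le_left (mul_nonneg (by linarith) hA.le)]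
    simp only [he.lor_dualVec_dualVec]
    nlinarith [gramAdj_mul_lt_sq h, mul_pos_of_neg_of_neg hd hd]
  rw [he.lor_dualVec_dualVec]
  linarith

theorem lor_dualComb_neg (he : IsSimplexFrame e) {c : Fin 5 → ℝ} {j : Fin 5} (h : 0 < c j) :
    lor (dualComb e c) (e j) < 0 := by
  rw [he.lor_dualComb]
  exact mul_neg_of_pos_of_neg h det_gram_neg

theorem lor_dualComb_vertex (he : IsSimplexFrame e) (c : Fin 5 → ℝ) (k : Fin 5) :
    lor (dualComb e c) (vertex e k) = (√(lor (dualVec e k) (dualVec e k)))⁻¹ *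
      (gram.det * ∑ l, c l * gramAdj l k) := by
  rw [vertex, lor_smul_right, he.lor_dualComb_dualVec]

theorem lor_dualComb_vertex_neg (he : IsSimplexFrame e) {c : Fin 5 → ℝ} {k : Fin 5}
    (h : 0 < ∑ l, c l * gramAdj l k) : lor (dualComb e c) (vertex e k) < 0 := by
  rw [he.lor_dualComb_vertex]
  exact mul_neg_of_pos_of_neg (he.inv_sqrt_pos k) (mul_neg_of_neg_of_pos det_gram_neg h)

/-! ### Points of the facets -/

/-- A point in the relative interior of the facet on `e j`. -/
theorem exists_point_of_simplex_facet (he : IsSimplexFrame e) (j : Fin 5) :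
    ∃ q, IsFuture q ∧ lor q (e j) = 0 ∧ (∀ i, i ≠ j → lor q (e i) < 0) ∧
      ∀ k, lor q (vertex e k) < 0 := by
  have hc : ∀ i, i ≠ j → 0 < if i = j then (0 : ℝ) else 1 := fun i hi => by simp [hi]
  -- The sum of the wₗ with l ≠ j.
  refine ⟨dualComb e fun l => if l = j then 0 else 1, he.isFuture_dualComb ?_
    (fun k => (sum_gramAdj_pos j k).le) ?_, ?_, fun i hi => he.lor_dualComb_neg (hc i hi),
    fun k => he.lor_dualComb_vertex_neg (sum_gramAdj_pos j k)⟩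
  · intro l
    split_ifs <;> norm_num
  · obtain ⟨k, hk⟩ := exists_ne j
    exact ⟨k, hc k hk, sum_gramAdj_pos j k⟩
  · rw [he.lor_dualComb, if_pos rfl, zero_mul]

/-- Points of the orthogonal facet `i`; the case `J = ∅` yields an interior point of it, and
`J = {j}` an interior point of its facet on `e j`. -/
theorem exists_point_of_vertex_facet (he : IsSimplexFrame e) (i : Fin 5) (J : Finset (Fin 5))
    (hi : i ∉ J) (hJ : J.card ≤ 1) :
    ∃ q, IsFuture q ∧ lor q (vertex e i) = 0 ∧ (∀ j ∈ J, lor q (e j) = 0) ∧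
      (∀ j, j ∉ J → lor q (e j) < 0) ∧ ∀ k, k ≠ i → lor q (vertex e k) < 0 := by
  classical
  obtain ⟨u, hu⟩ : ∃ u, u ∉ insert i J := by
    by_contra! h
    have := Finset.card_le_card (fun x _ => h x : (Finset.univ : Finset (Fin 5)) ⊆ insert i J)
    have := Finset.card_insert_le i J
    simp at *
    omega
  rw [Finset.mem_insert, not_or] at hu
  -- The point is the sum of the wₗ with l outside J ∪ {i}, projected along wᵢ to vᵢ^L; r below is
  -- the coefficient of wᵢ that achieves this.
  set b : Fin 5 → ℝ := fun l => if l ∈ insert i J then 0 else 1 with hb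
  have hb0 : ∀ l, 0 ≤ b l := fun l => by
    simp only [hb]
    split_ifs <;> norm_num
  have hbi : b i = 0 := by simp [hb]
  have hbu : b u = 1 := by simp [hb, hu]
  set s := ∑ l, b l * gramAdj l i with hs
  have hs0 : 0 < s := by
    refine Finset.sum_pos' (fun l _ => ?_) ⟨u, Finset.mem_univ u, ?_⟩
    · by_cases hl : l = i
      · rw [hl, hbi, zero_mul]
      · exact mul_nonneg (hb0 l) (gramAdj_pos hl).le
    · rw [hbu, one_mul]
      exact gramAdj_pos hu.1
  have hAi := gramAdj_neg i
  set r := s / -gramAdj i i with hr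
  have hr0 : 0 < r := div_pos hs0 (neg_pos.2 hAi)
  have hrA : r * gramAdj i i = -s := by
    rw [hr, div_mul_eq_mul_div, mul_div_assoc, div_neg, div_self hAi.ne, mul_neg_one]
  set c : Fin 5 → ℝ := fun l => b l + if l = i then r else 0 with hc
  have hsum : ∀ k, ∑ l, c l * gramAdj l k = ∑ l, b l * gramAdj l k + r * gramAdj i k := by
    intro k
    simp only [hc, add_mul, Finset.sum_add_distrib, ite_mul, zero_mul, Finset.sum_ite_eq',
      Finset.mem_univ, if_true]
  have hD : ∑ l, c l * gramAdj l i = 0 := by rw [hsum, hrA, ← hs, add_neg_cancel]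
  have hDk : ∀ k, k ≠ i → 0 < ∑ l, c l * gramAdj l k := by
    intro k hk
    rw [hsum]
    have hik := gramAdj_pos hk.symm
    by_cases hbk : b k = 0
    · refine add_pos_of_nonneg_of_pos (Finset.sum_nonneg fun l _ => ?_) (mul_pos hr0 hik)
      by_cases hl : l = k
      · rw [hl, hbk, zero_mul]
      · exact mul_nonneg (hb0 l) (gramAdj_pos hl).le
    · have hbk1 : b k = 1 := by
        simp only [hb] at hbk ⊢
        split_ifs at hbk ⊢
        · exact absurd rfl hbk
        · rfl
      have h₁ : gramAdj k k ≤ ∑ l, b l * gramAdj l k := by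
        rw [← Finset.add_sum_erase _ _ (Finset.mem_univ k), hbk1, one_mul]
        refine le_add_of_nonneg_right (Finset.sum_nonneg fun l hl => ?_)
        exact mul_nonneg (hb0 l) (gramAdj_pos (Finset.ne_of_mem_erase hl)).le
      have h₂ : gramAdj i k ≤ s := by
        rw [hs, ← Finset.add_sum_erase _ _ (Finset.mem_univ k), hbk1, one_mul, gramAdj_symm i k]
        refine le_add_of_nonneg_right (Finset.sum_nonneg fun l _ => ?_)
        by_cases hl : l = i
        · rw [hl, hbi, zero_mul]
        · exact mul_nonneg (hb0 l) (gramAdj_pos hl).le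
      have h₃ : gramAdj i k / -gramAdj i i ≤ r := by
        rw [hr]
        exact div_le_div_of_nonneg_right h₂ (neg_pos.2 hAi).le
      -- The sum for k contains the negative term Aₖₖ. The added multiple of wᵢ outweighs it, as r
      -- Aᵢₖ ≥ Aᵢₖ² / (-Aᵢᵢ) > -Aₖₖ.
      have h₄ : -gramAdj k k < gramAdj i k / -gramAdj i i * gramAdj i k := by
        rw [div_mul_eq_mul_div, lt_div_iff₀ (neg_pos.2 hAi)]
        nlinarith [gramAdj_mul_lt_sq hk.symm]
      nlinarith [mul_le_mul_of_nonneg_right h₃ hik.le]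
  have hcj : ∀ j, j ∉ J → 0 < c j := by
    intro j hj
    by_cases hji : j = i
    · simp only [hc, hji, hbi, if_true, zero_add]
      exact hr0
    · simp [hc, hb, hji, hj]
  have hcJ : ∀ j ∈ J, c j = 0 := by
    intro j hj
    have : j ≠ i := fun h => hi (h ▸ hj)
    simp [hc, hb, hj, this]
  refine ⟨dualComb e c, he.isFuture_dualComb (fun l => ?_) (fun k => ?_)
    ⟨u, hcj u hu.2, hDk u hu.1⟩, ?_, fun j hj => ?_, fun j hj => he.lor_dualComb_neg (hcj j hj),
    fun k hk => he.lor_dualComb_vertex_neg (hDk k hk)⟩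
  · by_cases hl : l ∈ J
    · exact (hcJ l hl).ge
    · exact (hcj l hl).le
  · by_cases hk : k = i
    · rw [hk, hD]
    · exact (hDk k hk).le
  · rw [he.lor_dualComb_vertex, hD, mul_zero, mul_zero]
  · rw [he.lor_dualComb, hcJ j hj, zero_mul]

/-! ### The facets of the truncated simplex -/

/-- The facet normals of the truncated simplex. -/
def _root_.CoxeterDomino.baseNormals (e : Fin 5 → LSpace) : Finset LSpace :=
  Finset.univ.image e ∪ Finset.univ.image (vertex e)

theorem forall_baseNormals {p : LSpace → Prop} :
    (∀ c ∈ baseNormals e, p c) ↔ (∀ j, p (e j)) ∧ ∀ k, p (vertex e k) := by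
  simp [baseNormals, or_imp, forall_and]

theorem truncatedSimplex_eq :
    truncatedSimplex e = {x | x ∈ hyp4 ∧ lor x 0 = 0 ∧ ∀ c ∈ baseNormals e, lor x c ≤ 0} := by
  ext x
  have := forall_baseNormals (e := e) (p := fun c => lor x c ≤ 0)
  constructor
  · rintro ⟨⟨hx, h₁⟩, h₂⟩
    exact ⟨hx, by simp, this.2 ⟨h₁, h₂⟩⟩
  · rintro ⟨hx, -, h⟩
    exact ⟨⟨hx, (this.1 h).1⟩, (this.1 h).2⟩

theorem lor_self (he : IsSimplexFrame e) (j : Fin 5) : lor (e j) (e j) = 1 := by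
  rw [he.1, gram_eq]
  fin_cases j <;> rfl

theorem isFacetSystem (he : IsSimplexFrame e) :
    IsFacetSystem 0 (truncatedSimplex e) (baseNormals e) where
  eq := truncatedSimplex_eq
  unit := forall_baseNormals.2 ⟨he.lor_self, he.lor_vertex_self⟩
  orth _ _ := lor_zero_right _
  interior := by
    obtain ⟨q, hq, h0, h₁, h₂⟩ := he.exists_point_of_simplex_facet 0
    -- An interior point arises by pushing a point of the facet on e 0 inwards.
    obtain ⟨ε, hε, hfut, hlt⟩ := exists_pos_perturbation hq (-e 0)
      ((baseNormals e).filter fun c => lor q c < 0) fun c hc => (Finset.mem_filter.1 hc).2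
    obtain ⟨r, hr, hmem⟩ := hfut.exists_smul_mem_hyp4
    have hneg : ∀ c ∈ baseNormals e, lor (r • (q + ε • -e 0)) c < 0 := by
      intro c hc
      rw [lor_smul_left]
      refine mul_neg_of_pos_of_neg hr ?_
      by_cases hqc : lor q c < 0
      · exact hlt c (Finset.mem_filter.2 ⟨hc, hqc⟩)
      · have hc0 : c = e 0 := by
          revert hqc
          revert c
          refine forall_baseNormals.2 ⟨fun j hj => ?_, fun k hk => absurd (h₂ k) hk⟩
          by_cases hj0 : j = 0
          · rw [hj0]
          · exact absurd (h₁ j hj0) hj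
        rw [hc0, lor_add_left, lor_smul_left, lor_neg_left, h0, he.lor_self]
        linarith
    refine ⟨_, ?_, hneg⟩
    rw [truncatedSimplex_eq]
    exact ⟨hmem, lor_zero_right _, fun c hc => (hneg c hc).le⟩
  span := by
    refine forall_baseNormals.2 ⟨fun j y hy hyc => ?_, fun i y hy hyc => ?_⟩
    · obtain ⟨q, hq, h0, h₁, h₂⟩ := he.exists_point_of_simplex_facet j
      refine IsFacetSystem.mem_span_of_point truncatedSimplex_eq hq (lor_zero_right _) h0 ?_ hy hyc
      exact forall_baseNormals.2 ⟨fun i hi => h₁ i fun h => hi (h ▸ rfl), fun k _ => h₂ k⟩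
    · obtain ⟨q, hq, h0, -, h₁, h₂⟩ :=
        he.exists_point_of_vertex_facet i ∅ (Finset.notMem_empty i) (by simp)
      refine IsFacetSystem.mem_span_of_point truncatedSimplex_eq hq (lor_zero_right _) h0 ?_ hy hyc
      exact forall_baseNormals.2 ⟨fun j _ => h₁ j (Finset.notMem_empty j),
        fun k hk => h₂ k fun h => hk (h ▸ rfl)⟩

/-- An ordering of the simplex normals that are orthogonal to the vertex `i`. -/
def _root_.CoxeterDomino.tetraIndex : Fin 5 → Fin 4 → Fin 5 :=
  ![![2, 3, 4, 1], ![2, 0, 4, 3], ![0, 1, 4, 3], ![0, 2, 4, 1], ![0, 1, 2, 3]]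

theorem _root_.CoxeterDomino.label_tetraIndex (i : Fin 5) (a b : Fin 4) :
    label (tetraIndex i a) (tetraIndex i b) = tetraLabel (facetType i) a b := by
  fin_cases i <;> fin_cases a <;> fin_cases b <;> rfl

theorem _root_.CoxeterDomino.exists_tetraIndex_iff (i j : Fin 5) :
    (∃ a, tetraIndex i a = j) ↔ j ≠ i := by
  revert i j
  decide

theorem mem_image_tetraIndex {i : Fin 5} {c : LSpace} :
    c ∈ Finset.univ.image (e ∘ tetraIndex i) ↔ ∃ j, j ≠ i ∧ e j = c := by
  simp only [Finset.mem_image, Finset.mem_univ, true_and, Function.comp_apply]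
  constructor
  · rintro ⟨a, rfl⟩
    exact ⟨_, (exists_tetraIndex_iff i _).1 ⟨a, rfl⟩, rfl⟩
  · rintro ⟨j, hj, rfl⟩
    obtain ⟨a, rfl⟩ := (exists_tetraIndex_iff i j).2 hj
    exact ⟨a, rfl⟩

theorem lor_le_of_baseNormals (he : IsSimplexFrame e) (i : Fin 5) {a : LSpace}
    (ha : a ∈ baseNormals e) (hae : a ∉ Finset.univ.image (e ∘ tetraIndex i))
    (hav : a ≠ vertex e i) : lor a (vertex e i) ≤ -1 := by
  refine (forall_baseNormals (p := fun a => a ∉ Finset.univ.image (e ∘ tetraIndex i) →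
    a ≠ vertex e i → lor a (vertex e i) ≤ -1)).2 ⟨fun j hj _ => ?_, fun k _ hk => ?_⟩
    a ha hae hav
  · by_cases hji : j = i
    · rw [hji]
      exact he.lor_vertex_same i
    · exact absurd (mem_image_tetraIndex.2 ⟨j, hji, rfl⟩) hj
  · exact he.lor_vertex_vertex fun h => hk (h ▸ rfl)

/-- By separation, the half spaces of eᵢ and of the other vₖ contain all of vᵢ^L, so that only the
four eⱼ with j ≠ i bound this facet. -/
theorem isFacetSystem_vertex (he : IsSimplexFrame e) (i : Fin 5) :
    IsFacetSystem (vertex e i) (truncatedSimplex e ∩ perp (vertex e i))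
      (Finset.univ.image (e ∘ tetraIndex i)) := by
  obtain ⟨q, hq, h0, -, h₁, h₂⟩ :=
    he.exists_point_of_vertex_facet i ∅ (Finset.notMem_empty i) (by simp)
  obtain ⟨r, hr, hmem⟩ := hq.exists_smul_mem_hyp4
  have hq0 : lor (r • q) (vertex e i) = 0 := by rw [lor_smul_left, h0, mul_zero]
  have hqneg : ∀ c ∈ baseNormals e, lor (r • q) c ≤ 0 := by
    refine forall_baseNormals.2 ⟨fun j => ?_, fun k => ?_⟩
    · rw [lor_smul_left]
      exact (mul_neg_of_pos_of_neg hr (h₁ j (Finset.notMem_empty j))).le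
    · by_cases hk : k = i
      · rw [hk, hq0]
      · rw [lor_smul_left]
        exact (mul_neg_of_pos_of_neg hr (h₂ k hk)).le
  have heq : truncatedSimplex e ∩ perp (vertex e i) = {x | x ∈ hyp4 ∧ lor x (vertex e i) = 0 ∧
      ∀ c ∈ Finset.univ.image (e ∘ tetraIndex i), lor x c ≤ 0} := by
    ext x
    rw [truncatedSimplex_eq]
    constructor
    · rintro ⟨⟨hx, -, hc⟩, hxv⟩
      refine ⟨hx, hxv, fun c hc' => ?_⟩
      obtain ⟨j, -, rfl⟩ := mem_image_tetraIndex.1 hc'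
      exact (forall_baseNormals.1 hc).1 j
    · rintro ⟨hx, hxv, hc⟩
      refine ⟨⟨hx, lor_zero_right _, fun c hcb => ?_⟩, hxv⟩
      by_cases hce : c ∈ Finset.univ.image (e ∘ tetraIndex i)
      · exact hc c hce
      · by_cases hcv : c = vertex e i
        · rw [hcv, hxv]
        · have := lor_nonpos_of_separated (he.isFacetSystem.unit c hcb) (he.lor_vertex_self i)
            (he.lor_le_of_baseNormals i hcb hce hcv) hmem hq0 (hqneg c hcb) hx
          rwa [hxv, mul_zero] at this
  refine ⟨heq, fun c hc => ?_, fun c hc => ?_, ⟨r • q, ?_, fun c hc => ?_⟩,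
    fun c hc y hyv hyc => ?_⟩
  · obtain ⟨j, -, rfl⟩ := mem_image_tetraIndex.1 hc
    exact he.lor_self j
  · obtain ⟨j, hj, rfl⟩ := mem_image_tetraIndex.1 hc
    exact he.lor_vertex_of_ne hj
  · rw [truncatedSimplex_eq]
    exact ⟨⟨hmem, lor_zero_right _, hqneg⟩, hq0⟩
  · obtain ⟨j, -, rfl⟩ := mem_image_tetraIndex.1 hc
    rw [lor_smul_left]
    exact mul_neg_of_pos_of_neg hr (h₁ j (Finset.notMem_empty j))
  · obtain ⟨j, hj, rfl⟩ := mem_image_tetraIndex.1 hc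
    obtain ⟨p, hp, hp0, hpj, hpn, -⟩ :=
      he.exists_point_of_vertex_facet i {j} (by simpa using hj.symm) (by simp)
    refine IsFacetSystem.mem_span_of_point heq hp hp0 (hpj j (by simp)) (fun d hd hdj => ?_)
      hyv hyc
    obtain ⟨k, -, rfl⟩ := mem_image_tetraIndex.1 hd
    exact hpn k (by rw [Finset.mem_singleton]; exact fun h => hdj (h ▸ rfl))

theorem _root_.CoxeterDomino.two_le_label {i j : Fin 5} (h : i ≠ j) : 2 ≤ label i j := by
  fin_cases i <;> fin_cases j <;> first | exact absurd rfl h | decide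

theorem coxeterProduct (he : IsSimplexFrame e) : ∀ a ∈ baseNormals e, ∀ b ∈ baseNormals e, a ≠ b →
    CoxeterProduct (lor a b) := by
  have hev : ∀ j k, CoxeterProduct (lor (e j) (vertex e k)) := fun j k => by
    by_cases hjk : j = k
    · rw [hjk]
      exact Or.inl (he.lor_vertex_same k)
    · exact Or.inr ⟨2, le_rfl, by rw [he.lor_vertex_of_ne hjk]; simp⟩
  refine forall_baseNormals.2 ⟨fun i => forall_baseNormals.2 ⟨fun j hij => ?_, fun k _ => hev i k⟩,
    fun i => forall_baseNormals.2 ⟨fun j _ => ?_, fun k hik => ?_⟩⟩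
  · exact Or.inr ⟨label i j, two_le_label fun h => hij (h ▸ rfl), he.1 i j⟩
  · rw [lor_comm]
    exact hev j i
  · exact Or.inl (he.lor_vertex_vertex fun h => hik (h ▸ rfl))

theorem growth_baseNormals (he : IsSimplexFrame e) :
    (1 + X) * numS * growthInv lorForm (baseNormals e : Set LSpace) =
      (1 + X) * (denQ 0 0 0 : PowerSeries ℤ) := by
  have hb := he.isFacetSystem.isRootBasis he.coxeterProduct
  have hfam : CoxeterFamily lorForm label e :=
    ⟨hb.mono (by rintro _ ⟨j, rfl⟩; simp [baseNormals]), he.1, fun _ _ => two_le_label⟩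
  have htet : ∀ i, numS * growthInv lorForm
      ((Finset.univ.image (e ∘ tetraIndex i) : Finset LSpace) : Set LSpace) =
      tetraPoly (facetType i) := fun i => by
    rw [Finset.coe_image, Finset.coe_univ, Set.image_univ]
    refine CoxeterFamily.num_mul_tetra ⟨?_, fun a b => ?_, tetraLabel_two_le _⟩
    · exact hfam.basis.mono (Set.range_comp_subset_range _ _)
    · rw [← label_tetraIndex]
      exact he.1 _ _
  have hsimp := hfam.num_mul_simplex
  -- The truncating normals are added one at a time; each subtracts t/(1 + t) times the facet
  -- polynomial from the polynomial of the simplex.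
  have key : ∀ S : Finset (Fin 5), (1 + X) * numS * growthInv lorForm
      ((Finset.univ.image e ∪ S.image (vertex e) : Finset LSpace) : Set LSpace) =
      (1 + X) * (numS * growthInv lorForm (Set.range e)) - X * ∑ i ∈ S, tetraPoly (facetType i) := by
    intro S
    induction S using Finset.induction with
    | empty => simp [mul_assoc]
    | insert i S hi ih =>
      have hsub : Finset.univ.image e ∪ (insert i S).image (vertex e) ⊆ baseNormals e :=
        Finset.union_subset_union_right (Finset.image_subset_image (Finset.subset_univ _))
      have hne : ∀ j, e j ≠ vertex e i := fun j h => by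
        have h₁ := he.lor_self j
        nth_rewrite 2 [h] at h₁
        by_cases hji : j = i
        · subst hji
          linarith [he.lor_vertex_same j]
        · rw [he.lor_vertex_of_ne hji] at h₁
          exact zero_ne_one h₁
      have hne' : ∀ k ∈ S, vertex e k ≠ vertex e i := fun k hk h => by
        have h₁ := he.lor_vertex_self k
        nth_rewrite 2 [h] at h₁
        linarith [he.lor_vertex_vertex (show k ≠ i from fun h => hi (h ▸ hk))]
      have herase : (Finset.univ.image e ∪ (insert i S).image (vertex e)).erase (vertex e i) =
          Finset.univ.image e ∪ S.image (vertex e) := by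
        rw [Finset.image_insert, Finset.union_insert, Finset.erase_insert]
        simp only [Finset.mem_union, Finset.mem_image, Finset.mem_univ, true_and, not_or,
          not_exists, not_and]
        exact ⟨hne, hne'⟩
      have hg := growthInv_erase (E := Finset.univ.image (e ∘ tetraIndex i)) (f := vertex e i)
        (hb.mono (Finset.coe_subset.2 hsub)) (by simp)
        (fun c hc => by
          obtain ⟨j, -, rfl⟩ := mem_image_tetraIndex.1 hc
          simp)
        (he.isFacetSystem_vertex i).orth
        (fun a ha => he.lor_le_of_baseNormals i (hsub ha))
      rw [herase] at hg
      rw [Finset.sum_insert hi]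
      linear_combination numS * hg - X * htet i + ih
  rw [baseNormals, key, hsimp]
  simp only [Fin.sum_univ_five, facetType, coe_denQ]
  simp [tetraPoly]
  ring

theorem isDominoSystem (he : IsSimplexFrame e) :
    IsDominoSystem 0 0 0 (truncatedSimplex e)
      (fun t => {v | ∃ i, facetType i = t ∧ v = vertex e i}) (baseNormals e) where
  facet := he.isFacetSystem
  nonempty := ⟨e 0, by simp [baseNormals]⟩
  pair := he.coxeterProduct
  mem := by
    rintro t _ ⟨i, -, rfl⟩
    simp [baseNormals]
  orth := by
    rintro t _ ⟨i, rfl, rfl⟩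
    refine ⟨e ∘ tetraIndex i, fun k => by simp [baseNormals], fun a b => ?_,
      he.isFacetSystem_vertex i, fun a ha => he.lor_le_of_baseNormals i ha⟩
    rw [← label_tetraIndex]
    exact he.1 _ _
  sep := by
    rintro t _ ⟨i, -, rfl⟩ t' _ ⟨j, -, rfl⟩ hij
    exact he.lor_vertex_vertex fun h => hij (h ▸ rfl)
  growth := by simpa using he.growth_baseNormals
  le := le_rfl

end IsSimplexFrame

theorem IsDomino.exists_isDominoSystem {l m n : ℕ} {P : Set LSpace} {O : FacetType → Set LSpace}
    (h : IsDomino l m n P O) : ∃ R, IsDominoSystem l m n P O R := by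
  induction h with
  | copy e he => exact ⟨_, he.isDominoSystem⟩
  | glue _ _ X f hf₁ hf₂ hF ih₁ ih₂ =>
    obtain ⟨R₁, h₁⟩ := ih₁
    obtain ⟨R₂, h₂⟩ := ih₂
    exact ⟨_, h₁.glue h₂ hf₁ hf₂ hF⟩

end CoxeterDomino

end

noncomputable section

namespace CoxeterDomino

open Polynomial

/-! ## Divisibility by cyclotomic polynomials -/

theorem cyclotomic_four : cyclotomic 4 ℤ = X ^ 2 + 1 := by
  rw [show 4 = 2 * 2 by rfl, ← cyclotomic_expand_eq_cyclotomic Nat.prime_two dvd_rfl]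
  simp

theorem cyclotomic_five : cyclotomic 5 ℤ = X ^ 4 + X ^ 3 + X ^ 2 + X + 1 := by
  have : Fact (Nat.Prime 5) := ⟨Nat.prime_five⟩
  rw [cyclotomic_prime]
  simp only [Finset.sum_range_succ, Finset.sum_range_zero]
  ring

theorem cyclotomic_ten : cyclotomic 10 ℤ = X ^ 4 - X ^ 3 + X ^ 2 - X + 1 := by
  apply mul_right_cancel₀ (cyclotomic_ne_zero 2 ℤ)
  rw [show 10 = 2 * 5 by rfl, ← cyclotomic_expand_eq_cyclotomic_mul Nat.prime_five (by norm_num1)]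
  simp only [cyclotomic_two, map_add, expand_X, map_one]
  ring

/-- A cyclotomic polynomial is irreducible, and a nonzero remainder of smaller degree excludes
divisibility. -/
theorem isRelPrime_cyclotomic_of_eq {k : ℕ} {p q r : ℤ[X]} (hk : 0 < k)
    (h : p = cyclotomic k ℤ * q + r) (hr : r ≠ 0) (hd : r.natDegree < k.totient) :
    IsRelPrime (cyclotomic k ℤ) p := by
  rw [(cyclotomic.irreducible hk).isRelPrime_iff_not_dvd, h, dvd_add_right (dvd_mul_right _ _)]
  exact (cyclotomic.monic k ℤ).not_dvd_of_natDegree_lt hr (by rwa [natDegree_cyclotomic])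

variable {l m n : ℤ}

/-- The remainder is Q(-1) = 84 + 8ℓ - 52m + 68n, which is positive since m ≤ n. -/
theorem isRelPrime_cyclotomic_two_denQ (hl : 0 ≤ l) (hm : 0 ≤ m) (hn : l + m ≤ n) :
    IsRelPrime (cyclotomic 2 ℤ) (denQ l m n) := by
  have h : denQ l m n = cyclotomic 2 ℤ * (X ^ 17 + (-7 - 4 * C n) * X ^ 16 + (10 - C m + 6 * C n) * X ^ 15
      + (-15 - C l + 2 * C m - 9 * C n) * X ^ 14
      + (20 + C l - 5 * C m + 14 * C n) * X ^ 13
      + (-21 - C l + 9 * C m - 15 * C n) * X ^ 12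
      + (30 + 2 * C l - 13 * C m + 23 * C n) * X ^ 11
      + (-30 - 3 * C l + 18 * C m - 23 * C n) * X ^ 10
      + (41 + 4 * C l - 23 * C m + 33 * C n) * X ^ 9
      + (-43 - 4 * C l + 29 * C m - 35 * C n) * X ^ 8
      + (54 + 5 * C l - 34 * C m + 45 * C n) * X ^ 7
      + (-54 - 6 * C l + 39 * C m - 45 * C n) * X ^ 6
      + (63 + 7 * C l - 43 * C m + 53 * C n) * X ^ 5
      + (-64 - 7 * C l + 47 * C m - 54 * C n) * X ^ 4
      + (69 + 7 * C l - 50 * C m + 59 * C n) * X ^ 3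
      + (-74 - 8 * C l + 51 * C m - 62 * C n) * X ^ 2
      + (77 + 8 * C l - 52 * C m + 64 * C n) * X + (-83 - 8 * C l + 52 * C m - 68 * C n)) +
      C (84 + 8 * l - 52 * m + 68 * n) := by
    rw [cyclotomic_two]
    simp only [denQ, C_add, C_sub, C_mul, map_ofNat, C_1]
    ring
  refine isRelPrime_cyclotomic_of_eq (by norm_num) h (fun h0 => ?_) ?_
  · have h1 := congrArg (coeff · 0) h0
    simp at h1
    omega
  · rw [show Nat.totient 2 = 1 by decide]
    refine lt_of_le_of_lt ?_ (show 0 < 1 by norm_num)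
    compute_degree

theorem isRelPrime_cyclotomic_three_denQ (hn : 0 ≤ n) :
    IsRelPrime (cyclotomic 3 ℤ) (denQ l m n) := by
  have h : denQ l m n = cyclotomic 3 ℤ * (X ^ 16 + (-7 - 4 * C n) * X ^ 15 + (9 - C m + 6 * C n) * X ^ 14
      + (-7 - C l + 2 * C m - 5 * C n) * X ^ 13 + (3 + C l - 4 * C m + 4 * C n) * X ^ 12
      + (3 + 6 * C m) * X ^ 11 + (3 - 6 * C m + 4 * C n) * X ^ 10
      + (-6 - C l + 5 * C m - 4 * C n) * X ^ 9
      + (14 + 2 * C l - 4 * C m + 10 * C n) * X ^ 8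
      + (-10 - C l + 5 * C m - 8 * C n) * X ^ 7 + (7 - 6 * C m + 8 * C n) * X ^ 6
      + (3 + 6 * C m) * X ^ 5 + (-1 + C l - 4 * C m) * X ^ 4
      + (-3 - C l + 2 * C m - C n) * X ^ 3 + (9 - C m + 6 * C n) * X ^ 2
      + (-11 - 8 * C n) * X + (5 + 4 * C n)) +
      C (-4 - 4 * n) := by
    rw [cyclotomic_three]
    simp only [denQ, C_add, C_sub, C_mul, C_neg, map_ofNat, C_1]
    ring
  refine isRelPrime_cyclotomic_of_eq (by norm_num) h (fun h0 => ?_) ?_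
  · have h1 := congrArg (coeff · 0) h0
    simp at h1
    omega
  · rw [show Nat.totient 3 = 2 by decide]
    refine lt_of_le_of_lt ?_ (show 0 < 2 by norm_num)
    compute_degree

/-- The remainder is a multiple of t, with coefficient at most -6 - 2n because 4ℓ + 2m ≤ 4n. -/
theorem isRelPrime_cyclotomic_four_denQ (hm : 0 ≤ m) (hl : 0 ≤ l) (hn : l + m ≤ n) :
    IsRelPrime (cyclotomic 4 ℤ) (denQ l m n) := by
  have h : denQ l m n = cyclotomic 4 ℤ * (X ^ 16 + (-6 - 4 * C n) * X ^ 15 + (2 - C m + 2 * C n) * X ^ 14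
      + (1 - C l + C m + C n) * X ^ 13 + (3 - 2 * C m + 3 * C n) * X ^ 12
      + (-2 + C l + 3 * C m - 2 * C n) * X ^ 11 + (6 + C l - 2 * C m + 5 * C n) * X ^ 10
      + (2 - 2 * C l + 2 * C m + 2 * C n) * X ^ 9 + (5 - 3 * C m + 5 * C n) * X ^ 8
      + (-4 + 2 * C l + 4 * C m - 4 * C n) * X ^ 7
      + (6 + C l - 2 * C m + 5 * C n) * X ^ 6 + (4 - 3 * C l + C m + 4 * C n) * X ^ 5
      + (3 - 2 * C m + 3 * C n) * X ^ 4 + (-5 + 3 * C l + 3 * C m - 5 * C n) * X ^ 3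
      + (2 - C m + 2 * C n) * X ^ 2 + (-4 * C l - 2 * C m + 2 * C n) * X + 1) +
      C (-6 + 4 * l + 2 * m - 6 * n) * X := by
    rw [cyclotomic_four]
    simp only [denQ, C_add, C_sub, C_mul, C_neg, map_ofNat, C_1]
    ring
  refine isRelPrime_cyclotomic_of_eq (by norm_num) h (fun h0 => ?_) ?_
  · have h1 := congrArg (coeff · 1) h0
    simp at h1
    omega
  · rw [show Nat.totient 4 = 2 by decide]
    refine lt_of_le_of_lt ?_ (show 1 < 2 by norm_num)
    compute_degree

theorem isRelPrime_cyclotomic_five_denQ (hn : 0 ≤ n) :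
    IsRelPrime (cyclotomic 5 ℤ) (denQ l m n) := by
  have h : denQ l m n = cyclotomic 5 ℤ * (X ^ 14 + (-7 - 4 * C n) * X ^ 13 + (9 - C m + 6 * C n) * X ^ 12
      + (-8 - C l + 2 * C m - 5 * C n) * X ^ 11
      + (10 + C l - 4 * C m + 8 * C n) * X ^ 10 + (-5 + 7 * C m - 6 * C n) * X ^ 9
      + (3 + C l - 8 * C m + 5 * C n) * X ^ 8 + (-2 * C l + 8 * C m - 2 * C n) * X ^ 7
      + (3 + C l - 8 * C m + 5 * C n) * X ^ 6 + (-3 + 7 * C m - 4 * C n) * X ^ 5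
      + (8 + C l - 4 * C m + 6 * C n) * X ^ 4 + (-8 - C l + 2 * C m - 5 * C n) * X ^ 3
      + (9 - C m + 6 * C n) * X ^ 2 + (-7 - 4 * C n) * X + (3 + 2 * C n)) +
      C (-2 - 2 * n) * (X ^ 3 + X ^ 2 + X + 1) := by
    rw [cyclotomic_five]
    simp only [denQ, C_add, C_sub, C_mul, C_neg, map_ofNat, C_1]
    ring
  refine isRelPrime_cyclotomic_of_eq (by norm_num) h (fun h0 => ?_) ?_
  · have h1 := congrArg (coeff · 0) h0
    simp at h1
    omega
  · rw [show Nat.totient 5 = 4 by decide]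
    refine lt_of_le_of_lt ?_ (show 3 < 4 by norm_num)
    compute_degree

theorem isRelPrime_cyclotomic_six_denQ (hl : 0 ≤ l) (hm : 0 ≤ m) (hn : l + m ≤ n) :
    IsRelPrime (cyclotomic 6 ℤ) (denQ l m n) := by
  have h : denQ l m n = cyclotomic 6 ℤ * (X ^ 16 + (-5 - 4 * C n) * X ^ 15 + (-3 - C m - 2 * C n) * X ^ 14
      + (-3 - C l - C n) * X ^ 13 + (5 - C l - 2 * C m + 6 * C n) * X ^ 12
      + (7 + 2 * C m + 6 * C n) * X ^ 11 + (11 + 2 * C l + 8 * C n) * X ^ 10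
      + (4 + C l + 3 * C m + 2 * C n) * X ^ 9 + (4 - 2 * C m + 4 * C n) * X ^ 8
      + (-2 - C l + C m) * X ^ 7 + (5 - 2 * C m + 6 * C n) * X ^ 6
      + (7 + 2 * C m + 6 * C n) * X ^ 5 + (11 + C l + 8 * C n) * X ^ 4
      + (3 + C l + 2 * C m + C n) * X ^ 3 + (-3 - C m - 2 * C n) * X ^ 2
      + (-11 - 2 * C l - 2 * C m - 6 * C n) * X + (-5 - 2 * C l - 2 * C m - 2 * C n)) +
      C (6 + 2 * l + 2 * m + 2 * n) := by
    rw [cyclotomic_six]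
    simp only [denQ, C_add, C_sub, C_mul, map_ofNat, C_1]
    ring
  refine isRelPrime_cyclotomic_of_eq (by norm_num) h (fun h0 => ?_) ?_
  · have h1 := congrArg (coeff · 0) h0
    simp at h1
    omega
  · rw [show Nat.totient 6 = 2 by decide]
    refine lt_of_le_of_lt ?_ (show 0 < 2 by norm_num)
    compute_degree

theorem isRelPrime_cyclotomic_ten_denQ (hl : 0 ≤ l) (hm : 0 ≤ m) (hn : l + m ≤ n) :
    IsRelPrime (cyclotomic 10 ℤ) (denQ l m n) := by
  have h : denQ l m n = cyclotomic 10 ℤ * (X ^ 14 + (-5 - 4 * C n) * X ^ 13 + (-3 - C m - 2 * C n) * X ^ 12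
      + (-2 - C l - C n) * X ^ 11 + (-C l - 2 * C m + 2 * C n) * X ^ 10
      + (3 + C m + 4 * C n) * X ^ 9 + (13 + C l + 11 * C n) * X ^ 8
      + (12 + 2 * C m + 10 * C n) * X ^ 7 + (13 + C l + 11 * C n) * X ^ 6
      + (9 + 2 * C l + 3 * C m + 6 * C n) * X ^ 5 + (6 + C l + 4 * C n) * X ^ 4
      + (-2 - C l - C n) * X ^ 3 + (-3 - C m - 2 * C n) * X ^ 2 + (-5 - 4 * C n) * X
      + (-5 - 2 * C l - 2 * C m - 2 * C n)) +
      C (6 + 2 * l + 2 * m + 2 * n) * (1 - X + X ^ 2 - X ^ 3) := by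
    rw [cyclotomic_ten]
    simp only [denQ, C_add, C_sub, C_mul, map_ofNat, C_1]
    ring
  refine isRelPrime_cyclotomic_of_eq (by norm_num) h (fun h0 => ?_) ?_
  · have h1 := congrArg (coeff · 0) h0
    simp at h1
    omega
  · rw [show Nat.totient 10 = 4 by decide]
    refine lt_of_le_of_lt ?_ (show 3 < 4 by norm_num)
    compute_degree

end CoxeterDomino

end

noncomputable section

/-! ### Factorization of P, symmetry of Q, coprimality, and the conclusion. -/

namespace CoxeterDomino

open Polynomial

theorem numP_eq_cyclotomic : numP = cyclotomic 2 ℤ ^ 4 * cyclotomic 3 ℤ * cyclotomic 4 ℤ *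
    cyclotomic 5 ℤ * cyclotomic 6 ℤ * cyclotomic 10 ℤ := by
  rw [cyclotomic_two, cyclotomic_three, cyclotomic_four, cyclotomic_five, cyclotomic_six,
    cyclotomic_ten]
  simp only [numP, bracket, Finset.sum_range_succ, Finset.sum_range_zero]
  ring

theorem coe_numP : (numP : PowerSeries ℤ) = numS := by
  rw [← coeToPowerSeries.ringHom_apply]
  simp [numP, numS, bracket, Finset.sum_range_succ]

theorem natDegree_denQ (l m n : ℤ) : (denQ l m n).natDegree = 18 := by
  unfold denQ
  compute_degree!

theorem reverse_denQ (l m n : ℤ) : (denQ l m n).reverse = denQ l m n := by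
  rw [reverse, natDegree_denQ]
  have hX : ∀ c : ℤ, reflect 18 (C c * X) = C c * X ^ 17 := fun c => by
    simpa [revAt_le] using reflect_C_mul_X_pow 18 1 (c := c)
  simp only [denQ, reflect_add, reflect_sub, reflect_C_mul_X_pow, hX, reflect_monomial,
    reflect_one]
  simp only [revAt_le, Nat.reduceLeDiff, Nat.reduceSub, pow_zero, pow_one, le_refl, Nat.sub_self]
  ring

theorem isRelPrime_numP_denQ {l m n : ℕ} (h : l + m ≤ n) : IsRelPrime numP (denQ l m n) := by
  have hl : (0 : ℤ) ≤ l := l.cast_nonneg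
  have hm : (0 : ℤ) ≤ m := m.cast_nonneg
  have hn : (l : ℤ) + m ≤ n := by exact_mod_cast h
  have hn' : (0 : ℤ) ≤ n := n.cast_nonneg
  rw [numP_eq_cyclotomic]
  exact ((((((isRelPrime_cyclotomic_two_denQ hl hm hn).pow_left).mul_left
    (isRelPrime_cyclotomic_three_denQ hn')).mul_left
    (isRelPrime_cyclotomic_four_denQ hm hl hn)).mul_left
    (isRelPrime_cyclotomic_five_denQ hn')).mul_left
    (isRelPrime_cyclotomic_six_denQ hl hm hn)).mul_left
    (isRelPrime_cyclotomic_ten_denQ hl hm hn)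

/-! ## The growth series of a domino -/

theorem facetReflections_eq {P : Set LSpace} {R : Finset LSpace} (h : IsFacetSystem 0 P R)
    (hR : R.Nonempty) : facetReflections P = refls lorForm (R : Set LSpace) := by
  ext s
  simp only [facetReflections, h.facetNormals_eq hR, refls, Set.mem_ofPred_eq, Set.mem_image]
  refine exists_congr fun a => and_congr_right fun ha => ?_
  have hx : ∀ x, refl lorForm a x = x - (2 * lor x a) • a := fun x => by
    rw [refl_apply (h.unit a ha), lorForm_apply, lor_comm]
  constructor
  · exact fun hs => LinearEquiv.ext fun x => by rw [hx, hs]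
  · rintro rfl
    exact hx

theorem IsDominoSystem.growthSeries_mul {l m n : ℕ} {P : Set LSpace}
    {O : FacetType → Set LSpace} {R : Finset LSpace} (h : IsDominoSystem l m n P O R) :
    growthSeries (facetReflections P) * (denQ l m n : PowerSeries ℤ) = (numP : PowerSeries ℤ) := by
  have hQ : numS * growthInv lorForm (R : Set LSpace) = (denQ l m n : PowerSeries ℤ) := by
    -- Here 1 + t, carried along through the gluings, is cancelled.
    refine mul_left_cancel₀ (CoxeterFamily.one_add_X_pow_ne_zero 0) ?_
    rw [zero_add, pow_one, ← mul_assoc, h.growth]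
  rw [facetReflections_eq h.facet h.nonempty, ← growth_eq_growthSeries, ← hQ, mul_left_comm,
    growth_mul_growthInv, mul_one, coe_numP]

end CoxeterDomino

end

theorem mainTheorem3 (ℓ m n : ℕ) (P : Set CoxeterDomino.LSpace)
    (O : CoxeterDomino.FacetType → Set CoxeterDomino.LSpace)
    (hP : CoxeterDomino.IsDomino ℓ m n P O) :
    (CoxeterDomino.facetNormals P).Finite ∧
    CoxeterDomino.growthSeries (CoxeterDomino.facetReflections P) *
        (CoxeterDomino.denQ ℓ m n : PowerSeries ℤ) = (CoxeterDomino.numP : PowerSeries ℤ) ∧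
    CoxeterDomino.numP =
      Polynomial.cyclotomic 2 ℤ ^ 4 * Polynomial.cyclotomic 3 ℤ * Polynomial.cyclotomic 4 ℤ *
        Polynomial.cyclotomic 5 ℤ * Polynomial.cyclotomic 6 ℤ * Polynomial.cyclotomic 10 ℤ ∧
    (CoxeterDomino.denQ ℓ m n).natDegree = 18 ∧
    (CoxeterDomino.denQ ℓ m n).reverse = CoxeterDomino.denQ ℓ m n ∧
    IsRelPrime CoxeterDomino.numP (CoxeterDomino.denQ ℓ m n) := by
  obtain ⟨R, hR⟩ := hP.exists_isDominoSystem
  refine ⟨?_, hR.growthSeries_mul, CoxeterDomino.numP_eq_cyclotomic,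
    CoxeterDomino.natDegree_denQ _ _ _, CoxeterDomino.reverse_denQ _ _ _,
    CoxeterDomino.isRelPrime_numP_denQ hR.le⟩
  rw [hR.facet.facetNormals_eq hR.nonempty]
  exact R.finite_toSet
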